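/- Let $n\ge 3$ and let $G$ be the simply connected simple complex algebraic group of type $D_n$ (with $D_3=A_3$), with nodes $I=\{1,\dots,n\}$ of the Dynkin diagram numbered so that $1,2,\dots,n-2$ is a chain and both $n-1$ and $n$ are joined to $n-2$. Let $e_i,f_i$ be the Chevalley generators, $x_i(t)=\exp(te_i)$, $y_i(t)=\exp(tf_i)$, let $U^{\pm}$ be the maximal unipotent subgroups generated by the $x_i(t)$, respectively the $y_i(t)$, let $\alpha_i^\vee(c)$ ($c\in\mathbb C^\times$) be the simple coroot subgroups, $T$ the maximal torus generated by them, $\Lambda_1,\dots,\Lambda_n$ the fundamental weights, $W$ the Weyl group with simple reflections $s_i$ and longest element $w_0$. Put $\overline{s}_i=x_i(-1)y_i(1)x_i(-1)$ and $\overline{w}=\overline{s}_{i_1}\cdots\overline{s}_{i_l}$ for a reduced word $i_1\dots i_l$ of $w\in W$. Let $\Delta_{\Lambda_k}$ be the principal minor, i.e. the unique regular function on $G$ with $\Delta_{\Lambda_k}(u^-tu^+)=\Lambda_k(t)$ for all $u^\pm\in U^\pm$, $t\in T$ (it exists for every $k\in I$), and let $\Delta_{u\Lambda_k,v\Lambda_k}(g)=\Delta_{\Lambda_k}(\overline{u}^{\,-1}g\,\overline{v})$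 for $u,v\in W$ be the generalized minors. The word $\mathbf i_0=(1\,2\cdots n)^{n-1}$ is a reduced word of $w_0$. For $c=(c^{(1)}_1,\dots,c^{(1)}_n,c^{(2)}_1,\dots,c^{(n-1)}_n)\in(\mathbb C^\times)^{n(n-1)}$ let $$\Theta^-_{\mathbf i_0}(c)=\prod_{l=1}^{n-1}\Bigl(\boldsymbol y_1(c^{(l)}_1)\,\boldsymbol y_2(c^{(l)}_2)\cdots\boldsymbol y_n(c^{(l)}_n)\Bigr),\qquad \boldsymbol y_i(a)=y_i(a)\,\alpha_i^\vee(a^{-1}),$$ where the factors $l=1,\dots,n-1$ are ordered from left to right. Then for every such $c$ and every $k\in\{1,\dots,n-2\}$ $$\Delta_{w_0\Lambda_k,s_k\Lambda_k}(\Theta^-_{\mathbf i_0}(c))=c^{(k)}_1+\sum_{j=2}^{n-2}\frac{c^{(k)}_j}{c^{(k+1)}_{j-1}}+\frac{c^{(k)}_{n-1}c^{(k)}_n}{c^{(k+1)}_{n-2}}+\frac{c^{(k+1)}_{n-2}}{c^{(k+1)}_{n-1}c^{(k+1)}_n}+\frac{c^{(k)}_n}{c^{(k+1)}_{n-1}}+\frac{c^{(k)}_{n-1}}{c^{(k+1)}_n}+\sum_{j=k+2}^{n-1}\frac{c^{(j)}_{n-1+k-j}}{c^{(j)}_{n+k-j}},$$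 and for the two spin weights $$\Delta_{w_0\Lambda_{n-1},s_{n-1}\Lambda_{n-1}}(\Theta^-_{\mathbf i_0}(c))=c^{(n-1)}_{n-1},\qquad \Delta_{w_0\Lambda_{n},s_{n}\Lambda_{n}}(\Theta^-_{\mathbf i_0}(c))=c^{(n-1)}_{n}.$$ -/

import Mathlib

/-! The simply connected complex group of type `D_n`, realised as a Chevalley group: the subgroup of
the general linear group of `V(Λ₁) ⊕ V(Λ_{n-1}) ⊕ V(Λ_n)` (vector and two half-spin modules)
generated by the one-parameter subgroups of the Chevalley generators.  The weights of this module
span the whole weight lattice, so the group is the simply connected one.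
Nodes `1, …, n` of the Dynkin diagram are the elements `0, …, n-1` of `Fin n`; the last two are
the spin nodes. -/

noncomputable section

namespace TypeD

/-! ### The module -/

/-- Basis of the vector representation `V(Λ₁)`: `inl i` is `v_{i+1}`, `inr i` is `v_{\overline{i+1}}`. -/
abbrev VecIdx (n : ℕ) := Fin n ⊕ Fin n

/-- Basis of the sum of the two half-spin representations: all sign vectors `(ε₁, …, ε_n)`,
with `true` for `+`.  The vectors with an even (odd) number of minus signs span
`V(Λ_n)` (`V(Λ_{n-1})`). -/
abbrev SpinIdx (n : ℕ) := Fin n → Bool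

/-- Basis of `V(Λ₁) ⊕ V(Λ_{n-1}) ⊕ V(Λ_n)`. -/
abbrev Idx (n : ℕ) := VecIdx n ⊕ SpinIdx n

/-- `VecRaise i b a` says `e_i b = a` for the basis vectors `b`, `a` of `V(Λ₁)`:
`e_i v_{i+1} = v_i` and `e_i v_{\bar i} = v_{\overline{i+1}}` for `i < n`, and
`e_n v_{\overline{n-1}} = v_n`, `e_n v_{\bar n} = v_{n-1}`. -/
def VecRaise {n : ℕ} (i : Fin n) : VecIdx n → VecIdx n → Prop
  | .inl b, .inl a => a = i ∧ b.val = i.val + 1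
  | .inr b, .inr a => b = i ∧ a.val = i.val + 1
  | .inr b, .inl a => i.val + 1 = n ∧ ((b.val + 1 = i.val ∧ a = i) ∨ (b = i ∧ a.val + 1 = i.val))
  | .inl _, .inr _ => False

/-- `SpinRaise i b a` says `e_i b = a` for sign vectors `b`, `a`: for `i < n` the signs
`(ε_i, ε_{i+1}) = (-, +)` become `(+, -)`, and for `i = n` the signs
`(ε_{n-1}, ε_n) = (-, -)` become `(+, +)`. -/
def SpinRaise {n : ℕ} (i : Fin n) (b a : SpinIdx n) : Prop :=
  (∃ j : Fin n, j.val = i.val + 1 ∧ b i = false ∧ b j = true ∧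
      a = Function.update (Function.update b i true) j false) ∨
  (i.val + 1 = n ∧ ∃ j : Fin n, j.val + 1 = i.val ∧ b j = false ∧ b i = false ∧
      a = Function.update (Function.update b j true) i true)

/-- `Raise i b a` says `e_i b = a`; if there is no such `a` then `e_i b = 0`. -/
def Raise {n : ℕ} (i : Fin n) : Idx n → Idx n → Prop
  | .inl b, .inl a => VecRaise i b a
  | .inr b, .inr a => SpinRaise i b a
  | _, _ => False

open scoped Classical in
/-- The Chevalley generator `e_i` acting on the module (columns are images of basis vectors). -/
def e {n : ℕ} (i : Fin n) : Matrix (Idx n) (Idx n) ℂ :=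
  Matrix.of fun a b => if Raise i b a then 1 else 0

open scoped Classical in
/-- The Chevalley generator `f_i`: `f_i a = b` exactly when `e_i b = a`. -/
def f {n : ℕ} (i : Fin n) : Matrix (Idx n) (Idx n) ℂ :=
  Matrix.of fun b a => if Raise i b a then 1 else 0

theorem Raise.not_raise {n : ℕ} {i : Fin n} {a b c : Idx n} (h : Raise i b a) :
    ¬ Raise i a c := by
  intro h'
  rcases b with (b | b) | b <;> rcases a with (a | a) | a <;> rcases c with (c | c) | c <;>
    simp only [Raise, VecRaise] at h h'
  all_goals try (simp only [Fin.ext_iff] at h h'; omega)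
  have ha : a i = true := by
    rcases h with ⟨j, hj, -, -, rfl⟩ | ⟨-, j, -, -, -, rfl⟩
    · have : i ≠ j := by intro hij; rw [← hij] at hj; omega
      simp [Function.update_of_ne this]
    · simp
  rcases h' with ⟨j, -, h1, -⟩ | ⟨-, j, -, -, h1, -⟩ <;> simp [ha] at h1

theorem e_mul_e {n : ℕ} (i : Fin n) : e i * e i = 0 := by
  ext a c
  simp only [e, Matrix.mul_apply, Matrix.of_apply, Matrix.zero_apply]
  refine Finset.sum_eq_zero fun b _ => ?_
  by_cases h : Raise i c b
  · simp [h.not_raise]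
  · simp [h]

theorem f_mul_f {n : ℕ} (i : Fin n) : f i * f i = 0 := by
  ext a c
  simp only [f, Matrix.mul_apply, Matrix.of_apply, Matrix.zero_apply]
  refine Finset.sum_eq_zero fun b _ => ?_
  by_cases h : Raise i a b
  · simp [h.not_raise]
  · simp [h]

/-- For `A² = 0` the invertible matrix `exp (t A) = 1 + t A`. -/
def expUnit {n : ℕ} (A : Matrix (Idx n) (Idx n) ℂ) (hA : A * A = 0) (t : ℂ) :
    (Matrix (Idx n) (Idx n) ℂ)ˣ where
  val := 1 + t • A
  inv := 1 - t • A
  val_inv := by simp [add_mul, mul_sub, hA]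
  inv_val := by simp [sub_mul, mul_add, hA]

theorem expUnit_val {n : ℕ} (A : Matrix (Idx n) (Idx n) ℂ) (hA : A * A = 0) (t : ℂ) :
    ((expUnit A hA t : (Matrix (Idx n) (Idx n) ℂ)ˣ) : Matrix (Idx n) (Idx n) ℂ) =
      IsNilpotent.exp (t • A) := by
  have h : (t • A) ^ 2 = 0 := by simp [pow_two, hA]
  rw [IsNilpotent.exp_eq_sum h]
  simp [expUnit, Finset.sum_range_succ]

/-! ### The group and its subgroups -/

/-- The simply connected group `G` of type `D_n`, generated by `exp (t e_i)` and `exp (t f_i)`. -/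
def G (n : ℕ) : Subgroup (Matrix (Idx n) (Idx n) ℂ)ˣ :=
  Subgroup.closure
    (Set.range (fun p : Fin n × ℂ => expUnit (e p.1) (e_mul_e p.1) p.2) ∪
      Set.range (fun p : Fin n × ℂ => expUnit (f p.1) (f_mul_f p.1) p.2))

/-- `x_i(t) = exp (t e_i)`. -/
def x {n : ℕ} (i : Fin n) (t : ℂ) : G n :=
  ⟨expUnit (e i) (e_mul_e i) t, Subgroup.subset_closure (Or.inl ⟨(i, t), rfl⟩)⟩

/-- `y_i(t) = exp (t f_i)`. -/
def y {n : ℕ} (i : Fin n) (t : ℂ) : G n :=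
  ⟨expUnit (f i) (f_mul_f i) t, Subgroup.subset_closure (Or.inr ⟨(i, t), rfl⟩)⟩

/-- The representative `\bar s_i = x_i(-1) y_i(1) x_i(-1)` of the simple reflection `s_i`. -/
def sBar {n : ℕ} (i : Fin n) : G n := x i (-1) * y i 1 * x i (-1)

/-- The coroot subgroup `α_i^∨(c) = φ_i (diag (c, c⁻¹))`, for `c ≠ 0`, where `φ_i : SL₂ → G` sends
the elementary matrices to `x_i(t)`, `y_i(t)`; in `SL₂` one has
`diag (c, c⁻¹) = (1 c; 0 1) (1 0; -c⁻¹ 1) (1 c; 0 1) · (1 -1; 0 1) (1 0; 1 1) (1 -1; 0 1)`. -/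
def alphaCheck {n : ℕ} (i : Fin n) (c : ℂ) : G n := x i c * y i (-c⁻¹) * x i c * sBar i

/-- The maximal unipotent subgroup `U = U⁺`, generated by the simple root subgroups `x_i(ℂ)`. -/
def Uplus (n : ℕ) : Subgroup (G n) :=
  Subgroup.closure (Set.range fun p : Fin n × ℂ => x p.1 p.2)

/-- The maximal unipotent subgroup `U⁻`, generated by the `y_i(ℂ)`. -/
def Uminus (n : ℕ) : Subgroup (G n) :=
  Subgroup.closure (Set.range fun p : Fin n × ℂ => y p.1 p.2)

/-- The general element `∏ α_i^∨(a_i)` of the maximal torus `T ≅ (ℂ^×)^n`. -/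
def torus {n : ℕ} (a : Fin n → ℂˣ) : G n := (List.ofFn fun i => alphaCheck i (a i : ℂ)).prod

/-! ### The Weyl group -/

/-- The simple root `α_i` as a linear form on the Cartan subalgebra `𝔱 = ⨁ ℂ h_j`, identified with
`Fin n → ℂ` by the basis of simple coroots: `α_i(h_j) = a_{j i}`, the Cartan matrix of type `D_n`. -/
def simpleRoot {n : ℕ} (i : Fin n) : Module.Dual ℂ (Fin n → ℂ) :=
  ∑ j, ((CartanMatrix.D n j i : ℤ) : ℂ) • LinearMap.proj j

theorem simpleRoot_coroot {n : ℕ} (i : Fin n) : simpleRoot i (Pi.single i (1 : ℂ)) = 2 := by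
  rw [simpleRoot, LinearMap.sum_apply, Finset.sum_eq_single i]
  · simp [CartanMatrix.D]
  · intro j _ hj
    simp [Pi.single_eq_of_ne hj]
  · simp

/-- The simple reflection `s_i(h) = h - α_i(h) h_i` of `𝔱`. -/
def simpleReflection {n : ℕ} (i : Fin n) : (Fin n → ℂ) ≃ₗ[ℂ] (Fin n → ℂ) :=
  Module.reflection (simpleRoot_coroot i)

/-- The Weyl group. -/
def weylGroup (n : ℕ) : Subgroup ((Fin n → ℂ) ≃ₗ[ℂ] (Fin n → ℂ)) :=
  Subgroup.closure (Set.range simpleReflection)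

/-- The simple reflection `s_i` as an element of the Weyl group. -/
def s {n : ℕ} (i : Fin n) : weylGroup n :=
  ⟨simpleReflection i, Subgroup.subset_closure ⟨i, rfl⟩⟩

/-- `i₁ … i_l` is a reduced word of `w`: `w = s_{i₁} ⋯ s_{i_l}` with `l` minimal. -/
def IsReducedWord {n : ℕ} (l : List (Fin n)) (w : weylGroup n) : Prop :=
  (l.map s).prod = w ∧ ∀ l' : List (Fin n), (l'.map s).prod = w → l.length ≤ l'.length

theorem exists_word {n : ℕ} (w : weylGroup n) : ∃ l : List (Fin n), (l.map s).prod = w := by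
  have hinv : ∀ i : Fin n, (simpleReflection i)⁻¹ = simpleReflection i := fun i => by
    rw [inv_eq_iff_mul_eq_one]
    ext1 h
    exact Module.involutive_reflection (simpleRoot_coroot i) h
  suffices h : ∀ g ∈ weylGroup n, ∃ l : List (Fin n), (l.map simpleReflection).prod = g by
    obtain ⟨l, hl⟩ := h w.1 w.2
    refine ⟨l, Subtype.ext ?_⟩
    rw [← hl, ← Subgroup.coe_subtype, map_list_prod, List.map_map]
    rfl
  intro g hg
  induction hg using Subgroup.closure_induction with
  | mem g hg => obtain ⟨i, rfl⟩ := hg; exact ⟨[i], by simp⟩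
  | one => exact ⟨[], rfl⟩
  | mul a b _ _ ha hb =>
    obtain ⟨l, rfl⟩ := ha
    obtain ⟨l', rfl⟩ := hb
    exact ⟨l ++ l', by simp⟩
  | inv a _ ha =>
    obtain ⟨l, rfl⟩ := ha
    refine ⟨l.reverse, ?_⟩
    rw [List.prod_inv_reverse, List.map_map, List.map_reverse]
    exact congrArg (fun m => (List.reverse m).prod) (List.map_congr_left fun i _ => (hinv i).symm)

theorem exists_reducedWord {n : ℕ} (w : weylGroup n) :
    ∃ l : List (Fin n), IsReducedWord l w := by
  classical
  have h : ∃ m : ℕ, ∃ l : List (Fin n), (l.map s).prod = w ∧ l.length = m := by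
    obtain ⟨l, hl⟩ := exists_word w
    exact ⟨_, l, hl, rfl⟩
  obtain ⟨l, hl, hm⟩ := Nat.find_spec h
  exact ⟨l, hl, fun l' hl' => hm ▸ Nat.find_min' h ⟨l', hl', rfl⟩⟩

/-- A reduced word of `w`. -/
def reducedWord {n : ℕ} (w : weylGroup n) : List (Fin n) := (exists_reducedWord w).choose

/-- The length `ℓ(w)` of a Weyl group element. -/
def length {n : ℕ} (w : weylGroup n) : ℕ := (reducedWord w).length

/-- The longest element of the Weyl group. -/
def IsLongest {n : ℕ} (w : weylGroup n) : Prop := ∀ w' : weylGroup n, length w' ≤ length w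

/-- The representative `\bar w = \bar s_{i₁} ⋯ \bar s_{i_l}` of `w`, for a reduced word
`i₁ … i_l` of `w`. -/
def lift {n : ℕ} (w : weylGroup n) : G n := ((reducedWord w).map sBar).prod

/-! ### Generalized minors -/

/-- Regular functions on the closed subgroup `G` of the special linear group: the polynomials in
the matrix entries. -/
def IsRegular {n : ℕ} (F : G n → ℂ) : Prop :=
  ∃ P : MvPolynomial (Idx n × Idx n) ℂ,
    ∀ g : G n, F g = MvPolynomial.eval (fun p => (g : (Matrix (Idx n) (Idx n) ℂ)ˣ).val p.1 p.2) P

/-- `F` is the principal minor `Δ_μ` of the dominant weight `μ = ∑ μ_i Λ_i`: the regular function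
on `G` with `Δ_μ(u⁻ t u⁺) = μ(t)` for `u^± ∈ U^±` and `t ∈ T`.  Here
`μ(∏ α_i^∨(a_i)) = ∏ a_i ^ μ_i`, because `Λ_j(h_i) = δ_{i j}`. -/
def IsPrincipalMinor {n : ℕ} (μ : Fin n → ℕ) (F : G n → ℂ) : Prop :=
  IsRegular F ∧
    ∀ u ∈ Uminus n, ∀ a : Fin n → ℂˣ, ∀ u' ∈ Uplus n,
      F (u * torus a * u') = ∏ i, (a i : ℂ) ^ μ i

/-- The principal minor `Δ_μ`. -/
def principalMinor {n : ℕ} (μ : Fin n → ℕ) : G n → ℂ := Classical.epsilon (IsPrincipalMinor μ)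

/-- The generalized minor `Δ_{uμ, vμ}(g) = Δ_μ(\bar u⁻¹ g \bar v)`. -/
def generalizedMinor {n : ℕ} (μ : Fin n → ℕ) (u v : weylGroup n) (g : G n) : ℂ :=
  principalMinor μ ((lift u)⁻¹ * g * lift v)

/-- The fundamental weight `Λ_k`. -/
def fundamentalWeight {n : ℕ} (k : Fin n) : Fin n → ℕ := Pi.single k 1

/-! ### The parametrisation -/

/-- `𝐲_i(c) = y_i(c) α_i^∨(c⁻¹)`. -/
def yBold {n : ℕ} (i : Fin n) (c : ℂ) : G n := y i c * alphaCheck i c⁻¹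

/-- `Θ⁻_𝐢(c₁, …, c_N) = 𝐲_{i₁}(c₁) ⋯ 𝐲_{i_N}(c_N)`, for a word `𝐢 = i₁ … i_N`. -/
def thetaMinus {n : ℕ} (word : List (Fin n)) (c : List ℂ) : G n := (List.zipWith yBold word c).prod

/-- The word `𝐢₀ = (1 2 … n)^{n-1}`. -/
def cyclicWord (n : ℕ) : List (Fin n) := (List.replicate (n - 1) (List.finRange n)).flatten

/-- The list `(c^{(1)}_1, …, c^{(1)}_n, c^{(2)}_1, …, c^{(n-1)}_n)`, where `c l i` stands
for `c^{(l)}_i`. -/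
def cyclicParams (n : ℕ) (c : ℕ → ℕ → ℂ) : List ℂ :=
  (List.range (n - 1)).flatMap fun l => (List.range n).map fun i => c (l + 1) (i + 1)

end TypeD

end

noncomputable section

namespace TypeD

open Matrix

/-! The module is multiplicity free and minuscule: a basis vector is determined by its weight
(`wt_injective`) and pairs with each simple coroot to -1, 0 or 1 (`pr_cases`). Identities in `G`
therefore reduce to three cases per coordinate (`raise_cases`), and `𝐲_i(c)` acts diagonally except
for off-diagonal entries equal to 1.

Principal minors are unique because a regular function vanishing on the big cell `U⁻TU⁺` vanishes on
`G` (`IsRegular.eq_zero`). They exist as leading minors of the vector representation for the chain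
weights `Λ_1, …, Λ_{n-2}` and as highest weight coefficients for the two spin weights
(`minorOf_isPrincipalMinor`).

In `ε`-coordinates the Weyl group acts by signed permutations, and word length is compared with the
inversions of `ρ = (n, …, 1)` (`isReducedWord_iff`). The word `𝐢₀` negates the first `n-1`
coordinates, so it makes every positive root negative on `ρ` and is a reduced word of `w₀`. The
representative of `w` acts monomially with an explicit sign (`ap_lift`). Hence the `k`-th minor is,
up to row signs, the determinant with rows `v̄_1, …, v̄_k` and columns `v_1, …, v_{k-1}, v_{k+1}`
(`generalizedMinor_vec`), and each spin minor is one matrix coefficient (`generalizedMinor_spin`).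

A block `𝐲_1 ⋯ 𝐲_n` advances an unbarred index by at most one, and up to `v_{n-1}` the fastest path
has coefficient 1 (`vecCol_eq_zero`, `vecCol_eq_one`). A row operation then strips the leftmost
block, one row and one column from the determinant (`det_step`, `det_vecCol`). What remains is the
entry (`v̄_1`, `v_{k+1}`) of the last `n-k` blocks. Travelling from `v_{k+1}` to `v_{n-1}` and on to
`v̄_1` takes `n-1-k` blocks, so one block is to spare; the summands record where it is spent
(`vecCol_final`).

In the spin modules a block lowers the height, the sum of the first `n-1` signs, by at most 2. The
block acting first cannot lower the starting vector, so all the others must: one path survives, and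
its only coefficient other than 1 comes from that first block (`spin_blocks`). -/

theorem sub_one_lt {n : ℕ} (hn : 3 ≤ n) : n - 1 < n := by omega

theorem sub_two_lt {n : ℕ} (hn : 3 ≤ n) : n - 2 < n := by omega

/-! ### Weights in `ε`-coordinates -/

/-- The smaller of the two indices in the support of the simple root `α_i`. -/
def lo {n : ℕ} (i : Fin n) : Fin n := ⟨if i.val + 1 = n then i.val - 1 else i.val, by split_ifs <;> omega⟩

/-- The larger of the two indices in the support of the simple root `α_i`. -/
def hi {n : ℕ} (i : Fin n) : Fin n := ⟨if i.val + 1 = n then i.val else i.val + 1, by split_ifs <;> omega⟩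

/-- The sign with which `ε_{hi i}` occurs in `α_i`. -/
def sg {n : ℕ} (i : Fin n) : ℤ := if i.val + 1 = n then 1 else -1

/-- The simple root `α_i = ε_{lo i} ± ε_{hi i}` in `ε`-coordinates. -/
def sroot {n : ℕ} (i : Fin n) : Fin n → ℤ := Pi.single (lo i) 1 + Pi.single (hi i) (sg i)

/-- Twice the weight of a basis vector, in `ε`-coordinates. -/
def wt {n : ℕ} : Idx n → Fin n → ℤ
  | .inl (.inl a) => Pi.single a 2
  | .inl (.inr a) => Pi.single a (-2)
  | .inr b => fun j => if b j then 1 else -1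

theorem sg_mul_sg {n : ℕ} (i : Fin n) : sg i * sg i = 1 := by
  unfold sg; split_ifs <;> rfl

theorem sg_eq {n : ℕ} (i : Fin n) : sg i = 1 ∨ sg i = -1 := by
  unfold sg; split_ifs <;> simp

theorem lo_val {n : ℕ} (i : Fin n) : (lo i).val = if i.val + 1 = n then i.val - 1 else i.val := rfl

theorem hi_val {n : ℕ} (i : Fin n) : (hi i).val = if i.val + 1 = n then i.val else i.val + 1 := rfl

theorem lo_lt_hi {n : ℕ} (hn : 3 ≤ n) (i : Fin n) : (lo i).val < (hi i).val := by
  rw [lo_val, hi_val]; split_ifs <;> omega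

theorem lo_ne_hi {n : ℕ} (hn : 3 ≤ n) (i : Fin n) : lo i ≠ hi i := fun h => by
  have := lo_lt_hi hn i; rw [h] at this; omega

theorem sroot_dot {n : ℕ} (i : Fin n) (v : Fin n → ℤ) :
    sroot i ⬝ᵥ v = v (lo i) + sg i * v (hi i) := by
  simp [sroot, add_dotProduct]

theorem sroot_lo {n : ℕ} (hn : 3 ≤ n) (i : Fin n) : sroot i (lo i) = 1 := by
  simp [sroot, Pi.single_eq_of_ne (lo_ne_hi hn i)]

theorem sroot_hi {n : ℕ} (hn : 3 ≤ n) (i : Fin n) : sroot i (hi i) = sg i := by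
  simp [sroot, Pi.single_eq_of_ne (lo_ne_hi hn i).symm]

theorem sroot_of_ne {n : ℕ} {i j : Fin n} (h1 : j ≠ lo i) (h2 : j ≠ hi i) : sroot i j = 0 := by
  simp [sroot, Pi.single_eq_of_ne h1, Pi.single_eq_of_ne h2]

theorem sroot_dot_self {n : ℕ} (hn : 3 ≤ n) (i : Fin n) : sroot i ⬝ᵥ sroot i = 2 := by
  rw [sroot_dot, sroot_lo hn, sroot_hi hn, sg_mul_sg]; rfl

/-- Type `D` is simply laced with all roots of square length 2, so roots and coroots coincide in
`ε`-coordinates. -/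
theorem cartan_eq {n : ℕ} (hn : 3 ≤ n) (i j : Fin n) :
    CartanMatrix.D n i j = sroot i ⬝ᵥ sroot j := by
  rw [sroot_dot]
  have hi' := i.2
  have hj' := j.2
  simp only [CartanMatrix.D, sroot, Matrix.of_apply, Pi.add_apply, Pi.single_apply,
    Fin.ext_iff, lo_val, hi_val, sg]
  by_cases h1 : i.val + 1 = n <;> by_cases h2 : j.val + 1 = n <;> simp only [h1, h2, if_true, if_false, or_true, or_false, and_true] <;>
    (split_ifs <;> omega)

theorem sroot_dot_nonpos {n : ℕ} (hn : 3 ≤ n) {i j : Fin n} (h : i ≠ j) :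
    sroot i ⬝ᵥ sroot j = 0 ∨ sroot i ⬝ᵥ sroot j = -1 := by
  rw [← cartan_eq hn]
  simp only [CartanMatrix.D, Matrix.of_apply, h, if_false]
  split_ifs <;> simp

/-- Doubled vector weights have one entry ±2 and zeros elsewhere, doubled spin weights have only
entries ±1. Multiplicity one lets equalities of basis vectors be checked on weights. -/
theorem wt_injective {n : ℕ} : Function.Injective (wt : Idx n → Fin n → ℤ) := by
  intro a b h
  have hs : ∀ (i : Fin n) (z : ℤ) (_ : z = 2 ∨ z = -2) (c : SpinIdx n),
      (Pi.single i z : Fin n → ℤ) ≠ fun j => if c j then 1 else -1 := by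
    intro i z hz c h
    have := congrFun h i
    simp only [Pi.single_eq_same] at this
    split_ifs at this <;> omega
  have hp : ∀ (i j : Fin n) (z w : ℤ), z ≠ 0 → (Pi.single i z : Fin n → ℤ) = Pi.single j w →
      i = j ∧ z = w := by
    intro i j z w hz h
    have h1 := congrFun h i
    simp only [Pi.single_eq_same, Pi.single_apply] at h1
    split_ifs at h1 with h2
    · exact ⟨h2, h1⟩
    · exact absurd h1 hz
  rcases a with (a | a) | a <;> rcases b with (b | b) | b <;> simp only [wt] at h
  · rw [(hp _ _ _ _ (by norm_num) h).1]
  · exact absurd (hp _ _ _ _ (by norm_num) h).2 (by norm_num)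
  · exact absurd h (hs _ _ (by simp) _)
  · exact absurd (hp _ _ _ _ (by norm_num) h).2 (by norm_num)
  · rw [(hp _ _ _ _ (by norm_num) h).1]
  · exact absurd h (hs _ _ (by simp) _)
  · exact absurd h.symm (hs _ _ (by simp) _)
  · exact absurd h.symm (hs _ _ (by simp) _)
  · congr 1
    funext j
    have := congrFun h j
    cases ha : a j <;> cases hb : b j <;> simp [ha, hb] at this ⊢

theorem Raise.wt_eq {n : ℕ} (hn : 3 ≤ n) {i : Fin n} {b a : Idx n} (h : Raise i b a) :
    wt a = wt b + (2 : ℤ) • sroot i := by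
  have hi' := i.2
  funext j
  have hj' := j.2
  rcases b with (b | b) | b <;> rcases a with (a | a) | a <;> simp only [Raise, VecRaise] at h
  · simp only [wt, sroot, Pi.add_apply, Pi.smul_apply, Pi.single_apply, Fin.ext_iff, lo_val, hi_val,
      sg, smul_eq_mul] at h ⊢
    have := b.2
    rw [if_neg (show ¬ i.val + 1 = n by omega), if_neg (show ¬ i.val + 1 = n by omega),
      if_neg (show ¬ i.val + 1 = n by omega)]
    split_ifs <;> omega
  · simp only [wt, sroot, Pi.add_apply, Pi.smul_apply, Pi.single_apply, Fin.ext_iff, lo_val, hi_val,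
      sg, smul_eq_mul] at h ⊢
    rw [if_pos h.1, if_pos h.1, if_pos h.1]
    split_ifs <;> omega
  · simp only [wt, sroot, Pi.add_apply, Pi.smul_apply, Pi.single_apply, Fin.ext_iff, lo_val, hi_val,
      sg, smul_eq_mul] at h ⊢
    have := a.2
    rw [if_neg (show ¬ i.val + 1 = n by omega), if_neg (show ¬ i.val + 1 = n by omega),
      if_neg (show ¬ i.val + 1 = n by omega)]
    split_ifs <;> omega
  · rcases h with ⟨k, hk, h1, h2, rfl⟩ | ⟨hl, k, hk, h1, h2, rfl⟩
    · have := k.2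
      have e1 : lo i = i := Fin.ext (by rw [lo_val, if_neg (by omega)])
      have e2 : hi i = k := Fin.ext (by rw [hi_val, if_neg (by omega)]; omega)
      have e3 : sg i = -1 := if_neg (by omega)
      simp only [wt, sroot, e1, e2, e3, Pi.add_apply, Pi.smul_apply, Pi.single_apply,
        Function.update_apply, smul_eq_mul]
      have hne : i ≠ k := fun h => by rw [h] at hk; omega
      by_cases hjk : j = k
      · subst hjk; simp [h2, hne.symm]
      · by_cases hji : j = i
        · subst hji; simp [h1, hne]
        · simp [hjk, hji]
    · have e1 : lo i = k := Fin.ext (by rw [lo_val, if_pos hl]; omega)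
      have e2 : hi i = i := Fin.ext (by rw [hi_val, if_pos hl])
      have e3 : sg i = 1 := if_pos hl
      simp only [wt, sroot, e1, e2, e3, Pi.add_apply, Pi.smul_apply, Pi.single_apply,
        Function.update_apply, smul_eq_mul]
      have hne : i ≠ k := fun h => by rw [h] at hk; omega
      by_cases hjk : j = k
      · subst hjk; simp [h1, hne.symm]
      · by_cases hji : j = i
        · subst hji; simp [h2, hne]
        · simp [hjk, hji]

/-! ### Pairings with coroots and root strings -/

/-- The pairing `⟨wt b, α_i^∨⟩`. -/
def pr {n : ℕ} (i : Fin n) (b : Idx n) : ℤ := (sroot i ⬝ᵥ wt b) / 2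

/-- The first component says that the integer division in `pr` is exact. The second is
minusculeness: every root string in the module has at most two members. -/
theorem pr_cases {n : ℕ} (hn : 3 ≤ n) (i : Fin n) (b : Idx n) :
    sroot i ⬝ᵥ wt b = 2 * pr i b ∧ (pr i b = -1 ∨ pr i b = 0 ∨ pr i b = 1) := by
  have key : sroot i ⬝ᵥ wt b = -2 ∨ sroot i ⬝ᵥ wt b = 0 ∨ sroot i ⬝ᵥ wt b = 2 := by
    rw [sroot_dot]
    have hne := lo_ne_hi hn i
    rcases b with (b | b) | b <;> rcases sg_eq i with h | h <;> rw [h] <;>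
      simp only [wt, Pi.single_apply] <;> split_ifs <;> simp_all
  unfold pr
  rcases key with h | h | h <;> rw [h] <;> norm_num

theorem two_mul_pr {n : ℕ} (hn : 3 ≤ n) (i : Fin n) (b : Idx n) :
    sroot i ⬝ᵥ wt b = 2 * pr i b := (pr_cases hn i b).1

theorem Raise.pr_eq {n : ℕ} (hn : 3 ≤ n) {i : Fin n} {b a : Idx n} (h : Raise i b a) (j : Fin n) :
    pr j a = pr j b + sroot j ⬝ᵥ sroot i := by
  have h1 := congrArg (sroot j ⬝ᵥ ·) (h.wt_eq hn)
  simp only [dotProduct_add, dotProduct_smul, two_mul_pr hn, smul_eq_mul] at h1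
  omega

theorem Raise.pr_left {n : ℕ} (hn : 3 ≤ n) {i : Fin n} {b a : Idx n} (h : Raise i b a) :
    pr i b = -1 := by
  have h1 := h.pr_eq hn i
  rw [sroot_dot_self hn] at h1
  have h2 := (pr_cases hn i a).2
  have h3 := (pr_cases hn i b).2
  omega

theorem Raise.pr_right {n : ℕ} (hn : 3 ≤ n) {i : Fin n} {b a : Idx n} (h : Raise i b a) :
    pr i a = 1 := by
  rw [h.pr_eq hn i, sroot_dot_self hn, h.pr_left hn]; rfl

theorem Raise.unique_right {n : ℕ} (hn : 3 ≤ n) {i : Fin n} {b a a' : Idx n} (h : Raise i b a)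
    (h' : Raise i b a') : a = a' :=
  wt_injective (by rw [h.wt_eq hn, h'.wt_eq hn])

theorem Raise.unique_left {n : ℕ} (hn : 3 ≤ n) {i : Fin n} {b b' a : Idx n} (h : Raise i b a)
    (h' : Raise i b' a) : b = b' :=
  wt_injective (by have := h.wt_eq hn; rw [h'.wt_eq hn] at this; exact (add_right_cancel this).symm)

theorem exists_raise {n : ℕ} (hn : 3 ≤ n) {i : Fin n} {b : Idx n} (h : pr i b = -1) :
    ∃ a, Raise i b a := by
  have h1 := two_mul_pr hn i b
  rw [h, sroot_dot] at h1
  have hne := lo_ne_hi hn i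
  have hi' := i.2
  by_cases hl : i.val + 1 = n
  · have e1 : (lo i).val + 1 = i.val := by rw [lo_val, if_pos hl]; omega
    have e2 : hi i = i := Fin.ext (by rw [hi_val, if_pos hl])
    have e3 : sg i = 1 := if_pos hl
    rw [e2] at hne
    rw [e2, e3] at h1
    rcases b with (b | b) | b
    · simp only [wt, Pi.single_apply] at h1
      split_ifs at h1 <;> omega
    · by_cases hb : b = i
      · exact ⟨.inl (.inl (lo i)), hl, Or.inr ⟨hb, e1⟩⟩
      · by_cases hb' : b = lo i
        · exact ⟨.inl (.inl i), hl, Or.inl ⟨by rw [hb']; exact e1, rfl⟩⟩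
        · simp [wt, Ne.symm hb, Ne.symm hb'] at h1
    · refine ⟨.inr (Function.update (Function.update b (lo i) true) i true),
        Or.inr ⟨hl, lo i, e1, ?_, ?_, rfl⟩⟩ <;>
      · cases h2 : b (lo i) <;> cases h3 : b i <;> simp [wt, h2, h3] at h1 ⊢
  · have e1 : lo i = i := Fin.ext (by rw [lo_val, if_neg hl])
    have e2 : (hi i).val = i.val + 1 := by rw [hi_val, if_neg hl]
    have e3 : sg i = -1 := if_neg hl
    rw [e1] at hne
    rw [e1, e3] at h1
    rcases b with (b | b) | b
    · by_cases hb : b = hi i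
      · exact ⟨.inl (.inl i), rfl, by rw [hb]; exact e2⟩
      · by_cases hb' : b = i
        · subst hb'; simp [wt, hne.symm] at h1
        · simp [wt, Ne.symm hb, Ne.symm hb'] at h1
    · by_cases hb : b = i
      · exact ⟨.inl (.inr (hi i)), hb, e2⟩
      · by_cases hb' : b = hi i
        · subst hb'; simp [wt, hne] at h1
        · simp [wt, Ne.symm hb, Ne.symm hb'] at h1
    · refine ⟨.inr (Function.update (Function.update b i true) (hi i) false),
        Or.inl ⟨hi i, e2, ?_, ?_, rfl⟩⟩ <;>
      · cases h2 : b i <;> cases h3 : b (hi i) <;> simp [wt, h2, h3] at h1 ⊢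

/-- The basis vector of opposite weight. -/
def Idx.neg {n : ℕ} : Idx n → Idx n
  | .inl (.inl a) => .inl (.inr a)
  | .inl (.inr a) => .inl (.inl a)
  | .inr b => .inr fun j => !b j

theorem wt_neg {n : ℕ} (b : Idx n) : wt b.neg = -wt b := by
  funext j
  rcases b with (b | b) | b <;> simp [Idx.neg, wt, Pi.single_apply] <;> split_ifs <;> simp_all

theorem pr_neg {n : ℕ} (hn : 3 ≤ n) (i : Fin n) (b : Idx n) : pr i b.neg = -pr i b := by
  have h1 := two_mul_pr hn i b.neg
  rw [wt_neg, dotProduct_neg, two_mul_pr hn] at h1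
  omega

/-- Adding `α_i` raises the pairing by 2, which inside {-1, 0, 1} forces it to start at -1. Then
`e_i` does not kill `b`, and multiplicity one identifies the image. -/
theorem raise_iff {n : ℕ} (hn : 3 ≤ n) {i : Fin n} {b a : Idx n} :
    Raise i b a ↔ wt a = wt b + (2 : ℤ) • sroot i := by
  refine ⟨fun h => h.wt_eq hn, fun h => ?_⟩
  have h1 := congrArg (sroot i ⬝ᵥ ·) h
  simp only [dotProduct_add, dotProduct_smul, two_mul_pr hn, smul_eq_mul,
    sroot_dot_self hn] at h1
  have h2 := (pr_cases hn i a).2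
  have h3 := (pr_cases hn i b).2
  obtain ⟨c, hc⟩ := exists_raise hn (i := i) (b := b) (by omega)
  rwa [wt_injective (h.trans (hc.wt_eq hn).symm)]

/-- The weights are stable under negation, which exchanges raising and lowering. -/
theorem exists_lower {n : ℕ} (hn : 3 ≤ n) {i : Fin n} {b : Idx n} (h : pr i b = 1) :
    ∃ c, Raise i c b := by
  obtain ⟨a, ha⟩ := exists_raise hn (i := i) (b := b.neg) (by rw [pr_neg hn, h])
  refine ⟨a.neg, (raise_iff hn).2 ?_⟩
  rw [wt_neg, ha.wt_eq hn, wt_neg]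
  abel

theorem raise_cases {n : ℕ} (hn : 3 ≤ n) (i : Fin n) (b : Idx n) :
    (∃ a, Raise i b a) ∨ (∃ c, Raise i c b) ∨ pr i b = 0 := by
  rcases (pr_cases hn i b).2 with h | h | h
  · exact Or.inl (exists_raise hn h)
  · exact Or.inr (Or.inr h)
  · exact Or.inr (Or.inl (exists_lower hn h))

end TypeD

end

noncomputable section

namespace TypeD

open Matrix

/-! ### The action on functions on the basis -/

/-- The action of the group on coordinate vectors. -/
def ap {n : ℕ} (g : G n) (φ : Idx n → ℂ) : Idx n → ℂ :=
  (g : (Matrix (Idx n) (Idx n) ℂ)ˣ).val *ᵥ φ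

theorem ap_mul {n : ℕ} (g h : G n) (φ : Idx n → ℂ) : ap (g * h) φ = ap g (ap h φ) := by
  simp [ap, mulVec_mulVec]

theorem ap_one {n : ℕ} (φ : Idx n → ℂ) : ap 1 φ = φ := by simp [ap]

theorem ap_ap_inv {n : ℕ} (g : G n) (φ : Idx n → ℂ) : ap g (ap g⁻¹ φ) = φ := by
  rw [← ap_mul, mul_inv_cancel, ap_one]

theorem ap_single {n : ℕ} (g : G n) (a b : Idx n) :
    ap g (Pi.single b 1) a = (g : (Matrix (Idx n) (Idx n) ℂ)ˣ).val a b := by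
  simp [ap]

theorem G_ext {n : ℕ} {g h : G n} (H : ∀ φ a, ap g φ a = ap h φ a) : g = h := by
  refine Subtype.ext (Units.ext ?_)
  ext a b
  rw [← ap_single, ← ap_single, H]

theorem e_mulVec_of_raise {n : ℕ} (hn : 3 ≤ n) {i : Fin n} {b a : Idx n} (h : Raise i b a)
    (φ : Idx n → ℂ) : (e i *ᵥ φ) a = φ b := by
  rw [mulVec, dotProduct, Finset.sum_eq_single b]
  · simp [e, h]
  · intro c _ hc
    simp only [e, of_apply]
    rw [if_neg fun h' => hc (h'.unique_left hn h), zero_mul]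
  · simp

theorem e_mulVec_of_pr {n : ℕ} (hn : 3 ≤ n) {i : Fin n} {a : Idx n} (h : pr i a ≠ 1)
    (φ : Idx n → ℂ) : (e i *ᵥ φ) a = 0 := by
  rw [mulVec, dotProduct]
  refine Finset.sum_eq_zero fun c _ => ?_
  simp only [e, of_apply]
  rw [if_neg fun h' => h (h'.pr_right hn), zero_mul]

theorem f_mulVec_of_raise {n : ℕ} (hn : 3 ≤ n) {i : Fin n} {b a : Idx n} (h : Raise i b a)
    (φ : Idx n → ℂ) : (f i *ᵥ φ) b = φ a := by
  rw [mulVec, dotProduct, Finset.sum_eq_single a]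
  · simp [f, h]
  · intro c _ hc
    simp only [f, of_apply]
    rw [if_neg fun h' => hc (h'.unique_right hn h), zero_mul]
  · simp

theorem f_mulVec_of_pr {n : ℕ} (hn : 3 ≤ n) {i : Fin n} {b : Idx n} (h : pr i b ≠ -1)
    (φ : Idx n → ℂ) : (f i *ᵥ φ) b = 0 := by
  rw [mulVec, dotProduct]
  refine Finset.sum_eq_zero fun c _ => ?_
  simp only [f, of_apply]
  rw [if_neg fun h' => h (h'.pr_left hn), zero_mul]

theorem ap_x {n : ℕ} (i : Fin n) (t : ℂ) (φ : Idx n → ℂ) (a : Idx n) :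
    ap (x i t) φ a = φ a + t * (e i *ᵥ φ) a := by
  simp [ap, x, expUnit, add_mulVec, smul_mulVec]

theorem ap_y {n : ℕ} (i : Fin n) (t : ℂ) (φ : Idx n → ℂ) (a : Idx n) :
    ap (y i t) φ a = φ a + t * (f i *ᵥ φ) a := by
  simp [ap, y, expUnit, add_mulVec, smul_mulVec]

theorem ap_x_right {n : ℕ} (hn : 3 ≤ n) {i : Fin n} {b a : Idx n} (h : Raise i b a) (t : ℂ)
    (φ : Idx n → ℂ) : ap (x i t) φ a = φ a + t * φ b := by
  rw [ap_x, e_mulVec_of_raise hn h]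

theorem ap_x_of_ne {n : ℕ} (hn : 3 ≤ n) {i : Fin n} {a : Idx n} (h : pr i a ≠ 1) (t : ℂ)
    (φ : Idx n → ℂ) : ap (x i t) φ a = φ a := by
  rw [ap_x, e_mulVec_of_pr hn h, mul_zero, add_zero]

theorem ap_x_left {n : ℕ} (hn : 3 ≤ n) {i : Fin n} {b a : Idx n} (h : Raise i b a) (t : ℂ)
    (φ : Idx n → ℂ) : ap (x i t) φ b = φ b :=
  ap_x_of_ne hn (by rw [h.pr_left hn]; decide) t φ

theorem ap_x_zero {n : ℕ} (hn : 3 ≤ n) {i : Fin n} {a : Idx n} (h : pr i a = 0) (t : ℂ)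
    (φ : Idx n → ℂ) : ap (x i t) φ a = φ a :=
  ap_x_of_ne hn (by rw [h]; decide) t φ

theorem ap_y_left {n : ℕ} (hn : 3 ≤ n) {i : Fin n} {b a : Idx n} (h : Raise i b a) (t : ℂ)
    (φ : Idx n → ℂ) : ap (y i t) φ b = φ b + t * φ a := by
  rw [ap_y, f_mulVec_of_raise hn h]

theorem ap_y_of_ne {n : ℕ} (hn : 3 ≤ n) {i : Fin n} {b : Idx n} (h : pr i b ≠ -1) (t : ℂ)
    (φ : Idx n → ℂ) : ap (y i t) φ b = φ b := by
  rw [ap_y, f_mulVec_of_pr hn h, mul_zero, add_zero]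

theorem ap_y_right {n : ℕ} (hn : 3 ≤ n) {i : Fin n} {b a : Idx n} (h : Raise i b a) (t : ℂ)
    (φ : Idx n → ℂ) : ap (y i t) φ a = φ a :=
  ap_y_of_ne hn (by rw [h.pr_right hn]; decide) t φ

theorem ap_y_zero {n : ℕ} (hn : 3 ≤ n) {i : Fin n} {a : Idx n} (h : pr i a = 0) (t : ℂ)
    (φ : Idx n → ℂ) : ap (y i t) φ a = φ a :=
  ap_y_of_ne hn (by rw [h]; decide) t φ

theorem ap_sBar_left {n : ℕ} (hn : 3 ≤ n) {i : Fin n} {b a : Idx n} (h : Raise i b a)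
    (φ : Idx n → ℂ) : ap (sBar i) φ b = φ a := by
  simp only [sBar, ap_mul, ap_x_left hn h, ap_x_right hn h, ap_y_left hn h]
  ring

theorem ap_sBar_right {n : ℕ} (hn : 3 ≤ n) {i : Fin n} {b a : Idx n} (h : Raise i b a)
    (φ : Idx n → ℂ) : ap (sBar i) φ a = -φ b := by
  simp only [sBar, ap_mul, ap_x_left hn h, ap_x_right hn h, ap_y_left hn h, ap_y_right hn h]
  ring

theorem ap_sBar_zero {n : ℕ} (hn : 3 ≤ n) {i : Fin n} {a : Idx n} (h : pr i a = 0)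
    (φ : Idx n → ℂ) : ap (sBar i) φ a = φ a := by
  simp only [sBar, ap_mul, ap_x_zero hn h, ap_y_zero hn h]

theorem ap_alphaCheck {n : ℕ} (hn : 3 ≤ n) (i : Fin n) {c : ℂ} (hc : c ≠ 0) (φ : Idx n → ℂ)
    (a : Idx n) : ap (alphaCheck i c) φ a = c ^ pr i a * φ a := by
  rcases raise_cases hn i a with ⟨b, h⟩ | ⟨b, h⟩ | h
  · simp only [alphaCheck, ap_mul, ap_x_left hn h, ap_x_right hn h, ap_y_left hn h,
      ap_sBar_left hn h, ap_sBar_right hn h, h.pr_left hn, _root_.zpow_neg_one]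
    field_simp
    ring
  · simp only [alphaCheck, ap_mul, ap_x_left hn h, ap_x_right hn h, ap_y_left hn h,
      ap_y_right hn h, ap_sBar_left hn h, ap_sBar_right hn h, h.pr_right hn, zpow_one]
    field_simp
    ring
  · simp only [alphaCheck, ap_mul, ap_x_zero hn h, ap_y_zero hn h, ap_sBar_zero hn h, h, zpow_zero,
      one_mul]

/-- In `SL₂` the element `𝐲(c)` is `(c⁻¹ 0; 1 c)`, and this is its lower row. The off-diagonal entry
does not depend on `c`; this is why extremal paths below acquire coefficient 1. -/
theorem ap_yBold_left {n : ℕ} (hn : 3 ≤ n) {i : Fin n} {b a : Idx n} (h : Raise i b a) {c : ℂ}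
    (hc : c ≠ 0) (φ : Idx n → ℂ) : ap (yBold i c) φ b = c * φ b + φ a := by
  rw [yBold, ap_mul, ap_y_left hn h, ap_alphaCheck hn i (inv_ne_zero hc),
    ap_alphaCheck hn i (inv_ne_zero hc), h.pr_left hn, h.pr_right hn, _root_.zpow_neg_one, zpow_one,
    inv_inv, mul_inv_cancel_left₀ hc]

theorem ap_yBold_of_ne {n : ℕ} (hn : 3 ≤ n) {i : Fin n} {b : Idx n} (h : pr i b ≠ -1) {c : ℂ}
    (hc : c ≠ 0) (φ : Idx n → ℂ) : ap (yBold i c) φ b = c⁻¹ ^ pr i b * φ b := by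
  rw [yBold, ap_mul, ap_y_of_ne hn h, ap_alphaCheck hn i (inv_ne_zero hc)]

/-! ### The torus -/

theorem ap_list_prod_alphaCheck {n : ℕ} (hn : 3 ≤ n) (a : Fin n → ℂˣ) (φ : Idx n → ℂ) (b : Idx n)
    (l : List (Fin n)) : ap (l.map fun i => alphaCheck i (a i : ℂ)).prod φ b =
      (l.map fun i => (a i : ℂ) ^ pr i b).prod * φ b := by
  induction l with
  | nil => simp [ap_one]
  | cons i l ih =>
    rw [List.map_cons, List.prod_cons, ap_mul, ap_alphaCheck hn i (a i).ne_zero, ih, List.map_cons,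
      List.prod_cons, mul_assoc]

theorem ap_torus {n : ℕ} (hn : 3 ≤ n) (a : Fin n → ℂˣ) (φ : Idx n → ℂ) (b : Idx n) :
    ap (torus a) φ b = (∏ i, (a i : ℂ) ^ pr i b) * φ b := by
  rw [torus, List.ofFn_eq_map, ap_list_prod_alphaCheck hn, ← List.ofFn_eq_map, List.prod_ofFn]

theorem torus_mul {n : ℕ} (hn : 3 ≤ n) (a b : Fin n → ℂˣ) : torus a * torus b = torus (a * b) := by
  refine G_ext fun φ c => ?_
  rw [ap_mul, ap_torus hn, ap_torus hn, ap_torus hn, ← mul_assoc, ← Finset.prod_mul_distrib]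
  simp [mul_zpow]

theorem torus_one {n : ℕ} (hn : 3 ≤ n) : torus (1 : Fin n → ℂˣ) = 1 := by
  refine G_ext fun φ c => ?_
  simp [ap_torus hn, ap_one]

theorem alphaCheck_eq_torus {n : ℕ} (hn : 3 ≤ n) (i : Fin n) (c : ℂˣ) :
    alphaCheck i (c : ℂ) = torus (Pi.mulSingle i c) := by
  refine G_ext fun φ b => ?_
  rw [ap_torus hn, ap_alphaCheck hn i c.ne_zero, Finset.prod_eq_single i]
  · simp
  · intro j _ hj
    simp [Pi.mulSingle_eq_of_ne hj]
  · simp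

theorem prod_zpow_raise {n : ℕ} (hn : 3 ≤ n) (a : Fin n → ℂˣ) {i : Fin n} {b c : Idx n}
    (h : Raise i b c) : (∏ j, (a j : ℂ) ^ pr j c) =
      (∏ j, (a j : ℂ) ^ (sroot j ⬝ᵥ sroot i)) * ∏ j, (a j : ℂ) ^ pr j b := by
  rw [← Finset.prod_mul_distrib]
  refine Finset.prod_congr rfl fun j _ => ?_
  rw [h.pr_eq hn j, zpow_add₀ (a j).ne_zero, mul_comm]

theorem torus_mul_y {n : ℕ} (hn : 3 ≤ n) (a : Fin n → ℂˣ) (i : Fin n) (t : ℂ) :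
    torus a * y i ((∏ j, (a j : ℂ) ^ (sroot j ⬝ᵥ sroot i)) * t) = y i t * torus a := by
  refine G_ext fun φ b => ?_
  rcases raise_cases hn i b with ⟨c, h⟩ | ⟨c, h⟩ | h
  · simp only [ap_mul, ap_torus hn, ap_y_left hn h, prod_zpow_raise hn a h]
    ring
  · simp only [ap_mul, ap_torus hn, ap_y_right hn h]
  · simp only [ap_mul, ap_torus hn, ap_y_zero hn h]

/-! ### The root subgroups -/

theorem x_mul_x {n : ℕ} (hn : 3 ≤ n) (i : Fin n) (s t : ℂ) : x i s * x i t = x i (s + t) := by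
  refine G_ext fun φ b => ?_
  rcases raise_cases hn i b with ⟨c, h⟩ | ⟨c, h⟩ | h
  · simp only [ap_mul, ap_x_left hn h]
  · simp only [ap_mul, ap_x_right hn h, ap_x_left hn h]; ring
  · simp only [ap_mul, ap_x_zero hn h]

theorem y_mul_y {n : ℕ} (hn : 3 ≤ n) (i : Fin n) (s t : ℂ) : y i s * y i t = y i (s + t) := by
  refine G_ext fun φ b => ?_
  rcases raise_cases hn i b with ⟨c, h⟩ | ⟨c, h⟩ | h
  · simp only [ap_mul, ap_y_left hn h, ap_y_right hn h]; ring
  · simp only [ap_mul, ap_y_right hn h]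
  · simp only [ap_mul, ap_y_zero hn h]

theorem x_zero {n : ℕ} (i : Fin n) : x i 0 = 1 := G_ext fun φ b => by simp [ap_x, ap_one]

theorem y_zero {n : ℕ} (i : Fin n) : y i 0 = 1 := G_ext fun φ b => by simp [ap_y, ap_one]

theorem x_inv {n : ℕ} (hn : 3 ≤ n) (i : Fin n) (t : ℂ) : (x i t)⁻¹ = x i (-t) :=
  inv_eq_of_mul_eq_one_right (by rw [x_mul_x hn, add_neg_cancel, x_zero])

theorem y_inv {n : ℕ} (hn : 3 ≤ n) (i : Fin n) (t : ℂ) : (y i t)⁻¹ = y i (-t) :=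
  inv_eq_of_mul_eq_one_right (by rw [y_mul_y hn, add_neg_cancel, y_zero])

/-- The Gauss decomposition in `SL₂`, available exactly when the relevant diagonal entry `1 + st` is
nonzero. -/
theorem x_mul_y {n : ℕ} (hn : 3 ≤ n) (i : Fin n) (s t : ℂ) (h0 : 1 + s * t ≠ 0) :
    x i s * y i t =
      y i (t / (1 + s * t)) * alphaCheck i (1 + s * t) * x i (s / (1 + s * t)) := by
  refine G_ext fun φ b => ?_
  rcases raise_cases hn i b with ⟨c, h⟩ | ⟨c, h⟩ | h
  · simp only [ap_mul, ap_x_left hn h, ap_x_right hn h, ap_y_left hn h,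
      ap_alphaCheck hn i h0, h.pr_left hn, h.pr_right hn, _root_.zpow_neg_one, zpow_one]
    rw [div_eq_mul_inv, div_eq_mul_inv]
    have hv := mul_inv_cancel₀ h0
    linear_combination -(t * φ c + φ b * t * s * (1 + s * t)⁻¹ + φ b) * hv
  · simp only [ap_mul, ap_x_right hn h, ap_y_left hn h, ap_y_right hn h,
      ap_alphaCheck hn i h0, h.pr_right hn, zpow_one]
    field_simp
    ring
  · simp only [ap_mul, ap_x_zero hn h, ap_y_zero hn h, ap_alphaCheck hn i h0, h, zpow_zero, one_mul]

/-! ### Relations among the Chevalley generators -/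

theorem matrix_ext_mulVec {n : ℕ} {A B : Matrix (Idx n) (Idx n) ℂ}
    (H : ∀ φ a, (A *ᵥ φ) a = (B *ᵥ φ) a) : A = B := by
  ext a b
  simpa using H (Pi.single b 1) a

/-- For adjacent nodes both composites vanish, since the first move shifts the second pairing away
from the value it needs. For orthogonal nodes the two moves are independent and end at the same
weight. -/
theorem e_mul_f_comm {n : ℕ} (hn : 3 ≤ n) {i j : Fin n} (hij : i ≠ j) : e i * f j = f j * e i := by
  have hA := sroot_dot_nonpos hn hij
  have hA' := sroot_dot_nonpos hn hij.symm
  refine matrix_ext_mulVec fun φ a => ?_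
  rw [← mulVec_mulVec, ← mulVec_mulVec]
  rcases (pr_cases hn i a).2 with h | h | h
  · have h1 : pr i a ≠ 1 := by omega
    rw [e_mulVec_of_pr hn h1]
    by_cases hj : pr j a = -1
    · obtain ⟨c, hc⟩ := exists_raise hn hj
      rw [f_mulVec_of_raise hn hc, e_mulVec_of_pr hn]
      rw [hc.pr_eq hn i]; omega
    · rw [f_mulVec_of_pr hn hj]
  · have h1 : pr i a ≠ 1 := by omega
    rw [e_mulVec_of_pr hn h1]
    by_cases hj : pr j a = -1
    · obtain ⟨c, hc⟩ := exists_raise hn hj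
      rw [f_mulVec_of_raise hn hc, e_mulVec_of_pr hn]
      rw [hc.pr_eq hn i]; omega
    · rw [f_mulVec_of_pr hn hj]
  · obtain ⟨b, hb⟩ := exists_lower hn h
    rw [e_mulVec_of_raise hn hb]
    have hbj := hb.pr_eq hn j
    have hbb := (pr_cases hn j b).2
    by_cases hj : pr j a = -1
    · obtain ⟨c, hc⟩ := exists_raise hn hj
      rw [f_mulVec_of_raise hn hc]
      have h2 := hc.pr_eq hn i
      by_cases h3 : sroot i ⬝ᵥ sroot j = -1
      · have h4 : sroot j ⬝ᵥ sroot i = -1 := by rw [dotProduct_comm]; exact h3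
        rw [e_mulVec_of_pr hn (by omega), f_mulVec_of_pr hn (by omega)]
      · have h4 : sroot j ⬝ᵥ sroot i ≠ -1 := by rw [dotProduct_comm]; exact h3
        obtain ⟨d, hd⟩ := exists_lower hn (i := i) (b := c) (by omega)
        rw [e_mulVec_of_raise hn hd, f_mulVec_of_raise hn ((raise_iff hn).2 _)]
        have e1 := hb.wt_eq hn
        have e2 := hc.wt_eq hn
        have e3 := hd.wt_eq hn
        rw [e2, e1] at e3
        have : wt b + (2 : ℤ) • sroot j + (2 : ℤ) • sroot i = wt d + (2 : ℤ) • sroot i := by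
          rw [← e3]; abel
        exact (add_right_cancel this).symm
    · rw [f_mulVec_of_pr hn hj, f_mulVec_of_pr hn]
      by_cases h3 : sroot i ⬝ᵥ sroot j = -1
      · have h4 : sroot j ⬝ᵥ sroot i = -1 := by rw [dotProduct_comm]; exact h3
        intro h5
        have := (pr_cases hn j a).2
        omega
      · have h4 : sroot j ⬝ᵥ sroot i ≠ -1 := by rw [dotProduct_comm]; exact h3
        omega

/-- The weight `2α_i + α_j` pairs with `α_i^∨` to at least 3, while two pairings in the module
differ by at most 2. -/
theorem e_mul_e_mul_e {n : ℕ} (hn : 3 ≤ n) {i j : Fin n} (hij : i ≠ j) :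
    e i * e j * e i = 0 := by
  have hA := sroot_dot_nonpos hn hij
  refine matrix_ext_mulVec fun φ a => ?_
  rw [← mulVec_mulVec, ← mulVec_mulVec, zero_mulVec]
  by_cases h : pr i a = 1
  · obtain ⟨b, hb⟩ := exists_lower hn h
    rw [e_mulVec_of_raise hn hb]
    by_cases h' : pr j b = 1
    · obtain ⟨c, hc⟩ := exists_lower hn h'
      rw [e_mulVec_of_raise hn hc, e_mulVec_of_pr hn]
      · rfl
      · have h1 := hb.pr_left hn
        have h2 := hc.pr_eq hn i
        omega
    · rw [e_mulVec_of_pr hn h']; rfl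
  · rw [e_mulVec_of_pr hn h]; rfl

theorem f_mul_e_mul_f {n : ℕ} (hn : 3 ≤ n) (i : Fin n) : f i * e i * f i = f i := by
  refine matrix_ext_mulVec fun φ a => ?_
  rw [← mulVec_mulVec, ← mulVec_mulVec]
  by_cases h : pr i a = -1
  · obtain ⟨b, hb⟩ := exists_raise hn h
    rw [f_mulVec_of_raise hn hb, e_mulVec_of_raise hn hb]
  · rw [f_mulVec_of_pr hn h, f_mulVec_of_pr hn h]

/-- The commutator `[e_i, f_i]` is diagonal with entries `pr i`, and `e_j` shifts `pr i` by the
Cartan integer. -/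
theorem coroot_mul_e {n : ℕ} (hn : 3 ≤ n) (i j : Fin n) :
    (e i * f i - f i * e i) * e j - e j * (e i * f i - f i * e i) =
      ((sroot i ⬝ᵥ sroot j : ℤ) : ℂ) • e j := by
  have hd : ∀ φ a, ((e i * f i - f i * e i) *ᵥ φ) a = (pr i a : ℂ) * φ a := by
    intro φ a
    rw [sub_mulVec, ← mulVec_mulVec, ← mulVec_mulVec, Pi.sub_apply]
    rcases raise_cases hn i a with ⟨c, h⟩ | ⟨c, h⟩ | h
    · rw [e_mulVec_of_pr hn (by rw [h.pr_left hn]; decide), f_mulVec_of_raise hn h,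
        e_mulVec_of_raise hn h, h.pr_left hn]
      simp
    · rw [f_mulVec_of_pr hn (by rw [h.pr_right hn]; decide), e_mulVec_of_raise hn h,
        f_mulVec_of_raise hn h, h.pr_right hn]
      simp
    · rw [e_mulVec_of_pr hn (by rw [h]; decide), f_mulVec_of_pr hn (by rw [h]; decide), h]
      simp
  refine matrix_ext_mulVec fun φ a => ?_
  rw [sub_mulVec, ← mulVec_mulVec, ← mulVec_mulVec, Pi.sub_apply, hd, smul_mulVec, Pi.smul_apply,
    smul_eq_mul]
  by_cases h : pr j a = 1
  · obtain ⟨b, hb⟩ := exists_lower hn h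
    rw [e_mulVec_of_raise hn hb, e_mulVec_of_raise hn hb, hd, hb.pr_eq hn i]
    push_cast
    ring
  · simp only [e_mulVec_of_pr hn h]
    ring

end TypeD

end

noncomputable section

namespace TypeD

open Matrix

/-! ### The big cell and uniqueness of principal minors -/

/-- The first three factors multiply to `1 + B + b[A, B]`. The last factor adjusts the coefficient
of `B`, making it independent of `b`, as conjugation by lower root elements requires. -/
theorem unipotent_word_eq {R : Type*} [Ring R] [Algebra ℂ R] {A B : R} (hA : A * A = 0)
    (hB : B * B = 0) (hAB : A * B * A = 0) (hBA : B * A * B = 0) (b s : ℂ) :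
    (1 + b • A) * (1 + (1 : ℂ) • B) * (1 + (-b) • A) * (1 + (s - 1) • B) =
      1 + s • B + b • (A * B - B * A) := by
  have hAB' : A * (B * A) = 0 := by rw [← mul_assoc, hAB]
  have hBA' : B * (A * B) = 0 := by rw [← mul_assoc, hBA]
  have hA' : ∀ X, A * (A * X) = 0 := fun X => by rw [← mul_assoc, hA, zero_mul]
  have hB' : ∀ X, B * (B * X) = 0 := fun X => by rw [← mul_assoc, hB, zero_mul]
  simp only [add_mul, mul_add, smul_mul_assoc, mul_smul_comm, one_mul, mul_one, mul_assoc, hA, hB,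
    hAB', hBA', smul_zero, mul_zero, add_zero]
  module

theorem unipotent_conj_raise {R : Type*} [Ring R] [Algebra ℂ R] {A B : R} (hA : A * A = 0)
    (hAB : A * B * A = 0) (a b s : ℂ) :
    (1 + a • A) * (1 + s • B + b • (A * B - B * A)) =
      (1 + s • B + (b + a * s) • (A * B - B * A)) * (1 + a • A) := by
  have hAB' : A * (B * A) = 0 := by rw [← mul_assoc, hAB]
  have hA' : ∀ X, A * (A * X) = 0 := fun X => by rw [← mul_assoc, hA, zero_mul]
  simp only [add_mul, mul_add, sub_mul, mul_sub, smul_mul_assoc, mul_smul_comm, one_mul, mul_one,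
    mul_assoc, hA, hAB', hA', smul_zero, add_zero, mul_zero, sub_zero]
  module

theorem unipotent_conj_lower {R : Type*} [Ring R] [Algebra ℂ R] {A B F : R}
    (hBF : B * F = F * B) (hF : F * F = 0) (hFAF : F * A * F = F) (c : ℂ)
    (hc : (A * F - F * A) * B - B * (A * F - F * A) = c • B) (b s t : ℂ) :
    (1 + s • B + b • (A * B - B * A)) * (1 + t • F) =
      (1 + t • F) * (1 + (s + t * c * b) • B + b • (A * B - B * A)) := by
  have hEF : (A * B - B * A) * F = F * (A * B - B * A) + c • B := by
    rw [← hc]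
    simp only [sub_mul, mul_sub, mul_assoc]
    rw [hBF, ← mul_assoc B F A, hBF, mul_assoc]
    abel
  -- Evaluate `F[A,B]F` twice: it vanishes by `FAF = F` and `BF = FB`, and it equals `cFB` after
  -- moving `F` past the commutator and using `F² = 0`. This removes the only term quadratic in `t`.
  have hFEF : c • (F * B) = 0 := by
    have h1 : F * ((A * B - B * A) * F) = 0 := by
      have : F * ((A * B - B * A) * F) = F * A * F * B - B * (F * A * F) := by
        simp only [sub_mul, mul_sub, mul_assoc]
        rw [hBF, ← mul_assoc F B (A * F), ← hBF, mul_assoc]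
      rw [this, hFAF, hBF, sub_self]
    rw [hEF, mul_add, ← mul_assoc, hF, zero_mul, zero_add, mul_smul_comm] at h1
    exact h1
  have h2 : (t * c * b) • (F * B) = 0 := by
    rw [show t * c * b = (t * b) * c by ring, mul_smul, hFEF, smul_zero]
  have e1 : (1 + s • B + b • (A * B - B * A)) * (1 + t • F) =
      1 + s • B + b • (A * B - B * A) + t • F + (s * t) • (F * B) +
        (b * t) • (F * (A * B - B * A) + c • B) := by
    rw [← hEF, ← hBF]
    simp only [add_mul, mul_add, one_mul, mul_one, smul_mul_assoc, mul_smul_comm]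
    module
  have e2 : (1 + t • F) * (1 + (s + t * c * b) • B + b • (A * B - B * A)) =
      1 + s • B + b • (A * B - B * A) + t • F + (s * t) • (F * B) +
        (b * t) • (F * (A * B - B * A) + c • B) + t • ((t * c * b) • (F * B)) := by
    simp only [add_mul, mul_add, one_mul, mul_one, smul_mul_assoc, mul_smul_comm]
    module
  rw [e1, e2, h2, smul_zero, add_zero]

/-! ### Unipotent radicals of the minimal parabolic subgroups -/

/-- The element `exp (s e_j + b [e_i, e_j])` of `U⁺`. -/
def rootPair {n : ℕ} (i j : Fin n) (b s : ℂ) : G n := x i b * x j 1 * x i (-b) * x j (s - 1)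

theorem x_val {n : ℕ} (i : Fin n) (t : ℂ) :
    ((x i t : G n) : (Matrix (Idx n) (Idx n) ℂ)ˣ).val = 1 + t • e i := rfl

theorem y_val {n : ℕ} (i : Fin n) (t : ℂ) :
    ((y i t : G n) : (Matrix (Idx n) (Idx n) ℂ)ˣ).val = 1 + t • f i := rfl

theorem rootPair_val {n : ℕ} (hn : 3 ≤ n) {i j : Fin n} (hij : i ≠ j) (b s : ℂ) :
    ((rootPair i j b s : G n) : (Matrix (Idx n) (Idx n) ℂ)ˣ).val =
      1 + s • e j + b • (e i * e j - e j * e i) := by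
  rw [← unipotent_word_eq (e_mul_e i) (e_mul_e j) (e_mul_e_mul_e hn hij)
    (e_mul_e_mul_e hn hij.symm) b s]
  rfl

theorem G_ext_val {n : ℕ} {g h : G n} (H : (g : (Matrix (Idx n) (Idx n) ℂ)ˣ).val =
    (h : (Matrix (Idx n) (Idx n) ℂ)ˣ).val) : g = h :=
  Subtype.ext (Units.ext H)

theorem G_val_mul {n : ℕ} (g h : G n) : ((g * h : G n) : (Matrix (Idx n) (Idx n) ℂ)ˣ).val =
    (g : (Matrix (Idx n) (Idx n) ℂ)ˣ).val * (h : (Matrix (Idx n) (Idx n) ℂ)ˣ).val := rfl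

theorem x_mul_rootPair {n : ℕ} (hn : 3 ≤ n) {i j : Fin n} (hij : i ≠ j) (a b s : ℂ) :
    x i a * rootPair i j b s = rootPair i j (b + a * s) s * x i a := by
  refine G_ext_val ?_
  rw [G_val_mul, G_val_mul, rootPair_val hn hij, rootPair_val hn hij, x_val]
  exact unipotent_conj_raise (e_mul_e i) (e_mul_e_mul_e hn hij) a b s

theorem rootPair_mul_y {n : ℕ} (hn : 3 ≤ n) {i j : Fin n} (hij : i ≠ j) (b s t : ℂ) :
    rootPair i j b s * y i t =
      y i t * rootPair i j b (s + t * ((sroot i ⬝ᵥ sroot j : ℤ) : ℂ) * b) := by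
  refine G_ext_val ?_
  rw [G_val_mul, G_val_mul, rootPair_val hn hij, rootPair_val hn hij, y_val]
  exact unipotent_conj_lower (e_mul_f_comm hn hij.symm) (f_mul_f i) (f_mul_e_mul_f hn i) _
    (coroot_mul_e hn i j) b s t

theorem rootPair_zero {n : ℕ} (hn : 3 ≤ n) {i j : Fin n} (hij : i ≠ j) (s : ℂ) :
    rootPair i j 0 s = x j s := by
  refine G_ext_val ?_
  rw [rootPair_val hn hij, x_val, zero_smul, add_zero]

theorem x_mem_Uplus {n : ℕ} (i : Fin n) (t : ℂ) : x i t ∈ Uplus n :=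
  Subgroup.subset_closure ⟨(i, t), rfl⟩

theorem y_mem_Uminus {n : ℕ} (i : Fin n) (t : ℂ) : y i t ∈ Uminus n :=
  Subgroup.subset_closure ⟨(i, t), rfl⟩

/-- The unipotent radical of the minimal parabolic subgroup attached to `i`. -/
def Uradical {n : ℕ} (i : Fin n) : Subgroup (G n) :=
  Subgroup.closure {u | ∃ j, i ≠ j ∧ ∃ b s : ℂ, u = rootPair i j b s}

theorem Uradical_le {n : ℕ} (i : Fin n) : Uradical i ≤ Uplus n := by
  refine (Subgroup.closure_le _).2 ?_
  rintro _ ⟨j, -, b, s, rfl⟩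
  exact mul_mem (mul_mem (mul_mem (x_mem_Uplus _ _) (x_mem_Uplus _ _)) (x_mem_Uplus _ _))
    (x_mem_Uplus _ _)

theorem Uradical_conj {n : ℕ} {i : Fin n} (g : G n)
    (hg : ∀ j, i ≠ j → ∀ b s : ℂ, g * rootPair i j b s * g⁻¹ ∈ Uradical i) {u : G n}
    (hu : u ∈ Uradical i) : g * u * g⁻¹ ∈ Uradical i := by
  induction hu using Subgroup.closure_induction with
  | mem u hu => obtain ⟨j, hj, b, s, rfl⟩ := hu; exact hg j hj b s
  | one => simp [one_mem]
  | mul u v _ _ hu hv => simpa [mul_assoc] using mul_mem hu hv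
  | inv u _ hu => simpa [mul_assoc] using inv_mem hu

theorem x_conj_Uradical {n : ℕ} (hn : 3 ≤ n) (i : Fin n) (a : ℂ) {u : G n} (hu : u ∈ Uradical i) :
    x i a * u * (x i a)⁻¹ ∈ Uradical i :=
  Uradical_conj _ (fun j hj b s => by
    rw [x_mul_rootPair hn hj, mul_inv_cancel_right]
    exact Subgroup.subset_closure ⟨j, hj, _, _, rfl⟩) hu

theorem y_conj_Uradical {n : ℕ} (hn : 3 ≤ n) (i : Fin n) (t : ℂ) {u : G n} (hu : u ∈ Uradical i) :
    (y i t)⁻¹ * u * y i t ∈ Uradical i := by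
  have := Uradical_conj (i := i) (y i t)⁻¹ (fun j hj b s => by
    rw [inv_inv, mul_assoc, rootPair_mul_y hn hj, inv_mul_cancel_left]
    exact Subgroup.subset_closure ⟨j, hj, _, _, rfl⟩) hu
  rwa [inv_inv] at this

/-- The group `U⁺` is the product of `x_i(ℂ)` and the radical: `x_i` normalises the radical, so its
factors can always be collected on the left. -/
theorem exists_x_mul_of_mem_Uplus {n : ℕ} (hn : 3 ≤ n) (i : Fin n) {u : G n} (hu : u ∈ Uplus n) :
    ∃ a, ∃ v ∈ Uradical i, u = x i a * v := by
  induction hu using Subgroup.closure_induction with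
  | mem u hu =>
    obtain ⟨⟨j, t⟩, rfl⟩ := hu
    by_cases hj : i = j
    · subst hj
      exact ⟨t, 1, one_mem _, by simp⟩
    · refine ⟨0, x j t, ?_, by rw [x_zero, one_mul]⟩
      rw [← rootPair_zero hn hj]
      exact Subgroup.subset_closure ⟨j, hj, _, _, rfl⟩
  | one => exact ⟨0, 1, one_mem _, by rw [x_zero, one_mul]⟩
  | mul u v _ _ hu hv =>
    obtain ⟨a, u, hu, rfl⟩ := hu
    obtain ⟨b, v, hv, rfl⟩ := hv
    refine ⟨a + b, (x i b)⁻¹ * u * x i b * v, mul_mem ?_ hv, ?_⟩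
    · have := x_conj_Uradical hn i (-b) hu
      rwa [← x_inv hn, inv_inv] at this
    · rw [← x_mul_x hn]; group
  | inv u _ hu =>
    obtain ⟨a, u, hu, rfl⟩ := hu
    refine ⟨-a, x i a * u⁻¹ * (x i a)⁻¹, x_conj_Uradical hn i a (inv_mem hu), ?_⟩
    rw [← x_inv hn]; group

/-! ### The big cell and functions vanishing on it -/

/-- The big cell `U⁻ T U⁺`. -/
def BigCell (n : ℕ) : Set (G n) :=
  {g | ∃ u ∈ Uminus n, ∃ a : Fin n → ℂˣ, ∃ v ∈ Uplus n, g = u * torus a * v}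

theorem one_mem_BigCell {n : ℕ} (hn : 3 ≤ n) : (1 : G n) ∈ BigCell n :=
  ⟨1, one_mem _, 1, 1, one_mem _, by rw [torus_one hn]; simp⟩

theorem BigCell_mul_x {n : ℕ} {g : G n} (hg : g ∈ BigCell n) (i : Fin n) (t : ℂ) :
    g * x i t ∈ BigCell n := by
  obtain ⟨u, hu, a, v, hv, rfl⟩ := hg
  exact ⟨u, hu, a, v * x i t, mul_mem hv (x_mem_Uplus i t), by simp [mul_assoc]⟩

/-- Write the `U⁺` part as `x_i(c)v` with `v` in the radical. Since `y_i` normalises the radical,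
only `x_i(c)y_i(t)` must be refactored, which works away from at most one `t`. -/
theorem BigCell_mul_y {n : ℕ} (hn : 3 ≤ n) {g : G n} (hg : g ∈ BigCell n) (i : Fin n) :
    ∃ c : ℂ, ∀ t, 1 + c * t ≠ 0 → g * y i t ∈ BigCell n := by
  obtain ⟨u, hu, a, v, hv, rfl⟩ := hg
  obtain ⟨c, v, hvr, rfl⟩ := exists_x_mul_of_mem_Uplus hn i hv
  refine ⟨c, fun t ht => ?_⟩
  set χ : ℂ := ∏ j, (a j : ℂ) ^ (sroot j ⬝ᵥ sroot i) with hχ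
  have hχ0 : χ ≠ 0 := Finset.prod_ne_zero_iff.2 fun j _ => zpow_ne_zero _ (a j).ne_zero
  have hv' := Uradical_le i (y_conj_Uradical hn i t hvr)
  -- The factor `χ⁻¹`, with `χ` the value of `α_i` on the torus element, compensates for moving
  -- `y_i` to its left.
  refine ⟨u * y i (χ⁻¹ * (t / (1 + c * t))), mul_mem hu (y_mem_Uminus _ _),
    a * Pi.mulSingle i (Units.mk0 _ ht), x i (c / (1 + c * t)) * ((y i t)⁻¹ * v * y i t),
    mul_mem (x_mem_Uplus _ _) hv', ?_⟩
  have h1 := torus_mul_y hn a i (χ⁻¹ * (t / (1 + c * t)))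
  rw [← hχ, mul_inv_cancel_left₀ hχ0] at h1
  have h2 := x_mul_y hn i c t ht
  have h3 := alphaCheck_eq_torus hn i (Units.mk0 _ ht)
  rw [Units.val_mk0] at h3
  calc u * torus a * (x i c * v) * y i t
      = u * torus a * (x i c * y i t) * ((y i t)⁻¹ * v * y i t) := by group
    _ = u * (torus a * y i (t / (1 + c * t))) * alphaCheck i (1 + c * t) * x i (c / (1 + c * t)) *
          ((y i t)⁻¹ * v * y i t) := by rw [h2]; group
    _ = _ := by rw [h1, h3, ← torus_mul hn]; group

theorem IsRegular.mul_right {n : ℕ} {F : G n → ℂ} (hF : IsRegular F) (h : G n) :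
    IsRegular fun g => F (g * h) := by
  obtain ⟨P, hP⟩ := hF
  refine ⟨MvPolynomial.bind₁ (fun p : Idx n × Idx n => ∑ q, MvPolynomial.X (p.1, q) *
    MvPolynomial.C ((h : (Matrix (Idx n) (Idx n) ℂ)ˣ).val q p.2)) P, fun g => ?_⟩
  change F (g * h) = _
  rw [hP, MvPolynomial.eval, MvPolynomial.eval, MvPolynomial.eval₂Hom_bind₁]
  congr 2
  funext p
  simp [Matrix.mul_apply]

/-- Because `y_i(t) = 1 + t f_i`, the function is a polynomial in `t` along this curve. The excluded
set has at most one element, so the polynomial has infinitely many roots. -/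
theorem IsRegular.eq_zero_of_y {n : ℕ} {F : G n → ℂ} (hF : IsRegular F) (g : G n) (i : Fin n)
    (c : ℂ) (h : ∀ t, 1 + c * t ≠ 0 → F (g * y i t) = 0) (t : ℂ) : F (g * y i t) = 0 := by
  obtain ⟨P, hP⟩ := hF
  set M := (g : (Matrix (Idx n) (Idx n) ℂ)ˣ).val
  set Q : Polynomial ℂ := MvPolynomial.eval₂ Polynomial.C (fun p : Idx n × Idx n =>
    Polynomial.C (M p.1 p.2) + Polynomial.X * Polynomial.C ((M * f i) p.1 p.2)) P with hQ
  have hev : ∀ t, Q.eval t = F (g * y i t) := by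
    intro t
    rw [hP, hQ, ← Polynomial.coe_evalRingHom, MvPolynomial.hom_eval₂, MvPolynomial.eval,
      MvPolynomial.coe_eval₂Hom]
    congr 1
    · ext z; simp
    · funext p
      rw [G_val_mul, y_val, mul_add, mul_one, mul_smul_comm]
      simp [M, mul_comm t]
  have hQ0 : Q = 0 := by
    refine Polynomial.eq_zero_of_infinite_isRoot _ ?_
    have hfin : {t : ℂ | 1 + c * t = 0}.Finite := by
      refine Set.Subsingleton.finite fun a ha b hb => ?_
      have ha' : 1 + c * a = 0 := ha
      have hb' : 1 + c * b = 0 := hb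
      have hc : c ≠ 0 := by rintro rfl; simp at ha'
      exact mul_left_cancel₀ hc (add_left_cancel (ha'.trans hb'.symm))
    refine hfin.infinite_compl.mono fun t ht => ?_
    show Q.eval t = 0
    rw [hev]
    exact h t ht
  rw [← hev, hQ0, Polynomial.eval_zero]

theorem closure_x_y {n : ℕ} : Subgroup.closure
    (Set.range (fun p : Fin n × ℂ => (x p.1 p.2 : G n)) ∪
      Set.range (fun p : Fin n × ℂ => (y p.1 p.2 : G n))) = ⊤ := by
  refine Eq.trans ?_ (Subgroup.closure_closure_coe_preimage (k :=
    Set.range (fun p : Fin n × ℂ => expUnit (e p.1) (e_mul_e p.1) p.2) ∪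
      Set.range (fun p : Fin n × ℂ => expUnit (f p.1) (f_mul_f p.1) p.2)))
  refine congrArg Subgroup.closure ?_
  ext g
  simp only [Set.mem_union, Set.mem_range]
  exact or_congr (exists_congr fun p => ⟨fun h => h ▸ rfl, fun h => Subtype.ext h⟩)
    (exists_congr fun p => ⟨fun h => h ▸ rfl, fun h => Subtype.ext h⟩)

/-- Density of the big cell, proved by induction on a word in the root subgroups without invoking
the Zariski topology. -/
theorem IsRegular.eq_zero {n : ℕ} (hn : 3 ≤ n) {F : G n → ℂ} (hF : IsRegular F)
    (h : ∀ g ∈ BigCell n, F g = 0) (g : G n) : F g = 0 := by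
  have hg : g ∈ Subgroup.closure
    (Set.range (fun p : Fin n × ℂ => (x p.1 p.2 : G n)) ∪
      Set.range (fun p : Fin n × ℂ => (y p.1 p.2 : G n))) := by rw [closure_x_y]; trivial
  -- The induction has to range over all such functions, since its step replaces `F` by a right
  -- translate.
  suffices H : ∀ F : G n → ℂ, IsRegular F → (∀ g ∈ BigCell n, F g = 0) → F g = 0 from H F hF h
  clear hF h F
  have hx : ∀ (g : G n) (i : Fin n) (t : ℂ),
      (∀ F : G n → ℂ, IsRegular F → (∀ g ∈ BigCell n, F g = 0) → F g = 0) →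
      ∀ F : G n → ℂ, IsRegular F → (∀ g ∈ BigCell n, F g = 0) → F (g * x i t) = 0 :=
    fun g i t hg F hF h => hg (fun g => F (g * x i t)) (hF.mul_right _)
      fun g' hg' => h _ (BigCell_mul_x hg' i t)
  have hy : ∀ (g : G n) (i : Fin n) (t : ℂ),
      (∀ F : G n → ℂ, IsRegular F → (∀ g ∈ BigCell n, F g = 0) → F g = 0) →
      ∀ F : G n → ℂ, IsRegular F → (∀ g ∈ BigCell n, F g = 0) → F (g * y i t) = 0 := by
    intro g i t hg F hF h
    refine hg (fun g => F (g * y i t)) (hF.mul_right _) fun g' hg' => ?_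
    obtain ⟨c, hc⟩ := BigCell_mul_y hn hg' i
    exact hF.eq_zero_of_y g' i c (fun t ht => h _ (hc t ht)) t
  induction hg using Subgroup.closure_induction_right with
  | one => exact fun F _ h => h 1 (one_mem_BigCell hn)
  | mul_right g _ s hs ih =>
    rcases hs with ⟨p, rfl⟩ | ⟨p, rfl⟩
    · exact hx _ _ _ ih
    · exact hy _ _ _ ih
  | mul_inv_cancel g _ s hs ih =>
    rcases hs with ⟨p, rfl⟩ | ⟨p, rfl⟩
    · rw [x_inv hn]; exact hx _ _ _ ih
    · rw [y_inv hn]; exact hy _ _ _ ih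

theorem IsRegular.sub {n : ℕ} {F F' : G n → ℂ} (hF : IsRegular F) (hF' : IsRegular F') :
    IsRegular fun g => F g - F' g := by
  obtain ⟨P, hP⟩ := hF
  obtain ⟨P', hP'⟩ := hF'
  exact ⟨P - P', fun g => by rw [map_sub, ← hP, ← hP']⟩

theorem IsPrincipalMinor.unique {n : ℕ} (hn : 3 ≤ n) {μ : Fin n → ℕ} {F F' : G n → ℂ}
    (hF : IsPrincipalMinor μ F) (hF' : IsPrincipalMinor μ F') : F = F' := by
  funext g
  refine sub_eq_zero.1 ((hF.1.sub hF'.1).eq_zero hn ?_ g)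
  rintro _ ⟨u, hu, a, v, hv, rfl⟩
  rw [hF.2 u hu a v hv, hF'.2 u hu a v hv, sub_self]

theorem principalMinor_eq {n : ℕ} (hn : 3 ≤ n) {μ : Fin n → ℕ} {F : G n → ℂ}
    (hF : IsPrincipalMinor μ F) : principalMinor μ = F :=
  IsPrincipalMinor.unique hn (Classical.epsilon_spec ⟨F, hF⟩) hF

/-! ### Determinantal principal minors -/

/-- The minor of `g` with rows and columns indexed by `r`. -/
def minorOf {n m : ℕ} (r : Fin m → Idx n) (g : G n) : ℂ :=
  ((g : (Matrix (Idx n) (Idx n) ℂ)ˣ).val.submatrix r r).det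

theorem minorOf_isRegular {n m : ℕ} (r : Fin m → Idx n) : IsRegular (minorOf r) := by
  refine ⟨(Matrix.of fun i j => MvPolynomial.X (r i, r j)).det, fun g => ?_⟩
  rw [minorOf, RingHom.map_det]
  congr 1
  ext i j
  simp

open scoped Classical in
-- The hypothesis `hup` makes the span of the listed vectors stable under raising, each raise
-- landing strictly earlier in the list. So the minor is multiplicative here and the minor of
-- `x_i(t)` is unitriangular.
theorem minorOf_x {n m : ℕ} {r : Fin m → Idx n} (hr : Function.Injective r)
    (hup : ∀ (i : Fin n) (k : Fin m) (a : Idx n), Raise i (r k) a → ∃ k' < k, a = r k')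
    (i : Fin n) (t : ℂ) (g : G n) : minorOf r (g * x i t) = minorOf r g := by
  have hsub : (1 + t • e i).submatrix r r = Matrix.of fun a b => if a = b then 1 else
      if Raise i (r b) (r a) then t else 0 := by
    ext a b
    simp only [submatrix_apply, Matrix.add_apply, Matrix.smul_apply, one_apply, hr.eq_iff, of_apply, e]
    by_cases hab : a = b
    · subst hab
      have : ¬ Raise i (r a) (r a) := fun h => h.not_raise h
      simp [this]
    · simp [hab]
  have hdet : ((1 + t • e i).submatrix r r).det = 1 := by
    rw [hsub, det_of_isUpperTriangular]
    · simp
    · intro a b (hab : b < a)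
      simp only [of_apply, hab.ne', if_false]
      rw [if_neg]
      intro h
      obtain ⟨k, hk, hk'⟩ := hup i b _ h
      exact absurd (hr hk' ▸ hk) hab.asymm
  have hmul : ((g * x i t : G n) : (Matrix (Idx n) (Idx n) ℂ)ˣ).val.submatrix r r =
      (g : (Matrix (Idx n) (Idx n) ℂ)ˣ).val.submatrix r r * (1 + t • e i).submatrix r r := by
    ext a b
    rw [G_val_mul, x_val, submatrix_apply, mul_apply, mul_apply]
    refine (Finset.sum_subset_zero_on_sdiff (Finset.subset_univ (Finset.univ.image r)) ?_
      fun _ _ => rfl).symm.trans ?_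
    · intro c hc
      simp only [Finset.mem_sdiff, Finset.mem_univ, true_and, Finset.mem_image, not_exists] at hc
      have h1 : c ≠ r b := fun h => hc b h.symm
      have h2 : ¬ Raise i (r b) c := fun h => by
        obtain ⟨k, -, hk⟩ := hup i b _ h
        exact hc k hk.symm
      simp [e, h1, h2, one_apply]
    · rw [Finset.sum_image fun _ _ _ _ h => hr h]
      rfl
  rw [minorOf, hmul, det_mul, hdet, mul_one, minorOf]

open scoped Classical in
theorem minorOf_y {n m : ℕ} {r : Fin m → Idx n} (hr : Function.Injective r)
    (hup : ∀ (i : Fin n) (k : Fin m) (a : Idx n), Raise i (r k) a → ∃ k' < k, a = r k')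
    (i : Fin n) (t : ℂ) (g : G n) : minorOf r (y i t * g) = minorOf r g := by
  have hsub : (1 + t • f i).submatrix r r = Matrix.of fun a b => if a = b then 1 else
      if Raise i (r a) (r b) then t else 0 := by
    ext a b
    simp only [submatrix_apply, Matrix.add_apply, Matrix.smul_apply, one_apply, hr.eq_iff, of_apply, f]
    by_cases hab : a = b
    · subst hab
      have : ¬ Raise i (r a) (r a) := fun h => h.not_raise h
      simp [this]
    · simp [hab]
  have hdet : ((1 + t • f i).submatrix r r).det = 1 := by
    rw [hsub, det_of_isLowerTriangular]
    · simp
    · intro a b (hab : a < b)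
      simp only [of_apply, hab.ne, if_false]
      rw [if_neg]
      intro h
      obtain ⟨k, hk, hk'⟩ := hup i a _ h
      exact absurd (hr hk' ▸ hk) hab.asymm
  have hmul : ((y i t * g : G n) : (Matrix (Idx n) (Idx n) ℂ)ˣ).val.submatrix r r =
      (1 + t • f i).submatrix r r * (g : (Matrix (Idx n) (Idx n) ℂ)ˣ).val.submatrix r r := by
    ext a b
    rw [G_val_mul, y_val, submatrix_apply, mul_apply, mul_apply]
    refine (Finset.sum_subset_zero_on_sdiff (Finset.subset_univ (Finset.univ.image r)) ?_
      fun _ _ => rfl).symm.trans ?_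
    · intro c hc
      simp only [Finset.mem_sdiff, Finset.mem_univ, true_and, Finset.mem_image, not_exists] at hc
      have h1 : r a ≠ c := fun h => hc a h
      have h2 : ¬ Raise i (r a) c := fun h => by
        obtain ⟨k, -, hk⟩ := hup i a _ h
        exact hc k hk.symm
      simp [f, h1, h2, one_apply]
    · rw [Finset.sum_image fun _ _ _ _ h => hr h]
      rfl
  rw [minorOf, hmul, det_mul, hdet, one_mul, minorOf]

theorem minorOf_torus {n m : ℕ} (hn : 3 ≤ n) {r : Fin m → Idx n} (hr : Function.Injective r)
    (a : Fin n → ℂˣ) : minorOf r (torus a) = ∏ i, (a i : ℂ) ^ ∑ k, pr i (r k) := by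
  have : (torus a : (Matrix (Idx n) (Idx n) ℂ)ˣ).val.submatrix r r =
      diagonal fun k => ∏ i, (a i : ℂ) ^ pr i (r k) := by
    ext k l
    rw [submatrix_apply, ← ap_single, ap_torus hn, diagonal_apply, Pi.single_apply]
    simp only [hr.eq_iff]
    split_ifs <;> simp
  rw [minorOf, this, det_diagonal, Finset.prod_comm]
  refine Finset.prod_congr rfl fun i _ => ?_
  have hz : ∀ s : Finset (Fin m), ∏ k ∈ s, (a i : ℂ) ^ pr i (r k) = (a i : ℂ) ^ ∑ k ∈ s, pr i (r k) := by
    intro s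
    induction s using Finset.cons_induction with
    | empty => simp
    | cons k s hk ih => rw [Finset.prod_cons, Finset.sum_cons, ih, zpow_add₀ (a i).ne_zero]
  exact hz _

theorem minorOf_isPrincipalMinor {n m : ℕ} (hn : 3 ≤ n) {r : Fin m → Idx n}
    (hr : Function.Injective r)
    (hup : ∀ (i : Fin n) (k : Fin m) (a : Idx n), Raise i (r k) a → ∃ k' < k, a = r k')
    {μ : Fin n → ℕ} (hμ : ∀ i, ∑ k, pr i (r k) = μ i) : IsPrincipalMinor μ (minorOf r) := by
  have hU : ∀ u ∈ Uplus n, ∀ g, minorOf r (g * u) = minorOf r g := by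
    intro u hu
    induction hu using Subgroup.closure_induction with
    | mem u hu => obtain ⟨p, rfl⟩ := hu; exact minorOf_x hr hup _ _
    | one => simp
    | mul u v _ _ hu hv => intro g; rw [← mul_assoc, hv, hu]
    | inv u _ hu => intro g; rw [← hu, inv_mul_cancel_right]
  have hU' : ∀ u ∈ Uminus n, ∀ g, minorOf r (u * g) = minorOf r g := by
    intro u hu
    induction hu using Subgroup.closure_induction with
    | mem u hu => obtain ⟨p, rfl⟩ := hu; exact minorOf_y hr hup _ _
    | one => simp
    | mul u v _ _ hu hv => intro g; rw [mul_assoc, hu, hv]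
    | inv u _ hu => intro g; rw [← hu, mul_inv_cancel_left]
  refine ⟨minorOf_isRegular r, fun u hu a v hv => ?_⟩
  rw [hU v hv, hU' u hu, minorOf_torus hn hr]
  refine Finset.prod_congr rfl fun i _ => ?_
  rw [hμ, zpow_natCast]

end TypeD

end

noncomputable section

namespace TypeD

open Matrix

/-! ### The reflection representation over `ℤ` -/

/-- The simple reflection in `ε`-coordinates. -/
def refl {n : ℕ} (i : Fin n) : Module.End ℤ (Fin n → ℤ) where
  toFun v := v - (sroot i ⬝ᵥ v) • sroot i
  map_add' v w := by rw [dotProduct_add, add_smul]; abel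
  map_smul' c v := by
    rw [dotProduct_smul, smul_sub, smul_smul]; rfl

theorem refl_apply {n : ℕ} (i : Fin n) (v : Fin n → ℤ) :
    refl i v = v - (sroot i ⬝ᵥ v) • sroot i := rfl

theorem refl_lo {n : ℕ} (hn : 3 ≤ n) (i : Fin n) (v : Fin n → ℤ) :
    refl i v (lo i) = -sg i * v (hi i) := by
  rw [refl_apply, Pi.sub_apply, Pi.smul_apply, sroot_lo hn, sroot_dot]
  simp

theorem refl_hi {n : ℕ} (hn : 3 ≤ n) (i : Fin n) (v : Fin n → ℤ) :
    refl i v (hi i) = -sg i * v (lo i) := by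
  rw [refl_apply, Pi.sub_apply, Pi.smul_apply, sroot_hi hn, sroot_dot, smul_eq_mul]
  linear_combination -(v (hi i)) * sg_mul_sg i

theorem refl_of_ne {n : ℕ} {i j : Fin n} (h1 : j ≠ lo i) (h2 : j ≠ hi i) (v : Fin n → ℤ) :
    refl i v j = v j := by
  rw [refl_apply, Pi.sub_apply, Pi.smul_apply, sroot_of_ne h1 h2]
  simp

theorem refl_single_lo {n : ℕ} (hn : 3 ≤ n) (i : Fin n) (t : ℤ) :
    refl i (Pi.single (lo i) t) = Pi.single (hi i) (-sg i * t) := by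
  have hne := lo_ne_hi hn i
  funext j
  by_cases h1 : j = lo i
  · subst h1; rw [refl_lo hn]; simp [hne, hne.symm]
  · by_cases h2 : j = hi i
    · subst h2; rw [refl_hi hn]; simp
    · rw [refl_of_ne h1 h2]; simp [h1, h2]

theorem refl_single_hi {n : ℕ} (hn : 3 ≤ n) (i : Fin n) (t : ℤ) :
    refl i (Pi.single (hi i) t) = Pi.single (lo i) (-sg i * t) := by
  have hne := lo_ne_hi hn i
  funext j
  by_cases h1 : j = lo i
  · subst h1; rw [refl_lo hn]; simp
  · by_cases h2 : j = hi i
    · subst h2; rw [refl_hi hn]; simp [hne, hne.symm]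
    · rw [refl_of_ne h1 h2]; simp [h1, h2]

theorem refl_single_of_ne {n : ℕ} {i j : Fin n} (h1 : j ≠ lo i) (h2 : j ≠ hi i) (t : ℤ) :
    refl i (Pi.single j t) = Pi.single j t := by
  rw [refl_apply, dotProduct_single, sroot_of_ne h1 h2]
  simp

theorem sroot_dot_refl {n : ℕ} (hn : 3 ≤ n) (i : Fin n) (v : Fin n → ℤ) :
    sroot i ⬝ᵥ refl i v = -(sroot i ⬝ᵥ v) := by
  rw [refl_apply, dotProduct_sub, dotProduct_smul, sroot_dot_self hn, smul_eq_mul]; ring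

theorem refl_refl {n : ℕ} (hn : 3 ≤ n) (i : Fin n) (v : Fin n → ℤ) : refl i (refl i v) = v := by
  rw [refl_apply i (refl i v), sroot_dot_refl hn, refl_apply]
  module

theorem dot_refl {n : ℕ} (i : Fin n) (v w : Fin n → ℤ) : v ⬝ᵥ refl i w = refl i v ⬝ᵥ w := by
  rw [refl_apply, refl_apply, dotProduct_sub, sub_dotProduct, dotProduct_smul, smul_dotProduct,
    dotProduct_comm v (sroot i), smul_eq_mul, smul_eq_mul, mul_comm]

/-- A simple reflection swaps two coordinates and changes either no sign or two. This invariant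
distinguishes type `D` from type `B`, and later fixes the sign of the last coordinate. -/
theorem prod_refl {n : ℕ} (hn : 3 ≤ n) (i : Fin n) (v : Fin n → ℤ) :
    ∏ j, refl i v j = ∏ j, v j := by
  have hne := lo_ne_hi hn i
  have h : ∀ j, refl i v j =
      (if j = lo i ∨ j = hi i then -sg i else 1) * v (Equiv.swap (lo i) (hi i) j) := by
    intro j
    by_cases h1 : j = lo i
    · subst h1; rw [refl_lo hn]; simp
    · by_cases h2 : j = hi i
      · subst h2; rw [refl_hi hn]; simp
      · rw [refl_of_ne h1 h2, Equiv.swap_apply_of_ne_of_ne h1 h2]; simp [h1, h2]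
  simp only [h]
  rw [Finset.prod_mul_distrib, Equiv.prod_comp (Equiv.swap (lo i) (hi i)) v,
    Fintype.prod_eq_mul (lo i) (hi i) hne fun j hj => by simp [hj.1, hj.2]]
  simp [sg_mul_sg]

/-- The action of a word in the simple reflections. -/
def wact {n : ℕ} (l : List (Fin n)) : Module.End ℤ (Fin n → ℤ) := (l.map refl).prod

theorem wact_nil {n : ℕ} (v : Fin n → ℤ) : wact [] v = v := rfl

theorem wact_cons {n : ℕ} (i : Fin n) (l : List (Fin n)) (v : Fin n → ℤ) :
    wact (i :: l) v = refl i (wact l v) := by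
  simp [wact]

theorem wact_append {n : ℕ} (l l' : List (Fin n)) (v : Fin n → ℤ) :
    wact (l ++ l') v = wact l (wact l' v) := by
  simp [wact]

theorem wact_reverse_wact {n : ℕ} (hn : 3 ≤ n) (l : List (Fin n)) (v : Fin n → ℤ) :
    wact l.reverse (wact l v) = v := by
  induction l generalizing v with
  | nil => rfl
  | cons i l ih =>
    rw [List.reverse_cons, wact_append, wact_cons, wact_cons, wact_nil, refl_refl hn, ih]

theorem wact_injective {n : ℕ} (hn : 3 ≤ n) (l : List (Fin n)) : Function.Injective (wact l) :=
  Function.LeftInverse.injective (wact_reverse_wact hn l)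

theorem dot_wact {n : ℕ} (l : List (Fin n)) (v w : Fin n → ℤ) :
    v ⬝ᵥ wact l w = wact l.reverse v ⬝ᵥ w := by
  induction l generalizing v with
  | nil => rfl
  | cons i l ih => rw [wact_cons, dot_refl, ih, List.reverse_cons, wact_append, wact_cons, wact_nil]

theorem wact_dot_wact {n : ℕ} (hn : 3 ≤ n) (l : List (Fin n)) (v w : Fin n → ℤ) :
    wact l v ⬝ᵥ wact l w = v ⬝ᵥ w := by
  rw [dot_wact, wact_reverse_wact hn]

theorem prod_wact {n : ℕ} (hn : 3 ≤ n) (l : List (Fin n)) (v : Fin n → ℤ) :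
    ∏ j, wact l v j = ∏ j, v j := by
  induction l with
  | nil => rfl
  | cons i l ih => rw [wact_cons, prod_refl hn, ih]

/-! ### Comparison with the Weyl group -/

/-- The pairing of a weight with an element of the Cartan subalgebra. -/
def pairing {n : ℕ} (v : Fin n → ℤ) (h : Fin n → ℂ) : ℂ := ∑ j, ((sroot j ⬝ᵥ v : ℤ) : ℂ) * h j

theorem pairing_refl {n : ℕ} (hn : 3 ≤ n) (i : Fin n) (v : Fin n → ℤ) (h : Fin n → ℂ) :
    pairing (refl i v) h = pairing v (simpleReflection i h) := by
  have h1 : simpleReflection i h = h - simpleRoot i h • Pi.single i (1 : ℂ) := by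
    rw [simpleReflection, Module.reflection_apply]
  have h2 : simpleRoot i h = ∑ j, ((sroot j ⬝ᵥ sroot i : ℤ) : ℂ) * h j := by
    simp [simpleRoot, LinearMap.sum_apply, cartan_eq hn]
  have h3 : pairing v (h - simpleRoot i h • Pi.single i (1 : ℂ)) =
      pairing v h - simpleRoot i h * ((sroot i ⬝ᵥ v : ℤ) : ℂ) := by
    simp only [pairing, Pi.sub_apply, Pi.smul_apply, smul_eq_mul, mul_sub, Finset.sum_sub_distrib]
    congr 1
    rw [Finset.sum_eq_single i]
    · simp [mul_comm]
    · intro j _ hj; simp [Pi.single_eq_of_ne hj]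
    · simp
  rw [h1, h3, h2, pairing, pairing, Finset.sum_mul, ← Finset.sum_sub_distrib]
  refine Finset.sum_congr rfl fun j _ => ?_
  rw [refl_apply, dotProduct_sub, dotProduct_smul, smul_eq_mul]
  push_cast
  ring

/-- Invariance of the pairing transfers questions about the Weyl group on `𝔱` to signed permutations
of integer vectors. -/
theorem pairing_wact {n : ℕ} (hn : 3 ≤ n) (l : List (Fin n)) (v : Fin n → ℤ) (h : Fin n → ℂ) :
    pairing (wact l v) ((l.map s).prod.1 h) = pairing v h := by
  induction l with
  | nil => rfl
  | cons i l ih =>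
    have h1 : ((i :: l).map s).prod.1 h = simpleReflection i ((l.map s).prod.1 h) := by
      rw [List.map_cons, List.prod_cons]; rfl
    have h2 : ∀ u, simpleReflection i (simpleReflection i u) = u :=
      Module.involutive_reflection (simpleRoot_coroot i)
    rw [h1, wact_cons, pairing_refl hn, h2, ih]

/-- The matrix of simple roots in `ε`-coordinates. -/
def srootMatrix (n : ℕ) : Matrix (Fin n) (Fin n) ℂ := Matrix.of fun i j => (sroot i j : ℂ)

/-- The two spin-node equations annihilate the last coordinate of a kernel vector; the chain
equations propagate the zero leftwards. Both sides of `pairing` are therefore nondegenerate. -/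
theorem isUnit_srootMatrix {n : ℕ} (hn : 3 ≤ n) : IsUnit (srootMatrix n) := by
  rw [← mulVec_injective_iff_isUnit]
  refine (injective_iff_map_eq_zero' (srootMatrix n).mulVecLin).2 fun u => ⟨fun hu => ?_, fun hu => by rw [hu, map_zero]⟩
  have h : ∀ i, u (lo i) + sg i * u (hi i) = 0 := by
    intro i
    have h1 : ((srootMatrix n) *ᵥ u) i = 0 := congrFun hu i
    rw [← h1]
    have hne := lo_ne_hi hn i
    rw [mulVec, dotProduct, Fintype.sum_eq_add (lo i) (hi i) hne]
    · simp [srootMatrix, sroot_lo hn, sroot_hi hn]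
    · rintro j ⟨hj1, hj2⟩
      simp [srootMatrix, sroot_of_ne hj1 hj2]
  have hlast : u ⟨n - 1, by omega⟩ = 0 := by
    have h1 := h ⟨n - 1, by omega⟩
    have h2 := h ⟨n - 2, by omega⟩
    have e1 : lo (⟨n - 1, by omega⟩ : Fin n) = ⟨n - 2, by omega⟩ :=
      Fin.ext (by rw [lo_val]; simp only; split_ifs <;> omega)
    have e2 : hi (⟨n - 1, by omega⟩ : Fin n) = ⟨n - 1, by omega⟩ :=
      Fin.ext (by rw [hi_val]; simp only; split_ifs <;> omega)
    have e3 : lo (⟨n - 2, by omega⟩ : Fin n) = ⟨n - 2, by omega⟩ :=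
      Fin.ext (by rw [lo_val]; simp only; split_ifs <;> omega)
    have e4 : hi (⟨n - 2, by omega⟩ : Fin n) = ⟨n - 1, by omega⟩ :=
      Fin.ext (by rw [hi_val]; simp only; split_ifs <;> omega)
    have e5 : sg (⟨n - 1, by omega⟩ : Fin n) = 1 := if_pos (by simp only; omega)
    have e6 : sg (⟨n - 2, by omega⟩ : Fin n) = -1 := if_neg (by simp only; omega)
    rw [e1, e2, e5] at h1
    rw [e3, e4, e6] at h2
    push_cast at h1 h2
    linear_combination (h1 - h2) / 2
  have hall : ∀ d : ℕ, ∀ j : Fin n, j.val + d + 1 = n → u j = 0 := by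
    intro d
    induction d with
    | zero =>
      intro j hj
      rw [← hlast]; congr 1; exact Fin.ext (by simp only; omega)
    | succ d ih =>
      intro j hj
      have h1 := h j
      have e3 : lo j = j := Fin.ext (by rw [lo_val, if_neg (by omega)])
      have e4 : hi j = ⟨j.val + 1, by omega⟩ := Fin.ext (by rw [hi_val, if_neg (by omega)])
      rw [e3, e4, ih ⟨j.val + 1, by omega⟩ (by simp only; omega), mul_zero, add_zero] at h1
      exact h1
  funext j
  exact hall (n - 1 - j.val) j (by omega)

theorem eq_of_pairing_right {n : ℕ} (hn : 3 ≤ n) {h h' : Fin n → ℂ}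
    (H : ∀ v : Fin n → ℤ, pairing v h = pairing v h') : h = h' := by
  refine vecMul_injective_iff_isUnit.2 (isUnit_srootMatrix hn) ?_
  funext j
  have := H (Pi.single j 1)
  simp only [pairing, dotProduct_single, mul_one] at this
  simpa [vecMul, dotProduct, srootMatrix, mul_comm] using this

theorem eq_of_pairing_left {n : ℕ} (hn : 3 ≤ n) {v v' : Fin n → ℤ}
    (H : ∀ h : Fin n → ℂ, pairing v h = pairing v' h) : v = v' := by
  have : (fun j => (v j : ℂ)) = fun j => (v' j : ℂ) := by
    refine mulVec_injective_iff_isUnit.2 (isUnit_srootMatrix hn) ?_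
    funext i
    have h1 : ∀ v : Fin n → ℤ, pairing v (Pi.single i 1) = (srootMatrix n *ᵥ fun j => (v j : ℂ)) i := by
      intro v
      rw [pairing, Finset.sum_eq_single i]
      · simp [srootMatrix, mulVec, dotProduct]
      · intro j _ hj; simp [Pi.single_eq_of_ne hj]
      · simp
    rw [← h1, ← h1, H]
  funext j
  exact_mod_cast congrFun this j

theorem prod_s_eq_iff {n : ℕ} (hn : 3 ≤ n) (l l' : List (Fin n)) :
    (l.map s).prod = (l'.map s).prod ↔ wact l = wact l' := by
  constructor
  · intro h
    refine LinearMap.ext fun v => eq_of_pairing_left hn fun u => ?_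
    obtain ⟨u, rfl⟩ := (l.map s).prod.1.surjective u
    rw [pairing_wact hn, h, pairing_wact hn]
  · intro h
    refine Subtype.ext (LinearEquiv.ext fun u => eq_of_pairing_right hn fun v => ?_)
    obtain ⟨v, rfl⟩ : ∃ w, wact l w = v :=
      ⟨wact l.reverse v, by simpa using wact_reverse_wact hn l.reverse v⟩
    rw [pairing_wact hn, h, pairing_wact hn]

/-! ### Positive roots and inversions -/

/-- The positive roots `ε_a ± ε_b`, `a < b`. -/
def posRoots (n : ℕ) : Finset (Fin n → ℤ) :=
  ((Finset.univ.filter fun p : Fin n × Fin n => p.1 < p.2) ×ˢ ({1, -1} : Finset ℤ)).image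
    fun p => Pi.single p.1.1 1 + Pi.single p.1.2 p.2

theorem mem_posRoots {n : ℕ} {γ : Fin n → ℤ} : γ ∈ posRoots n ↔
    ∃ a b : Fin n, ∃ t : ℤ, a < b ∧ (t = 1 ∨ t = -1) ∧ γ = Pi.single a 1 + Pi.single b t := by
  simp only [posRoots, Finset.mem_image, Finset.mem_product, Finset.mem_filter, Finset.mem_univ,
    true_and, Finset.mem_insert, Finset.mem_singleton, Prod.exists]
  constructor
  · rintro ⟨a, b, t, ⟨h1, h2⟩, rfl⟩; exact ⟨a, b, t, h1, h2, rfl⟩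
  · rintro ⟨a, b, t, h1, h2, rfl⟩; exact ⟨a, b, t, ⟨h1, h2⟩, rfl⟩

theorem sroot_mem_posRoots {n : ℕ} (hn : 3 ≤ n) (i : Fin n) : sroot i ∈ posRoots n :=
  mem_posRoots.2 ⟨lo i, hi i, sg i, lo_lt_hi hn i, sg_eq i, rfl⟩

/-- Only this bound is needed. Ordered pairs of distinct indices are injected into signed pairs `a <
b`, the order of the pair deciding the sign. -/
theorem card_posRoots {n : ℕ} : n * (n - 1) ≤ (posRoots n).card := by
  have h1 : (Finset.univ : Finset (Fin n)).offDiag.card = n * (n - 1) := by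
    rw [Finset.offDiag_card]; simp [Nat.mul_sub]
  rw [posRoots, Finset.card_image_of_injOn, ← h1]
  · refine Finset.card_le_card_of_injOn
      (fun p => if p.1 < p.2 then ((p.1, p.2), (1 : ℤ)) else ((p.2, p.1), -1)) ?_ ?_
    · rintro ⟨a, b⟩ hab
      simp only [Finset.coe_offDiag, Finset.coe_univ, Set.mem_offDiag, Set.mem_univ, true_and] at hab
      by_cases h : a < b
      · simp [h]
      · simp [h, lt_of_le_of_ne (not_lt.1 h) (Ne.symm hab)]
    · rintro ⟨a, b⟩ - ⟨c, d⟩ - h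
      simp only at h
      split_ifs at h <;> simp_all
  · rintro ⟨⟨a, b⟩, t⟩ hp ⟨⟨c, d⟩, s⟩ hq h
    simp only [Finset.coe_product, Finset.coe_filter, Finset.mem_univ, true_and, Finset.coe_insert,
      Finset.coe_singleton, Set.mem_prod, Set.mem_ofPred_eq, Set.mem_insert_iff,
      Set.mem_singleton_iff] at hp hq
    simp only at h
    have hac : a = c := by
      by_contra hac
      have h1 := congrFun h a
      have h2 := congrFun h c
      simp only [Pi.add_apply, Pi.single_apply, hac, Ne.symm hac, hp.1.ne, hq.1.ne, if_true, if_false,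
        add_zero, zero_add] at h1 h2
      have h3 : a = d := by by_contra h3; simp [h3] at h1
      have h4 : c = b := by by_contra h4; simp [h4] at h2
      exact absurd (hp.1.trans (h4 ▸ hq.1)) (by rw [h3]; exact lt_irrefl _)
    subst hac
    have h1 := add_left_cancel h
    have h2 := congrFun h1 b
    have h3 : b = d := by
      by_contra h3
      simp only [Pi.single_eq_same, Pi.single_eq_of_ne h3] at h2
      omega
    subst h3
    simp only [Pi.single_eq_same] at h2
    rw [h2]

theorem posRoots_dot {n : ℕ} {a b : Fin n} {t : ℤ} (v : Fin n → ℤ) :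
    (Pi.single a 1 + Pi.single b t : Fin n → ℤ) ⬝ᵥ v = v a + t * v b := by
  simp [add_dotProduct]

/-- The reflection exchanges the adjacent places `lo i` and `hi i`, with sign changes only when `hi
i` is the last place. Hence the leading index or its sign can only be spoilt when both places are
involved, and then the root is `α_i` or is fixed. -/
theorem refl_mem_posRoots {n : ℕ} (hn : 3 ≤ n) (i : Fin n) {γ : Fin n → ℤ} (hγ : γ ∈ posRoots n)
    (hne : γ ≠ sroot i) : refl i γ ∈ posRoots n := by
  obtain ⟨a, b, t, hab, ht, rfl⟩ := mem_posRoots.1 hγ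
  have hlh := lo_lt_hi hn i
  have hadj : (hi i).val = (lo i).val + 1 := by
    have := i.2
    rw [lo_val, hi_val]; split_ifs <;> omega
  have hlast : sg i = 1 → (hi i).val + 1 = n := by
    intro h
    unfold sg at h
    rw [hi_val]
    split_ifs at h ⊢ <;> omega
  have hab' : a.val < b.val := hab
  have hb := b.2
  have hs : ∀ t : ℤ, (t = 1 ∨ t = -1) → (-sg i * t = 1 ∨ -sg i * t = -1) := by
    intro t ht
    rcases sg_eq i with h | h <;> rcases ht with h' | h' <;> simp [h, h']
  rw [map_add, mem_posRoots]
  by_cases h1 : a = lo i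
  · by_cases h2 : b = hi i
    · refine ⟨a, b, t, hab, ht, ?_⟩
      have : t = -sg i := by
        have h3 : t ≠ sg i := by rintro rfl; exact hne (by rw [h1, h2]; rfl)
        rcases sg_eq i with h | h <;> rcases ht with h' | h' <;> omega
      rw [h1, h2, refl_single_lo hn, refl_single_hi hn, this]
      rw [show -sg i * -sg i = 1 by linear_combination sg_mul_sg i, mul_one, add_comm]
    · have h3 : b.val ≠ (hi i).val := fun h => h2 (Fin.ext h)
      have h4 : a.val = (lo i).val := congrArg _ h1
      have h5 : sg i = -1 := (sg_eq i).resolve_left fun h => by have := hlast h; omega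
      refine ⟨hi i, b, t, Fin.lt_def.2 (by omega), ht, ?_⟩
      rw [h1, refl_single_lo hn, refl_single_of_ne (Fin.ne_of_val_ne (by omega)) h2, h5]
      rfl
  · by_cases h2 : a = hi i
    · have h4 : a.val = (hi i).val := congrArg _ h2
      have h5 : sg i = -1 := (sg_eq i).resolve_left fun h => by have := hlast h; omega
      refine ⟨lo i, b, t, Fin.lt_def.2 (by omega), ht, ?_⟩
      rw [h2, refl_single_hi hn, refl_single_of_ne (Fin.ne_of_val_ne (by omega))
        (Fin.ne_of_val_ne (by omega)), h5]
      rfl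
    · rw [refl_single_of_ne h1 h2]
      have h1' : a.val ≠ (lo i).val := fun h => h1 (Fin.ext h)
      by_cases h3 : b = lo i
      · have h4 : b.val = (lo i).val := congrArg _ h3
        refine ⟨a, hi i, -sg i * t, Fin.lt_def.2 (by omega), hs t ht, ?_⟩
        rw [h3, refl_single_lo hn]
      · by_cases h4 : b = hi i
        · have h5 : b.val = (hi i).val := congrArg _ h4
          refine ⟨a, lo i, -sg i * t, Fin.lt_def.2 (by omega), hs t ht, ?_⟩
          rw [h4, refl_single_hi hn]
        · exact ⟨a, b, t, hab, ht, by rw [refl_single_of_ne h3 h4]⟩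

theorem card_filter_refl {n : ℕ} (hn : 3 ≤ n) (i : Fin n) (P : (Fin n → ℤ) → Prop)
    [DecidablePred P] :
    (((posRoots n).erase (sroot i)).filter fun γ => P (refl i γ)).card =
      (((posRoots n).erase (sroot i)).filter P).card := by
  have hmem : ∀ γ ∈ (posRoots n).erase (sroot i), refl i γ ∈ (posRoots n).erase (sroot i) := by
    intro γ hγ
    rw [Finset.mem_erase] at hγ ⊢
    refine ⟨fun h => ?_, refl_mem_posRoots hn i hγ.2 hγ.1⟩
    have h1 : γ = -sroot i := by
      rw [← refl_refl hn i γ, h, refl_apply, sroot_dot_self hn]; module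
    obtain ⟨a, b, t, hab, -, h2⟩ := mem_posRoots.1 hγ.2
    obtain ⟨c, d, t', hcd, -, h3⟩ := mem_posRoots.1 (sroot_mem_posRoots hn i)
    -- The first nonzero coordinate of a positive root is 1, so `-α_i` is not positive.
    have hρ : ∀ (a b : Fin n) (t : ℤ), a < b → (Pi.single a 1 + Pi.single b t : Fin n → ℤ) a = 1 ∧
        ∀ j < a, (Pi.single a 1 + Pi.single b t : Fin n → ℤ) j = 0 := by
      intro a b t hab
      refine ⟨by simp [hab.ne], fun j hj => by simp [hj.ne, (hj.trans hab).ne]⟩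
    have e1 := hρ a b t hab
    have e2 := hρ c d t' hcd
    rw [← h2] at e1
    rw [← h3] at e2
    rw [h1] at e1
    simp only [Pi.neg_apply] at e1
    rcases lt_trichotomy a c with h | h | h
    · have := e2.2 a h; omega
    · subst h; omega
    · have := e1.2 c h; omega
  refine Finset.card_bij' (fun γ _ => refl i γ) (fun γ _ => refl i γ) ?_ ?_ ?_ ?_
  · intro γ hγ
    rw [Finset.mem_filter] at hγ ⊢
    exact ⟨hmem _ hγ.1, hγ.2⟩
  · intro γ hγ
    rw [Finset.mem_filter] at hγ ⊢
    exact ⟨hmem _ hγ.1, by rw [refl_refl hn]; exact hγ.2⟩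
  · intro γ _; exact refl_refl hn i γ
  · intro γ _; exact refl_refl hn i γ

theorem card_filter_posRoots {n : ℕ} (hn : 3 ≤ n) (i : Fin n) (P : (Fin n → ℤ) → Prop)
    [DecidablePred P] :
    ((posRoots n).filter P).card =
      (((posRoots n).erase (sroot i)).filter P).card + if P (sroot i) then 1 else 0 := by
  conv_lhs => rw [← Finset.insert_erase (sroot_mem_posRoots hn i), Finset.filter_insert]
  split_ifs
  · rw [Finset.card_insert_of_notMem (by simp)]
  · rfl

/-! ### Inversions, length and reduced words -/

/-- The number of positive roots that are negative on `v`. -/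
def inversions {n : ℕ} (v : Fin n → ℤ) : ℕ := ((posRoots n).filter fun γ => γ ⬝ᵥ v < 0).card

/-- Only `α_i` can change its status, as the reflection permutes the other positive roots. Placing
the corrections on opposite sides avoids subtraction and covers `α_i · v = 0`. -/
theorem inversions_refl {n : ℕ} (hn : 3 ≤ n) (i : Fin n) (v : Fin n → ℤ) :
    inversions (refl i v) + (if sroot i ⬝ᵥ v < 0 then 1 else 0) =
      inversions v + if 0 < sroot i ⬝ᵥ v then 1 else 0 := by
  have h1 := card_filter_posRoots hn i fun γ => γ ⬝ᵥ v < 0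
  have h2 := card_filter_posRoots hn i fun γ => γ ⬝ᵥ refl i v < 0
  have h3 := card_filter_refl hn i fun γ => γ ⬝ᵥ v < 0
  simp only [← dot_refl] at h3
  rw [sroot_dot_refl hn] at h2
  simp only [neg_lt_zero] at h2
  rw [inversions, inversions, h2, h3, h1]
  omega

theorem inversions_refl_le {n : ℕ} (hn : 3 ≤ n) (i : Fin n) (v : Fin n → ℤ) :
    inversions (refl i v) ≤ inversions v + 1 := by
  have := inversions_refl hn i v
  split_ifs at this <;> omega

/-- The regular dominant vector `(n, n-1, …, 1)`. -/
def rho (n : ℕ) : Fin n → ℤ := fun j => (n : ℤ) - j.val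

theorem rho_pos {n : ℕ} (j : Fin n) : 0 < rho n j := by
  have := j.2; unfold rho; omega

theorem posRoots_dot_rho {n : ℕ} {γ : Fin n → ℤ} (hγ : γ ∈ posRoots n) : 0 < γ ⬝ᵥ rho n := by
  obtain ⟨a, b, t, hab, ht, rfl⟩ := mem_posRoots.1 hγ
  rw [posRoots_dot]
  have := Fin.lt_def.1 hab
  have := b.2
  unfold rho
  rcases ht with rfl | rfl <;> omega

theorem inversions_rho {n : ℕ} : inversions (rho n) = 0 := by
  rw [inversions, Finset.card_eq_zero, Finset.filter_eq_empty_iff]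
  exact fun γ hγ => (posRoots_dot_rho hγ).asymm

theorem inversions_wact_le {n : ℕ} (hn : 3 ≤ n) (l : List (Fin n)) :
    inversions (wact l (rho n)) ≤ l.length := by
  induction l with
  | nil => rw [wact_nil, inversions_rho]; exact Nat.zero_le _
  | cons i l ih =>
    rw [wact_cons, List.length_cons]
    exact (inversions_refl_le hn i _).trans (by omega)

theorem wact_rho_regular {n : ℕ} (hn : 3 ≤ n) (l : List (Fin n)) {γ : Fin n → ℤ}
    (hγ : γ ∈ posRoots n) : γ ⬝ᵥ wact l (rho n) ≠ 0 := by
  induction l generalizing γ with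
  | nil => exact (posRoots_dot_rho hγ).ne'
  | cons i l ih =>
    rw [wact_cons]
    by_cases h : γ = sroot i
    · subst h
      rw [sroot_dot_refl hn, neg_ne_zero]
      exact ih hγ
    · rw [dot_refl]
      exact ih (refl_mem_posRoots hn i hγ h)

theorem inversions_eq_zero {n : ℕ} (hn : 3 ≤ n) {l : List (Fin n)}
    (h : inversions (wact l (rho n)) = 0) {γ : Fin n → ℤ} (hγ : γ ∈ posRoots n) :
    0 < γ ⬝ᵥ wact l (rho n) := by
  rw [inversions, Finset.card_eq_zero, Finset.filter_eq_empty_iff] at h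
  exact lt_of_le_of_ne (not_lt.1 (h hγ)) (wact_rho_regular hn l hγ).symm

/-- The vector is dominant with nonzero integer coordinates, so it dominates `ρ` in every place but
the last, where its absolute value is at least 1. Equality of norms forces equality except for the
last sign, which the product of coordinates decides. -/
theorem wact_rho_eq {n : ℕ} (hn : 3 ≤ n) {l : List (Fin n)}
    (h : inversions (wact l (rho n)) = 0) : wact l (rho n) = rho n := by
  set v := wact l (rho n) with hv
  have hpos : ∀ a b : Fin n, a < b → ∀ t : ℤ, (t = 1 ∨ t = -1) → 0 < v a + t * v b := by
    intro a b hab t ht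
    rw [← posRoots_dot]
    exact inversions_eq_zero hn h (mem_posRoots.2 ⟨a, b, t, hab, ht, rfl⟩)
  have hprod : ∏ j, v j = ∏ j, rho n j := prod_wact hn l _
  have hne : ∀ j, v j ≠ 0 := by
    intro j hj
    have h1 : ∏ j, v j = 0 := Finset.prod_eq_zero (Finset.mem_univ j) hj
    rw [hprod] at h1
    exact (Finset.prod_pos fun j _ => rho_pos j).ne' h1
  -- Descent from the last place but one. There `v_j ± v_{j+1} > 0` with `v_{j+1} ≠ 0` gives `v_j ≥
  -- 2`; afterwards the coordinates increase strictly.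
  have hdec : ∀ d : ℕ, ∀ j : Fin n, j.val + (d + 1) + 1 = n → rho n j ≤ v j := by
    intro d
    induction d with
    | zero =>
      intro j hj
      have h1 := hpos j ⟨j.val + 1, by omega⟩ (Fin.lt_def.2 (by simp)) 1 (by simp)
      have h2 := hpos j ⟨j.val + 1, by omega⟩ (Fin.lt_def.2 (by simp)) (-1) (by simp)
      have h3 := hne ⟨j.val + 1, by omega⟩
      unfold rho
      omega
    | succ d ih =>
      intro j hj
      have h1 := ih ⟨j.val + 1, by omega⟩ (by simp only; omega)
      have h2 := hpos j ⟨j.val + 1, by omega⟩ (Fin.lt_def.2 (by simp)) (-1) (by simp)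
      unfold rho at h1 ⊢
      simp only at h1
      push_cast at h1
      omega
  have hle : ∀ j : Fin n, j.val + 1 ≠ n → rho n j ≤ v j := fun j hj =>
    hdec (n - 2 - j.val) j (by have := j.2; omega)
  have hsq : ∀ j ∈ (Finset.univ : Finset (Fin n)), rho n j * rho n j ≤ v j * v j := by
    intro j _
    by_cases hj : j.val + 1 = n
    · have h1 : rho n j = 1 := by unfold rho; omega
      have h2 := mul_self_pos.2 (hne j)
      rw [h1]; omega
    · exact mul_self_le_mul_self (rho_pos j).le (hle j hj)
  have hsum : ∑ j, rho n j * rho n j = ∑ j, v j * v j := (wact_dot_wact hn l _ _).symm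
  have heq := (Finset.sum_eq_sum_iff_of_le hsq).1 hsum
  have hlt : ∀ j : Fin n, j.val + 1 ≠ n → v j = rho n j := by
    intro j hj
    have h1 := heq j (Finset.mem_univ j)
    have h2 := hle j hj
    have h3 := rho_pos j
    nlinarith
  funext j
  by_cases hj : j.val + 1 = n
  · have h1 : ∀ k ∈ Finset.univ.erase j, v k = rho n k := by
      intro k hk
      refine hlt k fun hk' => (Finset.mem_erase.1 hk).1 (Fin.ext (by omega))
    rw [← Finset.mul_prod_erase _ _ (Finset.mem_univ j), ← Finset.mul_prod_erase _ _
      (Finset.mem_univ j), Finset.prod_congr rfl h1] at hprod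
    exact mul_right_cancel₀ (Finset.prod_pos fun k _ => rho_pos k).ne' hprod
  · exact hlt j hj

theorem wact_single {n : ℕ} (hn : 3 ≤ n) (l : List (Fin n)) (j : Fin n) :
    ∃ k : Fin n, ∃ t : ℤ, (t = 1 ∨ t = -1) ∧ wact l (Pi.single j 1) = Pi.single k t := by
  induction l with
  | nil => exact ⟨j, 1, Or.inl rfl, rfl⟩
  | cons i l ih =>
    obtain ⟨k, t, ht, h⟩ := ih
    have hs : -sg i * t = 1 ∨ -sg i * t = -1 := by
      rcases sg_eq i with h | h <;> rcases ht with h' | h' <;> simp [h, h']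
    rw [wact_cons, h]
    by_cases h1 : k = lo i
    · exact ⟨hi i, _, hs, by rw [h1, refl_single_lo hn]⟩
    · by_cases h2 : k = hi i
      · exact ⟨lo i, _, hs, by rw [h2, refl_single_hi hn]⟩
      · exact ⟨k, t, ht, refl_single_of_ne h1 h2 t⟩

/-- A signed permutation fixing `ρ`, whose coordinates are positive and distinct, is the identity.
-/
theorem wact_eq_one {n : ℕ} (hn : 3 ≤ n) {l : List (Fin n)}
    (h : inversions (wact l (rho n)) = 0) : wact l = 1 := by
  have hρ := wact_rho_eq hn h
  refine LinearMap.pi_ext' fun j => LinearMap.ext_ring ?_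
  obtain ⟨k, t, ht, hk⟩ := wact_single hn l j
  have h1 := wact_dot_wact hn l (Pi.single j 1) (rho n)
  rw [hρ, hk, single_dotProduct, single_one_dotProduct] at h1
  have h2 := rho_pos j
  have h3 := rho_pos k
  have ht1 : t = 1 := by
    rcases ht with rfl | rfl
    · rfl
    · omega
  subst ht1
  have : k = j := by
    refine Fin.ext ?_
    unfold rho at h1
    omega
  subst this
  exact hk

/-- If no simple root is negative, the coordinates decrease weakly and the last two have nonnegative
sum, so no positive root is negative either. -/
theorem exists_sroot_neg {n : ℕ} (hn : 3 ≤ n) {v : Fin n → ℤ} (h : inversions v ≠ 0) :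
    ∃ i, sroot i ⬝ᵥ v < 0 := by
  by_contra! hc
  apply h
  rw [inversions, Finset.card_eq_zero, Finset.filter_eq_empty_iff]
  intro γ hγ
  obtain ⟨a, b, t, hab, ht, rfl⟩ := mem_posRoots.1 hγ
  have hab' := Fin.lt_def.1 hab
  have hb := b.2
  have hstep : ∀ j : ℕ, ∀ hj : j + 1 < n, v ⟨j + 1, hj⟩ ≤ v ⟨j, by omega⟩ := by
    intro j hj
    have h1 := hc ⟨j, by omega⟩
    have e3 : lo (⟨j, by omega⟩ : Fin n) = ⟨j, by omega⟩ :=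
      Fin.ext (by rw [lo_val]; simp only; split_ifs <;> omega)
    have e4 : hi (⟨j, by omega⟩ : Fin n) = ⟨j + 1, hj⟩ :=
      Fin.ext (by rw [hi_val]; simp only; split_ifs <;> omega)
    have e6 : sg (⟨j, by omega⟩ : Fin n) = -1 := if_neg (by simp only; omega)
    rw [sroot_dot, e3, e4, e6] at h1
    omega
  have hanti : ∀ d j : ℕ, ∀ hj : j + d < n, v ⟨j + d, hj⟩ ≤ v ⟨j, by omega⟩ := by
    intro d
    induction d with
    | zero => intro j hj; exact le_refl _
    | succ d ih => intro j hj; exact (hstep (j + d) hj).trans (ih j (by omega))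
  have hmono : ∀ j k : Fin n, j ≤ k → v k ≤ v j := by
    intro j k hjk
    have h1 := hanti (k.val - j.val) j.val (by have := Fin.le_def.1 hjk; omega)
    have e : (⟨j.val + (k.val - j.val), by have := Fin.le_def.1 hjk; omega⟩ : Fin n) = k :=
      Fin.ext (by have := Fin.le_def.1 hjk; simp only; omega)
    rwa [e] at h1
  have h1 := hc ⟨n - 1, by omega⟩
  have e1 : lo (⟨n - 1, by omega⟩ : Fin n) = ⟨n - 2, by omega⟩ :=
    Fin.ext (by rw [lo_val]; simp only; split_ifs <;> omega)
  have e2 : hi (⟨n - 1, by omega⟩ : Fin n) = ⟨n - 1, by omega⟩ :=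
    Fin.ext (by rw [hi_val]; simp only; split_ifs <;> omega)
  have e5 : sg (⟨n - 1, by omega⟩ : Fin n) = 1 := if_pos (by simp only; omega)
  rw [sroot_dot, e1, e2, e5] at h1
  have h2 := hmono a ⟨n - 2, by omega⟩ (Fin.le_def.2 (by simp only; omega))
  have h3 := hmono b ⟨n - 1, by omega⟩ (Fin.le_def.2 (by simp only; omega))
  have h4 := hmono a b hab.le
  rw [posRoots_dot]
  rcases ht with rfl | rfl <;> omega

theorem exists_short_word {n : ℕ} (hn : 3 ≤ n) (l : List (Fin n)) :
    ∃ l', wact l' = wact l ∧ l'.length = inversions (wact l (rho n)) := by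
  generalize hm : inversions (wact l (rho n)) = m
  induction m generalizing l with
  | zero => exact ⟨[], (wact_eq_one hn hm).symm, rfl⟩
  | succ m ih =>
    obtain ⟨i, hi⟩ := exists_sroot_neg hn (v := wact l (rho n)) (by omega)
    have h1 := inversions_refl hn i (wact l (rho n))
    rw [if_pos hi, if_neg hi.asymm] at h1
    obtain ⟨l', hl', hlen⟩ := ih (i :: l) (by rw [wact_cons]; omega)
    refine ⟨i :: l', LinearMap.ext fun v => ?_, by rw [List.length_cons, hlen]⟩
    rw [wact_cons, hl', wact_cons, refl_refl hn]

theorem isReducedWord_iff {n : ℕ} (hn : 3 ≤ n) {l : List (Fin n)} {w : weylGroup n} :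
    IsReducedWord l w ↔ (l.map s).prod = w ∧ l.length = inversions (wact l (rho n)) := by
  constructor
  · rintro ⟨rfl, h⟩
    refine ⟨rfl, le_antisymm ?_ (inversions_wact_le hn l)⟩
    obtain ⟨l', hl', hlen⟩ := exists_short_word hn l
    rw [← hlen]
    exact h l' ((prod_s_eq_iff hn _ _).2 hl')
  · rintro ⟨rfl, h⟩
    refine ⟨rfl, fun l' hl' => ?_⟩
    rw [h, ← (prod_s_eq_iff hn _ _).1 hl']
    exact inversions_wact_le hn l'

theorem reducedWord_spec {n : ℕ} (w : weylGroup n) : IsReducedWord (reducedWord w) w :=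
  (exists_reducedWord w).choose_spec

theorem length_prod {n : ℕ} (hn : 3 ≤ n) (l : List (Fin n)) :
    length (l.map s).prod = inversions (wact l (rho n)) := by
  have h := (isReducedWord_iff hn).1 (reducedWord_spec (l.map s).prod)
  rw [length, h.2, (prod_s_eq_iff hn _ _).1 h.1]

/-- Having every positive root as an inversion is the maximum possible, so `w₀` shares this property
with `L`. Then `L⁻¹w₀` has no inversions and is trivial. -/
theorem isReducedWord_of_antidominant {n : ℕ} (hn : 3 ≤ n) {w₀ : weylGroup n} (hw₀ : IsLongest w₀)
    {L : List (Fin n)} (hlen : L.length ≤ (posRoots n).card)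
    (hL : ∀ γ ∈ posRoots n, γ ⬝ᵥ wact L (rho n) < 0) : IsReducedWord L w₀ := by
  have hall : ∀ v : Fin n → ℤ, inversions v = (posRoots n).card ↔ ∀ γ ∈ posRoots n, γ ⬝ᵥ v < 0 :=
    fun v => Finset.card_filter_eq_iff
  have hNL := (hall _).2 hL
  obtain ⟨l, hl⟩ := exists_word w₀
  have h1 := hw₀ (L.map s).prod
  rw [← hl, length_prod hn, length_prod hn, hNL] at h1
  have hNl : inversions (wact l (rho n)) = (posRoots n).card :=
    le_antisymm (Finset.card_filter_le _ _) h1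
  have hone : wact (L.reverse ++ l) = 1 := by
    refine wact_eq_one hn ?_
    rw [inversions, Finset.card_eq_zero, Finset.filter_eq_empty_iff]
    intro γ hγ
    rw [wact_append, dot_wact, List.reverse_reverse, not_lt]
    -- A word sends roots to roots up to sign, so a positive root for `L⁻¹w₀` can be tested on its
    -- image under `L`.
    have key : ∀ (M : List (Fin n)) (γ : Fin n → ℤ), γ ∈ posRoots n →
        wact M γ ∈ posRoots n ∨ -wact M γ ∈ posRoots n := by
      intro M γ hγ
      induction M with
      | nil => exact Or.inl hγ
      | cons i M ih =>
        rw [wact_cons]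
        rcases ih with ih | ih
        · by_cases h : wact M γ = sroot i
          · right
            have : -refl i (wact M γ) = sroot i := by
              rw [h, refl_apply, sroot_dot_self hn]; module
            rw [this]; exact sroot_mem_posRoots hn i
          · exact Or.inl (refl_mem_posRoots hn i ih h)
        · by_cases h : -wact M γ = sroot i
          · left
            have : refl i (wact M γ) = sroot i := by
              rw [← neg_neg (wact M γ), h, map_neg, refl_apply, sroot_dot_self hn]; module
            rw [this]; exact sroot_mem_posRoots hn i
          · right
            rw [← map_neg]
            exact refl_mem_posRoots hn i ih h
    rcases key L γ hγ with h | h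
    · have h2 := hL _ h
      rw [wact_dot_wact hn] at h2
      exact absurd (posRoots_dot_rho hγ) h2.asymm
    · have h2 := (hall _).1 hNl _ h
      rw [neg_dotProduct] at h2
      omega
  have heq : wact L = wact l := by
    refine LinearMap.ext fun v => ?_
    have h2 : wact (L.reverse ++ l) v = v := by rw [hone]; rfl
    rw [wact_append] at h2
    have h3 := wact_reverse_wact hn L.reverse (wact l v)
    rw [h2, List.reverse_reverse] at h3
    exact h3
  rw [isReducedWord_iff hn]
  refine ⟨by rw [← hl]; exact (prod_s_eq_iff hn _ _).2 heq, ?_⟩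
  exact le_antisymm (by rw [hNL]; exact hlen) (inversions_wact_le hn L)

end TypeD

end

noncomputable section

namespace TypeD

open Matrix

/-! ### Representatives of Weyl group elements -/

/-- The number of positive roots that are negative on `y` and pair to `1` with half of `v`. -/
def signExp {n : ℕ} (v y : Fin n → ℤ) : ℕ :=
  ((posRoots n).filter fun γ => γ ⬝ᵥ y < 0 ∧ γ ⬝ᵥ v = 2).card

/-- The positive roots other than `α_i` are permuted. Only the new inversion `α_i` can contribute,
exactly when `s̄_i` introduces a minus sign. -/
theorem signExp_refl {n : ℕ} (hn : 3 ≤ n) (i : Fin n) (v y : Fin n → ℤ) (hy : 0 < sroot i ⬝ᵥ y) :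
    signExp (refl i v) (refl i y) = signExp v y + if sroot i ⬝ᵥ v = -2 then 1 else 0 := by
  have h1 := card_filter_posRoots hn i fun γ => γ ⬝ᵥ y < 0 ∧ γ ⬝ᵥ v = 2
  have h2 := card_filter_posRoots hn i fun γ => γ ⬝ᵥ refl i y < 0 ∧ γ ⬝ᵥ refl i v = 2
  have h3 := card_filter_refl hn i fun γ => γ ⬝ᵥ y < 0 ∧ γ ⬝ᵥ v = 2
  simp only [← dot_refl] at h3
  rw [if_neg fun h => hy.asymm h.1] at h1
  have h4 : (sroot i ⬝ᵥ refl i y < 0 ∧ sroot i ⬝ᵥ refl i v = 2) ↔ sroot i ⬝ᵥ v = -2 := by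
    rw [sroot_dot_refl hn, sroot_dot_refl hn]
    omega
  simp only [h4] at h2
  rw [signExp, signExp, h2, h3, h1, add_zero]

theorem signExp_rho {n : ℕ} (v : Fin n → ℤ) : signExp v (rho n) = 0 := by
  rw [signExp, Finset.card_eq_zero, Finset.filter_eq_empty_iff]
  exact fun γ hγ h => (posRoots_dot_rho hγ).asymm h.1

/-- Each `s̄_i` is monomial, and reducedness makes `α_i` a new inversion at each letter, so the
signs accumulate into a count over inversions. -/
theorem ap_sBar_prod {n : ℕ} (hn : 3 ≤ n) {l : List (Fin n)}
    (hl : l.length = inversions (wact l (rho n))) (b' : Idx n) :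
    ∃ b, wt b' = wact l (wt b) ∧ ∀ φ, ap (l.map sBar).prod φ b' =
      (-1) ^ signExp (wt b') (wact l (rho n)) * φ b := by
  induction l generalizing b' with
  | nil => exact ⟨b', rfl, fun φ => by simp [ap_one, wact_nil, signExp_rho]⟩
  | cons i l ih =>
    have h1 := inversions_refl hn i (wact l (rho n))
    have h2 := inversions_wact_le hn l
    rw [wact_cons, List.length_cons] at hl
    have hy : 0 < sroot i ⬝ᵥ wact l (rho n) := by
      by_contra h
      rw [if_neg h] at h1
      split_ifs at h1 <;> omega
    rw [if_pos hy, if_neg hy.asymm] at h1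
    have ih := ih (by omega)
    have hsgn : ∀ c, wt b' = refl i (wt c) → signExp (wt b') (wact (i :: l) (rho n)) =
        signExp (wt c) (wact l (rho n)) + if pr i c = -1 then 1 else 0 := by
      intro c hc
      rw [hc, wact_cons, signExp_refl hn i _ _ hy, two_mul_pr hn]
      congr 1
      by_cases h : pr i c = -1
      · simp [h]
      · rw [if_neg h, if_neg (by omega)]
    rcases raise_cases hn i b' with ⟨c, h⟩ | ⟨c, h⟩ | h
    · have hc : wt b' = refl i (wt c) := by
        rw [refl_apply, two_mul_pr hn, h.pr_right hn, h.wt_eq hn]; module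
      obtain ⟨b, hb, H⟩ := ih c
      refine ⟨b, by rw [wact_cons, ← hb, hc], fun φ => ?_⟩
      rw [List.map_cons, List.prod_cons, ap_mul, ap_sBar_left hn h, H, hsgn c hc, h.pr_right hn]
      simp
    · have hc : wt b' = refl i (wt c) := by
        rw [refl_apply, two_mul_pr hn, h.pr_left hn, h.wt_eq hn]; module
      obtain ⟨b, hb, H⟩ := ih c
      refine ⟨b, by rw [wact_cons, ← hb, hc], fun φ => ?_⟩
      rw [List.map_cons, List.prod_cons, ap_mul, ap_sBar_right hn h, H, hsgn c hc, h.pr_left hn]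
      simp [pow_succ]
    · have hc : wt b' = refl i (wt b') := by
        rw [refl_apply, two_mul_pr hn, h]; module
      obtain ⟨b, hb, H⟩ := ih b'
      refine ⟨b, by rw [wact_cons, ← hb, ← hc], fun φ => ?_⟩
      rw [List.map_cons, List.prod_cons, ap_mul, ap_sBar_zero hn h, H, hsgn b' hc, h]
      simp

/-- The sign in `ap_sBar_prod` sees a word only through its action, so any reduced word may replace
the one chosen in `lift`. -/
theorem ap_lift {n : ℕ} (hn : 3 ≤ n) {l : List (Fin n)} {w : weylGroup n} (hl : IsReducedWord l w)
    {b b' : Idx n} (hb : wt b' = wact l (wt b)) (φ : Idx n → ℂ) :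
    ap (lift w) φ b' = (-1) ^ signExp (wt b') (wact l (rho n)) * φ b := by
  have h1 := (isReducedWord_iff hn).1 (reducedWord_spec w)
  have h2 : wact (reducedWord w) = wact l :=
    (prod_s_eq_iff hn _ _).1 (h1.1.trans ((isReducedWord_iff hn).1 hl).1.symm)
  obtain ⟨c, hc, H⟩ := ap_sBar_prod hn h1.2 b'
  rw [lift, H, h2]
  rw [h2, hb] at hc
  rw [wt_injective (wact_injective hn l hc)]

theorem lift_s {n : ℕ} (hn : 3 ≤ n) (k : Fin n) : lift (s k) = sBar k := by
  have hα : 0 < sroot k ⬝ᵥ rho n := posRoots_dot_rho (sroot_mem_posRoots hn k)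
  have h1 := inversions_refl hn k (rho n)
  rw [if_pos hα, if_neg hα.asymm, inversions_rho] at h1
  have hlen : [k].length = inversions (wact [k] (rho n)) := by
    rw [wact_cons, wact_nil]; simpa using h1.symm
  have hk : IsReducedWord [k] (s k) := (isReducedWord_iff hn).2 ⟨by simp, hlen⟩
  refine G_ext fun φ b' => ?_
  obtain ⟨b, hb, H⟩ := ap_sBar_prod hn hlen b'
  rw [ap_lift hn hk hb, ← H]
  simp

theorem ap_sBar_single_of_raise {n : ℕ} (hn : 3 ≤ n) {k : Fin n} {b a : Idx n} (h : Raise k b a) :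
    ap (sBar k) (Pi.single a 1) = Pi.single b 1 := by
  funext d
  rcases raise_cases hn k d with ⟨c, hc⟩ | ⟨c, hc⟩ | hc
  · rw [ap_sBar_left hn hc]
    by_cases hd : d = b
    · subst hd; rw [hc.unique_right hn h]; simp
    · have : c ≠ a := by rintro rfl; exact hd (hc.unique_left hn h)
      simp [hd, this]
  · rw [ap_sBar_right hn hc]
    have h1 : c ≠ a := by rintro rfl; exact h.not_raise hc
    have h2 : d ≠ b := by rintro rfl; exact hc.not_raise h
    simp [h1, h2]
  · rw [ap_sBar_zero hn hc]
    have h1 : d ≠ a := by rintro rfl; rw [h.pr_right hn] at hc; omega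
    have h2 : d ≠ b := by rintro rfl; rw [h.pr_left hn] at hc; omega
    simp [h1, h2]

theorem ap_sBar_single_of_pr {n : ℕ} (hn : 3 ≤ n) {k : Fin n} {b : Idx n} (h : pr k b = 0) :
    ap (sBar k) (Pi.single b 1) = Pi.single b 1 := by
  funext d
  rcases raise_cases hn k d with ⟨c, hc⟩ | ⟨c, hc⟩ | hc
  · rw [ap_sBar_left hn hc]
    have h1 : c ≠ b := by rintro rfl; rw [hc.pr_right hn] at h; omega
    have h2 : d ≠ b := by rintro rfl; rw [hc.pr_left hn] at h; omega
    simp [h1, h2]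
  · rw [ap_sBar_right hn hc]
    have h1 : c ≠ b := by rintro rfl; rw [hc.pr_left hn] at h; omega
    have h2 : d ≠ b := by rintro rfl; rw [hc.pr_right hn] at h; omega
    simp [h1, h2]
  · rw [ap_sBar_zero hn hc]

/-! ### The cyclic word -/

theorem refl_of_lt {n : ℕ} (hn : 3 ≤ n) {i i' : Fin n} (hi' : i'.val = i.val + 1)
    (v : Fin n → ℤ) : refl i v i = v i' ∧ refl i v i' = v i ∧
      ∀ j, j ≠ i → j ≠ i' → refl i v j = v j := by
  have := i'.2
  have e1 : lo i = i := Fin.ext (by rw [lo_val, if_neg (by omega)])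
  have e2 : hi i = i' := Fin.ext (by rw [hi_val, if_neg (by omega), hi'])
  have e3 : sg i = -1 := if_neg (by omega)
  have h1 := refl_lo hn i v
  have h2 := refl_hi hn i v
  have h3 := fun j h h' => refl_of_ne (i := i) (j := j) h h' v
  rw [e1, e2, e3] at h1 h2
  rw [e1, e2] at h3
  rw [neg_neg, one_mul] at h1 h2
  exact ⟨h1, h2, h3⟩

theorem refl_last {n : ℕ} (hn : 3 ≤ n) {i i' : Fin n} (hi : i.val + 1 = n) (hi' : i'.val + 2 = n)
    (v : Fin n → ℤ) : refl i v i = -v i' ∧ refl i v i' = -v i ∧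
      ∀ j, j ≠ i → j ≠ i' → refl i v j = v j := by
  have e1 : lo i = i' := Fin.ext (by rw [lo_val, if_pos hi]; omega)
  have e2 : TypeD.hi i = i := Fin.ext (by rw [hi_val, if_pos hi])
  have e3 : sg i = 1 := if_pos hi
  have h1 := refl_lo hn i v
  have h2 := refl_hi hn i v
  have h3 := fun j h h' => refl_of_ne (i := i) (j := j) h h' v
  rw [e1, e2, e3] at h1 h2
  rw [e1, e2] at h3
  refine ⟨by simpa using h2, by simpa using h1, fun j h h' => h3 j h' h⟩

/-- The tail of the Coxeter word is a signed cyclic shift of places `i, …, n-2`: the entry returning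
to the front is negated, and so is the fixed last coordinate. After `n-1` full turns each of the
first `n-1` coordinates has been negated once. -/
theorem wact_drop_finRange {n : ℕ} (hn : 3 ≤ n) (v : Fin n → ℤ) (d i : ℕ) (hd : i + d + 2 = n) :
    (∀ j : Fin n, j.val < i → wact ((List.finRange n).drop i) v j = v j) ∧
    wact ((List.finRange n).drop i) v ⟨i, by omega⟩ = -v ⟨n - 2, sub_two_lt hn⟩ ∧
    (∀ j j' : Fin n, i < j.val → j.val + 1 < n → j'.val + 1 = j.val →
      wact ((List.finRange n).drop i) v j = v j') ∧
    wact ((List.finRange n).drop i) v ⟨n - 1, sub_one_lt hn⟩ = -v ⟨n - 1, sub_one_lt hn⟩ := by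
  have hcons : ∀ i (hi : i < n), (List.finRange n).drop i =
      ⟨i, hi⟩ :: (List.finRange n).drop (i + 1) := by
    intro i hi
    rw [List.drop_eq_getElem_cons (by simpa using hi)]
    simp
  induction d generalizing i with
  | zero =>
    obtain rfl : i = n - 2 := by omega
    have hnil : (List.finRange n).drop (n - 2 + 1 + 1) = [] := List.drop_eq_nil_of_le (by simp; omega)
    rw [hcons (n - 2) (by omega), hcons (n - 2 + 1) (by omega), hnil, wact_cons, wact_cons, wact_nil]
    have h1 := refl_last hn (i := ⟨n - 2 + 1, by omega⟩) (i' := ⟨n - 2, by omega⟩)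
      (by simp only; omega) (by simp only; omega) v
    have h2 := refl_of_lt hn (i := ⟨n - 2, by omega⟩) (i' := ⟨n - 2 + 1, by omega⟩) rfl
      (refl ⟨n - 2 + 1, by omega⟩ v)
    have e : (⟨n - 1, by omega⟩ : Fin n) = ⟨n - 2 + 1, by omega⟩ := Fin.ext (by simp only; omega)
    refine ⟨fun j hj => ?_, ?_, fun j j' h h' => by omega, ?_⟩
    · rw [h2.2.2 j (Fin.ne_of_val_ne (by simp only; omega)) (Fin.ne_of_val_ne (by simp only; omega)),
        h1.2.2 j (Fin.ne_of_val_ne (by simp only; omega)) (Fin.ne_of_val_ne (by simp only; omega))]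
    · rw [h2.1, h1.1]
    · rw [e, h2.2.1, h1.2.1]
  | succ d ih =>
    obtain ⟨h1, h2, h3, h4⟩ := ih (i + 1) (by omega)
    rw [hcons i (by omega), wact_cons]
    set u := wact ((List.finRange n).drop (i + 1)) v
    have h5 := refl_of_lt hn (i := ⟨i, by omega⟩) (i' := ⟨i + 1, by omega⟩) rfl u
    refine ⟨fun j hj => ?_, by rw [h5.1, h2], fun j j' hij hj hjj => ?_, ?_⟩
    · rw [h5.2.2 j (Fin.ne_of_val_ne (by simp only; omega)) (Fin.ne_of_val_ne (by simp only; omega)),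
        h1 j (by omega)]
    · by_cases hj1 : j.val = i + 1
      · have e : j = ⟨i + 1, by omega⟩ := Fin.ext hj1
        rw [e, h5.2.1, h1 _ (by simp)]
        congr 1
        exact Fin.ext (by simp only; omega)
      · rw [h5.2.2 j (Fin.ne_of_val_ne (by simp only; omega)) (Fin.ne_of_val_ne (by simp only; omega)),
          h3 j j' (by omega) hj hjj]
    · rw [h5.2.2 _ (Fin.ne_of_val_ne (by simp only; omega)) (Fin.ne_of_val_ne (by simp only; omega)), h4]

theorem wact_finRange {n : ℕ} (hn : 3 ≤ n) (v : Fin n → ℤ) :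
    wact (List.finRange n) v ⟨0, by omega⟩ = -v ⟨n - 2, sub_two_lt hn⟩ ∧
    (∀ j j' : Fin n, j.val + 1 < n → j'.val + 1 = j.val → wact (List.finRange n) v j = v j') ∧
    wact (List.finRange n) v ⟨n - 1, sub_one_lt hn⟩ = -v ⟨n - 1, sub_one_lt hn⟩ := by
  have h := wact_drop_finRange hn v (n - 2) 0 (by omega)
  rw [List.drop_zero] at h
  exact ⟨h.2.1, fun j j' h1 h2 => h.2.2.1 j j' (by omega) h1 h2, h.2.2.2⟩

theorem wact_replicate {n : ℕ} (hn : 3 ≤ n) (v : Fin n → ℤ) (m : ℕ) (hm : m + 1 ≤ n) :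
    (∀ j k : Fin n, j.val + 1 < n → j.val < m → k.val + m = n - 1 + j.val →
      wact (List.replicate m (List.finRange n)).flatten v j = -v k) ∧
    (∀ j k : Fin n, j.val + 1 < n → k.val + m = j.val →
      wact (List.replicate m (List.finRange n)).flatten v j = v k) ∧
    wact (List.replicate m (List.finRange n)).flatten v ⟨n - 1, sub_one_lt hn⟩ =
      (-1) ^ m * v ⟨n - 1, sub_one_lt hn⟩ := by
  induction m with
  | zero =>
    refine ⟨fun j k _ h => by omega, fun j k _ h => ?_, by simp [wact_nil]⟩
    rw [List.replicate_zero, List.flatten_nil, wact_nil]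
    congr 1
    exact Fin.ext (by omega)
  | succ m ih =>
    obtain ⟨h1, h2, h3⟩ := ih (by omega)
    rw [List.replicate_succ, List.flatten_cons, wact_append]
    set u := wact (List.replicate m (List.finRange n)).flatten v
    obtain ⟨e1, e2, e3⟩ := wact_finRange hn u
    refine ⟨fun j k hj hjm hk => ?_, fun j k hj hk => ?_, ?_⟩
    · by_cases hj0 : j.val = 0
      · rw [show j = ⟨0, by omega⟩ from Fin.ext hj0, e1, h2 _ k (by simp only; omega) (by simp only; omega)]
      · rw [e2 j ⟨j.val - 1, by omega⟩ hj (by simp only; omega),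
          h1 _ k (by simp only; omega) (by simp only; omega) (by simp only; omega)]
    · rw [e2 j ⟨j.val - 1, by omega⟩ hj (by simp only; omega),
        h2 _ k (by simp only; omega) (by simp only; omega)]
    · rw [e3, h3, pow_succ]; ring

theorem wact_cyclicWord {n : ℕ} (hn : 3 ≤ n) (v : Fin n → ℤ) (j : Fin n) :
    wact (cyclicWord n) v j = (if j.val + 1 = n then (-1) ^ (n - 1) else -1) * v j := by
  obtain ⟨h1, -, h3⟩ := wact_replicate hn v (n - 1) (by omega)
  have hj := j.2
  split_ifs with h
  · rw [show j = ⟨n - 1, by omega⟩ from Fin.ext (by simp only; omega)]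
    exact h3
  · rw [neg_one_mul]
    exact h1 j j (by omega) (by omega) (by omega)

theorem cyclicWord_antidominant {n : ℕ} (hn : 3 ≤ n) {γ : Fin n → ℤ} (hγ : γ ∈ posRoots n) :
    γ ⬝ᵥ wact (cyclicWord n) (rho n) < 0 := by
  obtain ⟨a, b, t, hab, ht, rfl⟩ := mem_posRoots.1 hγ
  have hab' := Fin.lt_def.1 hab
  have hb := b.2
  rw [posRoots_dot, wact_cyclicWord hn, wact_cyclicWord hn, if_neg (by omega)]
  have hs : ∃ u : ℤ, (u = 1 ∨ u = -1) ∧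
      t * ((if b.val + 1 = n then (-1) ^ (n - 1) else -1) * rho n b) = u * rho n b := by
    refine ⟨t * (if b.val + 1 = n then (-1) ^ (n - 1) else -1), ?_, by ring⟩
    rcases neg_one_pow_eq_or ℤ (n - 1) with h | h <;> rw [h] <;> rcases ht with rfl | rfl <;>
      split_ifs <;> simp
  obtain ⟨u, hu, h⟩ := hs
  rw [h]
  unfold rho
  rcases hu with rfl | rfl <;> omega

theorem isReducedWord_cyclicWord {n : ℕ} (hn : 3 ≤ n) {w₀ : weylGroup n} (hw₀ : IsLongest w₀) :
    IsReducedWord (cyclicWord n) w₀ := by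
  refine isReducedWord_of_antidominant hn hw₀ ?_ fun γ hγ => cyclicWord_antidominant hn hγ
  refine le_trans (le_of_eq ?_) card_posRoots
  simp [cyclicWord, mul_comm]

theorem signExp_cyclicWord {n : ℕ} (hn : 3 ≤ n) (v : Fin n → ℤ) :
    signExp v (wact (cyclicWord n) (rho n)) = ((posRoots n).filter fun γ => γ ⬝ᵥ v = 2).card := by
  rw [signExp]
  congr 1
  exact Finset.filter_congr fun γ hγ => by simp [cyclicWord_antidominant hn hγ]

/-- All positive roots are inversions of `w₀`; those pairing to 1 with `-ε_a` are `ε_c - ε_a` with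
`c < a`, which gives the exponent. -/
theorem ap_lift_longest_vec {n : ℕ} (hn : 3 ≤ n) {w₀ : weylGroup n} (hw₀ : IsLongest w₀) {a : Fin n}
    (ha : a.val + 1 < n) (φ : Idx n → ℂ) :
    ap (lift w₀) φ (.inl (.inr a)) = (-1) ^ a.val * φ (.inl (.inl a)) := by
  rw [ap_lift hn (isReducedWord_cyclicWord hn hw₀) (b := .inl (.inl a)), signExp_cyclicWord hn]
  · congr 2
    rw [← Fin.card_Iio]
    symm
    refine Finset.card_bij (fun c _ => Pi.single c 1 + Pi.single a (-1)) ?_ ?_ ?_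
    · intro c hc
      rw [Finset.mem_Iio] at hc
      refine Finset.mem_filter.2 ⟨mem_posRoots.2 ⟨c, a, -1, hc, Or.inr rfl, rfl⟩, ?_⟩
      rw [posRoots_dot]
      simp [wt, hc.ne]
    · intro c _ d _ h
      have := congrFun (add_right_cancel h) c
      by_contra hcd
      simp [Pi.single_eq_of_ne hcd] at this
    · intro γ hγ
      obtain ⟨h1, h2⟩ := Finset.mem_filter.1 hγ
      obtain ⟨c, b, t, hcb, ht, rfl⟩ := mem_posRoots.1 h1
      rw [posRoots_dot] at h2
      simp only [wt, Pi.single_apply] at h2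
      have hb : b = a := by
        by_contra hb
        rw [if_neg hb] at h2
        split_ifs at h2 <;> omega
      subst hb
      rw [if_neg hcb.ne, if_pos rfl] at h2
      obtain rfl : t = -1 := by omega
      exact ⟨c, Finset.mem_Iio.2 hcb, rfl⟩
  · funext j
    rw [wact_cyclicWord hn]
    by_cases h : j = a
    · subst h
      rw [if_neg (by omega)]
      simp [wt]
    · simp [wt, h]

/-- Sign vectors that are constant except for the last sign. -/
def spinVec {n : ℕ} (δ ε : Bool) : Idx n := .inr fun j => if j.val + 1 = n then ε else δ

theorem wt_spinVec {n : ℕ} (δ ε : Bool) (j : Fin n) : wt (spinVec δ ε) j =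
    if j.val + 1 = n then if ε then 1 else -1 else if δ then 1 else -1 := by
  simp only [wt, spinVec]
  by_cases h : j.val + 1 = n <;> simp only [h, if_true, if_false]

/-- The first index of a positive root lies among the first `n-1` places, where the target weight is
negative. Its pairing is never 1, so no sign appears. -/
theorem ap_lift_longest_spin {n : ℕ} (hn : 3 ≤ n) {w₀ : weylGroup n} (hw₀ : IsLongest w₀)
    {ε ε' : Bool} (h : ε' = if Even (n - 1) then ε else !ε) (φ : Idx n → ℂ) :
    ap (lift w₀) φ (spinVec false ε') = φ (spinVec true ε) := by
  rw [ap_lift hn (isReducedWord_cyclicWord hn hw₀) (b := spinVec true ε), signExp_cyclicWord hn]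
  · rw [Finset.card_eq_zero.2, pow_zero, one_mul]
    rw [Finset.filter_eq_empty_iff]
    intro γ hγ
    obtain ⟨a, b, t, hab, ht, rfl⟩ := mem_posRoots.1 hγ
    have hab' := Fin.lt_def.1 hab
    have hb := b.2
    rw [posRoots_dot, wt_spinVec, wt_spinVec, if_neg (show ¬ a.val + 1 = n by omega),
      if_neg Bool.false_ne_true]
    rcases ht with rfl | rfl <;> split_ifs <;> omega
  · funext j
    rw [wact_cyclicWord hn, h]
    simp only [wt, spinVec]
    by_cases hj : j.val + 1 = n
    · by_cases he : Even (n - 1)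
      · simp [hj, he]
      · rw [Nat.not_even_iff_odd] at he
        cases ε <;> simp [hj, he.neg_one_pow, Nat.not_even_iff_odd.2 he]
    · simp [hj]

theorem ap_lift_inv {n : ℕ} {w : weylGroup n} {a b : Idx n} {c : ℂ}
    (h : ∀ φ, ap (lift w) φ b = c * φ a) (hc : c * c = 1) (φ : Idx n → ℂ) :
    ap (lift w)⁻¹ φ a = c * φ b := by
  have h1 := h (ap (lift w)⁻¹ φ)
  rw [ap_ap_inv] at h1
  rw [h1, ← mul_assoc, hc, one_mul]

/-! ### Generalized minors as determinants -/

theorem pr_inl_inl {n : ℕ} (hn : 3 ≤ n) (i a : Fin n) : pr i (.inl (.inl a)) = sroot i a := by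
  have h := two_mul_pr hn i (.inl (.inl a))
  simp only [wt, dotProduct_single] at h
  omega

/-- The vectors `v_1, …, v_{k+1}`. -/
def vecTop {n : ℕ} (k : ℕ) (hk : k < n) (a : Fin (k + 1)) : Idx n := .inl (.inl ⟨a.val, by omega⟩)

/-- The listed weights add up to `ε_1 + ⋯ + ε_{k+1}`, which is fundamental precisely because `k` is
not a spin node. -/
theorem vecTop_isPrincipalMinor {n : ℕ} (hn : 3 ≤ n) (k : ℕ) (hk : k + 2 < n) :
    IsPrincipalMinor (fundamentalWeight ⟨k, by omega⟩) (minorOf (vecTop (n := n) k (by omega))) := by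
  refine minorOf_isPrincipalMinor hn (fun a b h => ?_) (fun i a c h => ?_) fun i => ?_
  · simpa [vecTop, Fin.ext_iff] using h
  · rcases c with (c | c) | c
    · have h' : c = i ∧ a.val = i.val + 1 := h
      have := a.2
      refine ⟨⟨i.val, by omega⟩, Fin.lt_def.2 (by simp only; omega), ?_⟩
      simp [vecTop, h'.1]
    · exact h.elim
    · exact h.elim
  · simp only [vecTop, pr_inl_inl hn, sroot, Pi.add_apply, Finset.sum_add_distrib, Pi.single_apply,
      Fin.ext_iff]
    have hsum : ∀ (p : ℕ) (t : ℤ), ∑ a : Fin (k + 1), (if a.val = p then t else 0) =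
        if p < k + 1 then t else 0 := by
      intro p t
      split_ifs with hp
      · rw [Finset.sum_eq_single ⟨p, hp⟩]
        · simp
        · intro b _ hb; rw [if_neg fun h => hb (Fin.ext h)]
        · simp
      · exact Finset.sum_eq_zero fun b _ => if_neg (by have := b.2; omega)
    rw [hsum, hsum, fundamentalWeight, lo_val, hi_val, Pi.single_apply, sg]
    have := i.2
    simp only [Fin.ext_iff]
    split_ifs <;> omega

/-- On columns `s̄_k` only replaces the last vector by its successor, without a sign. On rows the
inverse representative of `w₀` turns `v_a` into `v̄_a` with the sign of `ap_lift_longest_vec`. -/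
theorem generalizedMinor_vec {n : ℕ} (hn : 3 ≤ n) {w₀ : weylGroup n} (hw₀ : IsLongest w₀) (k : ℕ)
    (hk : k + 2 < n) (g : G n) :
    generalizedMinor (fundamentalWeight ⟨k, by omega⟩) w₀ (s ⟨k, by omega⟩) g =
      (Matrix.of fun a b : Fin (k + 1) => (-1 : ℂ) ^ a.val *
        ap g (Pi.single (.inl (.inl ⟨if b.val = k then k + 1 else b.val, by split_ifs <;> omega⟩)) 1)
          (.inl (.inr ⟨a.val, by omega⟩))).det := by
  rw [generalizedMinor, principalMinor_eq hn (vecTop_isPrincipalMinor hn k hk), lift_s hn, minorOf]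
  congr 1
  ext a b
  have ha := a.2
  have hb := b.2
  rw [submatrix_apply, ← ap_single, ap_mul, ap_mul, of_apply]
  have h1 : ap (sBar (⟨k, by omega⟩ : Fin n)) (Pi.single (vecTop k (by omega) b) 1) =
      Pi.single (.inl (.inl ⟨if b.val = k then k + 1 else b.val, by split_ifs <;> omega⟩)) 1 := by
    by_cases h : b.val = k
    · refine ap_sBar_single_of_raise hn ⟨Fin.ext h, ?_⟩
      simp [h]
    · simp only [h, if_false]
      refine ap_sBar_single_of_pr hn ?_
      rw [vecTop, pr_inl_inl hn]
      refine sroot_of_ne (Fin.ne_of_val_ne ?_) (Fin.ne_of_val_ne ?_)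
      · rw [lo_val]; simp only; split_ifs <;> omega
      · rw [hi_val]; simp only; split_ifs <;> omega
  rw [h1]
  refine ap_lift_inv (fun φ => ap_lift_longest_vec hn hw₀ (by simp only; omega) φ) ?_ _
  rw [← pow_add]
  exact Even.neg_one_pow ⟨_, rfl⟩

theorem ite_lt {n : ℕ} (hn : 3 ≤ n) (ε : Bool) : (if ε then n - 1 else n - 2) < n := by
  split_ifs <;> omega

/-- The node of the spin module with highest weight vector `spinVec true ε`. -/
def spinNode {n : ℕ} (hn : 3 ≤ n) (ε : Bool) : Fin n :=
  ⟨if ε then n - 1 else n - 2, ite_lt hn ε⟩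

/-- The image of the highest weight vector `spinVec true ε` under its simple reflection. -/
def spinTarget {n : ℕ} (ε : Bool) : Idx n :=
  .inr fun j => if j.val + 1 = n then !ε else if j.val + 2 = n then false else true

theorem pr_spinVec {n : ℕ} (hn : 3 ≤ n) (i : Fin n) (ε : Bool) :
    pr i (spinVec true ε) = fundamentalWeight (spinNode hn ε) i := by
  have h := two_mul_pr hn i (spinVec true ε)
  have hi' := i.2
  rw [sroot_dot, wt_spinVec, wt_spinVec, lo_val, hi_val, sg, if_pos rfl] at h
  rw [fundamentalWeight, spinNode, Pi.single_apply]
  simp only [Fin.ext_iff]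
  by_cases h1 : i.val + 1 = n
  · rw [if_pos h1, if_neg (show ¬ i.val - 1 + 1 = n by omega), if_pos h1, if_pos h1, if_pos h1] at h
    cases ε
    · rw [if_neg Bool.false_ne_true] at h
      rw [if_neg (by simp only [Bool.false_eq_true, if_false]; omega)]; push_cast; omega
    · rw [if_pos rfl] at h
      rw [if_pos (by simp only [if_true]; omega)]; push_cast; omega
  · rw [if_neg h1, if_neg h1, if_neg h1, if_neg h1] at h
    by_cases h2 : i.val + 1 + 1 = n
    · rw [if_pos h2] at h
      cases ε
      · rw [if_neg Bool.false_ne_true] at h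
        rw [if_pos (by simp only [Bool.false_eq_true, if_false]; omega)]; push_cast; omega
      · rw [if_pos rfl] at h
        rw [if_neg (by simp only [if_true]; omega)]; push_cast; omega
    · rw [if_neg h2] at h
      rw [if_neg (by cases ε <;> simp <;> omega)]
      push_cast; omega

theorem spin_isPrincipalMinor {n : ℕ} (hn : 3 ≤ n) (ε : Bool) :
    IsPrincipalMinor (fundamentalWeight (spinNode hn ε))
      (minorOf fun _ : Fin 1 => (spinVec true ε : Idx n)) := by
  refine minorOf_isPrincipalMinor hn (fun a b _ => Subsingleton.elim a b) (fun i a c h => ?_) fun i => ?_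
  · have h1 := h.pr_left hn
    rw [pr_spinVec hn] at h1
    omega
  · simp [pr_spinVec hn]

theorem raise_spinTarget {n : ℕ} (hn : 3 ≤ n) (ε : Bool) :
    Raise (spinNode hn ε) (spinTarget ε) (spinVec true ε) := by
  rw [raise_iff hn]
  funext j
  have hj := j.2
  have hlo : (lo (spinNode hn ε)).val = n - 2 := by
    rw [lo_val]; cases ε <;> simp only [spinNode, if_true, Bool.false_eq_true, if_false] <;>
      split_ifs <;> omega
  have hhi : (TypeD.hi (spinNode hn ε)).val = n - 1 := by
    rw [hi_val]; cases ε <;> simp only [spinNode, if_true, Bool.false_eq_true, if_false] <;>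
      split_ifs <;> omega
  have hsg : sg (spinNode hn ε) = if ε then 1 else -1 := by
    rw [sg]; cases ε <;> simp only [spinNode, if_true, Bool.false_eq_true, if_false]
    · rw [if_neg (by omega)]
    · rw [if_pos (by omega)]
  have ht : wt (spinTarget ε) j = if j.val + 1 = n then if ε then -1 else 1 else
      if j.val + 2 = n then -1 else 1 := by
    simp only [wt, spinTarget]
    by_cases h : j.val + 1 = n <;> by_cases h' : j.val + 2 = n <;> cases ε <;> simp [h, h']
  rw [wt_spinVec, Pi.add_apply, ht, Pi.smul_apply, sroot, Pi.add_apply, Pi.single_apply,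
    Pi.single_apply, hsg, if_pos rfl, smul_eq_mul]
  simp only [Fin.ext_iff, hlo, hhi]
  cases ε <;> simp only [Bool.false_eq_true, if_false, if_true] <;> split_ifs <;> omega

theorem generalizedMinor_spin {n : ℕ} (hn : 3 ≤ n) {w₀ : weylGroup n} (hw₀ : IsLongest w₀)
    (ε : Bool) (g : G n) :
    generalizedMinor (fundamentalWeight (spinNode hn ε)) w₀ (s (spinNode hn ε)) g =
      ap g (Pi.single (spinTarget ε) 1) (spinVec false (if Even (n - 1) then ε else !ε)) := by
  rw [generalizedMinor, principalMinor_eq hn (spin_isPrincipalMinor hn ε), lift_s hn, minorOf,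
    det_unique, submatrix_apply, ← ap_single, ap_mul, ap_mul,
    ap_sBar_single_of_raise hn (raise_spinTarget hn ε)]
  rw [ap_lift_inv (c := 1) (b := spinVec false (if Even (n - 1) then ε else !ε)) (fun φ => ?_)
    (one_mul 1), one_mul]
  rw [ap_lift_longest_spin hn hw₀ rfl, one_mul]

theorem exists_isPrincipalMinor {n : ℕ} (hn : 3 ≤ n) (k : Fin n) :
    ∃ F : G n → ℂ, IsPrincipalMinor (fundamentalWeight k) F := by
  have hk := k.2
  by_cases h : k.val + 2 < n
  · exact ⟨_, vecTop_isPrincipalMinor hn k.val h⟩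
  · by_cases h' : k.val + 1 = n
    · have e : k = spinNode hn true := Fin.ext (by simp only [spinNode, if_true]; omega)
      rw [e]
      exact ⟨_, spin_isPrincipalMinor hn true⟩
    · have e : k = spinNode hn false :=
        Fin.ext (by simp only [spinNode, Bool.false_eq_true, if_false]; omega)
      rw [e]
      exact ⟨_, spin_isPrincipalMinor hn false⟩

end TypeD

end

noncomputable section

namespace TypeD

open Matrix

/-! ### Blocks of the factorisation -/

/-- The product `𝐲_{i+1}(d_{i+1}) ⋯ 𝐲_n(d_n)`. -/
def blockFrom (n : ℕ) (d : ℕ → ℂ) (i : ℕ) : G n :=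
  (((List.finRange n).drop i).map fun j => yBold j (d (j.val + 1))).prod

theorem blockFrom_of_lt {n : ℕ} (d : ℕ → ℂ) {i : ℕ} (hi : i < n) :
    blockFrom n d i = yBold ⟨i, hi⟩ (d (i + 1)) * blockFrom n d (i + 1) := by
  rw [blockFrom, List.drop_eq_getElem_cons (by simpa using hi), List.map_cons, List.prod_cons,
    blockFrom]
  simp

theorem ap_blockFrom_self {n : ℕ} (d : ℕ → ℂ) (φ : Idx n → ℂ) : ap (blockFrom n d n) φ = φ := by
  rw [blockFrom, List.drop_eq_nil_of_le (by simp), List.map_nil, List.prod_nil, ap_one]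

theorem ap_blockFrom_raise {n : ℕ} (hn : 3 ≤ n) {d : ℕ → ℂ} (hd : ∀ i ∈ Finset.Icc 1 n, d i ≠ 0)
    {i : ℕ} (hi : i < n) {b a : Idx n} (h : Raise ⟨i, hi⟩ b a) (φ : Idx n → ℂ) :
    ap (blockFrom n d i) φ b =
      d (i + 1) * ap (blockFrom n d (i + 1)) φ b + ap (blockFrom n d (i + 1)) φ a := by
  rw [blockFrom_of_lt d hi, ap_mul, ap_yBold_left hn h (hd _ (Finset.mem_Icc.2 (by omega)))]

theorem ap_blockFrom_one {n : ℕ} (hn : 3 ≤ n) {d : ℕ → ℂ} (hd : ∀ i ∈ Finset.Icc 1 n, d i ≠ 0)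
    {i : ℕ} (hi : i < n) {b : Idx n} (h : pr ⟨i, hi⟩ b = 1) (φ : Idx n → ℂ) :
    ap (blockFrom n d i) φ b = (d (i + 1))⁻¹ * ap (blockFrom n d (i + 1)) φ b := by
  rw [blockFrom_of_lt d hi, ap_mul, ap_yBold_of_ne hn (by rw [h]; decide)
    (hd _ (Finset.mem_Icc.2 (by omega))), h, zpow_one]

theorem ap_blockFrom_zero {n : ℕ} (hn : 3 ≤ n) {d : ℕ → ℂ} (hd : ∀ i ∈ Finset.Icc 1 n, d i ≠ 0)
    {i : ℕ} (hi : i < n) {b : Idx n} (h : pr ⟨i, hi⟩ b = 0) (φ : Idx n → ℂ) :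
    ap (blockFrom n d i) φ b = ap (blockFrom n d (i + 1)) φ b := by
  rw [blockFrom_of_lt d hi, ap_mul, ap_yBold_of_ne hn (by rw [h]; decide)
    (hd _ (Finset.mem_Icc.2 (by omega))), h, zpow_zero, one_mul]

theorem ap_blockFrom_skip {n : ℕ} (hn : 3 ≤ n) {d : ℕ → ℂ} (hd : ∀ i ∈ Finset.Icc 1 n, d i ≠ 0)
    {b : Idx n} (φ : Idx n → ℂ) {i : ℕ} (j : ℕ) (hij : i ≤ j) (hj : j ≤ n)
    (h : ∀ m (hm : m < n), i ≤ m → m < j → pr ⟨m, hm⟩ b = 0) :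
    ap (blockFrom n d i) φ b = ap (blockFrom n d j) φ b := by
  induction j, hij using Nat.le_induction with
  | base => rfl
  | succ j hij ih =>
    rw [ih (by omega) fun m hm h1 h2 => h m hm h1 (by omega),
      ap_blockFrom_zero hn hd (by omega) (h j (by omega) hij (by omega))]

/-- The product of the `m` blocks with superscripts `t + 1, …, t + m`. -/
def blocks (n : ℕ) (c : ℕ → ℕ → ℂ) (t m : ℕ) : G n :=
  ((List.range' t m).map fun l => blockFrom n (c (l + 1)) 0).prod

theorem blocks_zero {n : ℕ} (c : ℕ → ℕ → ℂ) (t : ℕ) : blocks n c t 0 = 1 := rfl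

theorem blocks_succ {n : ℕ} (c : ℕ → ℕ → ℂ) (t m : ℕ) :
    blocks n c t (m + 1) = blockFrom n (c (t + 1)) 0 * blocks n c (t + 1) m := by
  rw [blocks, List.range'_succ, List.map_cons, List.prod_cons, blocks]

theorem thetaMinus_eq_blocks (n : ℕ) (c : ℕ → ℕ → ℂ) :
    thetaMinus (cyclicWord n) (cyclicParams n c) = blocks n c 0 (n - 1) := by
  -- An arbitrary list of superscripts allows induction from the left.
  have h : ∀ L : List ℕ, thetaMinus (List.replicate L.length (List.finRange n)).flatten
      (L.flatMap fun l => (List.range n).map fun i => c (l + 1) (i + 1)) =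
      (L.map fun l => blockFrom n (c (l + 1)) 0).prod := by
    intro L
    induction L with
    | nil => rfl
    | cons l L ih =>
      rw [List.length_cons, List.replicate_succ, List.flatten_cons, List.flatMap_cons, thetaMinus,
        List.zipWith_append (by simp), List.prod_append, List.map_cons, List.prod_cons, ← ih]
      congr 1
      rw [blockFrom, List.drop_zero, ← List.map_coe_finRange_eq_range, List.map_map,
        List.zipWith_map_right, List.zipWith_self]
      rfl
  have := h (List.range (n - 1))
  rw [List.length_range] at this
  rw [cyclicWord, cyclicParams, this, List.range_eq_range', blocks]

/-! ### Action of a block on the vector representation -/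

/-- The basis vector `v_{a+1}`. -/
def vec {n : ℕ} (a : ℕ) (ha : a < n) : Idx n := .inl (.inl ⟨a, ha⟩)

/-- The basis vector `v_{\overline{a+1}}`. -/
def bar {n : ℕ} (a : ℕ) (ha : a < n) : Idx n := .inl (.inr ⟨a, ha⟩)

theorem pr_vec {n : ℕ} (hn : 3 ≤ n) {i a : ℕ} (hi : i < n) (ha : a < n) : pr ⟨i, hi⟩ (vec a ha) =
    if i + 1 = n then if n ≤ a + 2 then 1 else 0 else if a = i then 1 else
      if a = i + 1 then -1 else 0 := by
  rw [vec, pr_inl_inl hn, sroot, Pi.add_apply, Pi.single_apply, Pi.single_apply, sg]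
  simp only [Fin.ext_iff, lo_val, hi_val]
  split_ifs <;> omega

theorem pr_bar {n : ℕ} (hn : 3 ≤ n) {i a : ℕ} (hi : i < n) (ha : a < n) :
    pr ⟨i, hi⟩ (bar a ha) = -pr ⟨i, hi⟩ (vec a ha) :=
  pr_neg hn _ (vec a ha)

theorem raise_vec {n : ℕ} {a : ℕ} (ha : a + 1 < n) :
    Raise ⟨a, by omega⟩ (vec (n := n) (a + 1) ha) (vec a (by omega)) := ⟨rfl, rfl⟩

theorem raise_bar {n : ℕ} {a : ℕ} (ha : a + 1 < n) :
    Raise ⟨a, by omega⟩ (bar (n := n) a (by omega)) (bar (a + 1) ha) := ⟨rfl, rfl⟩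

theorem raise_bar_last {n : ℕ} {a a' i : ℕ} (ha : a + 2 = n) (ha' : a' + 1 = n) (hi : i + 1 = n) :
    Raise ⟨i, by omega⟩ (bar (n := n) a (by omega)) (vec a' (by omega)) :=
  ⟨hi, Or.inl ⟨by simp only; omega, Fin.ext (by simp only; omega)⟩⟩

theorem raise_bar_last' {n : ℕ} {a a' i : ℕ} (ha : a + 1 = n) (ha' : a' + 2 = n) (hi : i + 1 = n) :
    Raise ⟨i, by omega⟩ (bar (n := n) a (by omega)) (vec a' (by omega)) :=
  ⟨hi, Or.inr ⟨Fin.ext (by simp only; omega), by simp only; omega⟩⟩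

section

variable {n : ℕ} (hn : 3 ≤ n) {d : ℕ → ℂ} (hd : ∀ i ∈ Finset.Icc 1 n, d i ≠ 0) (φ : Idx n → ℂ)

include hn hd

/-- After the raise from index `a+1` to `a`, no factor further right acts on the new vector, so a
block moves an unbarred vector at most one step. Barred vectors can be raised repeatedly within one
block. -/
theorem ap_block_vec {a : ℕ} (ha : a + 3 < n) :
    ap (blockFrom n d 0) φ (vec (a + 1) (by omega)) =
      d (a + 1) / d (a + 2) * φ (vec (a + 1) (by omega)) + φ (vec a (by omega)) := by
  rw [ap_blockFrom_skip hn hd φ a (Nat.zero_le _) (by omega) fun m hm _ h => by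
      rw [pr_vec hn, if_neg (by omega), if_neg (by omega), if_neg (by omega)],
    ap_blockFrom_raise hn hd (by omega) (raise_vec (by omega)),
    ap_blockFrom_one hn hd (i := a + 1) (by omega) (by
      rw [pr_vec hn, if_neg (by omega), if_pos rfl]),
    ap_blockFrom_skip hn hd φ n (i := a + 1 + 1) (by omega) le_rfl fun m hm h _ => by
      rw [pr_vec hn]; split_ifs <;> omega,
    ap_blockFrom_skip hn hd φ n (i := a + 1) (by omega) le_rfl fun m hm h _ => by
      rw [pr_vec hn]; split_ifs <;> omega,
    ap_blockFrom_self]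
  ring

theorem ap_block_vec_sub_two {a : ℕ} (ha : a + 3 = n) :
    ap (blockFrom n d 0) φ (vec (a + 1) (by omega)) =
      d (a + 1) / (d (a + 2) * d n) * φ (vec (a + 1) (by omega)) + φ (vec a (by omega)) := by
  rw [ap_blockFrom_skip hn hd φ a (Nat.zero_le _) (by omega) fun m hm _ h => by
      rw [pr_vec hn, if_neg (by omega), if_neg (by omega), if_neg (by omega)],
    ap_blockFrom_raise hn hd (by omega) (raise_vec (by omega)),
    ap_blockFrom_one hn hd (i := a + 1) (by omega) (by
      rw [pr_vec hn, if_neg (by omega), if_pos rfl]),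
    ap_blockFrom_one hn hd (i := a + 1 + 1) (by omega) (by
      rw [pr_vec hn, if_pos (by omega), if_pos (by omega)]),
    ap_blockFrom_skip hn hd φ n (i := a + 1) (by omega) le_rfl fun m hm h _ => by
      rw [pr_vec hn]; split_ifs <;> omega,
    show a + 1 + 1 + 1 = n by omega, ap_blockFrom_self]
  rw [mul_comm (d (a + 2)), div_eq_mul_inv, mul_inv]
  ring

theorem ap_block_vec_last {a : ℕ} (ha : a + 2 = n) :
    ap (blockFrom n d 0) φ (vec (a + 1) (by omega)) =
      d (a + 1) / d n * φ (vec (a + 1) (by omega)) + (d n)⁻¹ * φ (vec a (by omega)) := by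
  rw [ap_blockFrom_skip hn hd φ a (Nat.zero_le _) (by omega) fun m hm _ h => by
      rw [pr_vec hn, if_neg (by omega), if_neg (by omega), if_neg (by omega)],
    ap_blockFrom_raise hn hd (by omega) (raise_vec (by omega)),
    ap_blockFrom_one hn hd (i := a + 1) (by omega) (by
      rw [pr_vec hn, if_pos (by omega), if_pos (by omega)]),
    ap_blockFrom_one hn hd (i := a + 1) (by omega) (by
      rw [pr_vec hn, if_pos (by omega), if_pos (by omega)]),
    show a + 1 + 1 = n by omega, ap_blockFrom_self]
  ring

theorem ap_block_bar_last {a : ℕ} (ha : a + 2 = n) :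
    ap (blockFrom n d 0) φ (bar (a + 1) (by omega)) =
      d n / d (a + 1) * φ (bar (a + 1) (by omega)) + (d (a + 1))⁻¹ * φ (vec a (by omega)) := by
  rw [ap_blockFrom_skip hn hd φ a (Nat.zero_le _) (by omega) fun m hm _ h => by
      rw [pr_bar hn, pr_vec hn, if_neg (by omega), if_neg (by omega), if_neg (by omega), neg_zero],
    ap_blockFrom_one hn hd (i := a) (by omega) (by
      rw [pr_bar hn, pr_vec hn, if_neg (by omega), if_neg (by omega), if_pos rfl, neg_neg]),
    ap_blockFrom_raise hn hd (i := a + 1) (by omega) (raise_bar_last' (a' := a) (by omega) (by omega)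
      (by omega)),
    show a + 1 + 1 = n by omega, ap_blockFrom_self]
  ring

/-- `d_a` for `a ≥ 1`, and `1` for `a = 0`. -/
def withOne (d : ℕ → ℂ) (a : ℕ) : ℂ := if a = 0 then 1 else d a

omit hn in
theorem withOne_ne_zero {a : ℕ} (ha : a ≤ n) : withOne d a ≠ 0 := by
  unfold withOne
  split_ifs with h
  · exact one_ne_zero
  · exact hd a (Finset.mem_Icc.2 (by omega))

/-- Among the factors left of the raising one, only the preceding factor acts, by the scalar
`d_a⁻¹`; for `a = 0` there is none. Clearing it makes adjacent barred rows comparable. -/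
theorem withOne_mul_ap_block_bar {a : ℕ} (ha : a + 1 < n) :
    withOne d a * ap (blockFrom n d 0) φ (bar a (by omega)) =
      ap (blockFrom n d a) φ (bar a (by omega)) := by
  rcases a with _ | a
  · simp [withOne]
  · rw [ap_blockFrom_skip hn hd φ a (Nat.zero_le _) (by omega) fun m hm _ h => by
        rw [pr_bar hn, pr_vec hn, if_neg (by omega), if_neg (by omega), if_neg (by omega), neg_zero],
      ap_blockFrom_one hn hd (i := a) (by omega) (by
        rw [pr_bar hn, pr_vec hn, if_neg (by omega), if_neg (by omega), if_pos rfl, neg_neg]),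
      withOne, if_neg (by omega), mul_inv_cancel_left₀ (hd _ (Finset.mem_Icc.2 (by omega)))]

theorem ap_block_bar {a : ℕ} (ha : a + 2 < n) :
    withOne d a * ap (blockFrom n d 0) φ (bar a (by omega)) =
      d (a + 1) * φ (bar a (by omega)) +
        withOne d (a + 1) * ap (blockFrom n d 0) φ (bar (a + 1) (by omega)) := by
  rw [withOne_mul_ap_block_bar hn hd φ (by omega), ap_blockFrom_raise hn hd _ (raise_bar (by omega)),
    withOne_mul_ap_block_bar hn hd φ (by omega),
    ap_blockFrom_skip hn hd φ n (i := a + 1) (by omega) le_rfl fun m hm h _ => by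
      rw [pr_bar hn, pr_vec hn]; split_ifs <;> omega,
    ap_blockFrom_self]

theorem ap_block_bar_sub_two {a : ℕ} (ha : a + 2 = n) :
    withOne d a * ap (blockFrom n d 0) φ (bar a (by omega)) =
      d (a + 1) * d n * φ (bar a (by omega)) + d (a + 1) * φ (vec (a + 1) (by omega)) +
        d n * φ (bar (a + 1) (by omega)) + φ (vec a (by omega)) := by
  rw [withOne_mul_ap_block_bar hn hd φ (by omega), ap_blockFrom_raise hn hd _ (raise_bar (by omega)),
    ap_blockFrom_raise hn hd (i := a + 1) (by omega) (raise_bar_last (a' := a + 1) (by omega)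
      (by omega) (by omega)),
    ap_blockFrom_raise hn hd (i := a + 1) (by omega) (raise_bar_last' (a' := a) (by omega)
      (by omega) (by omega)),
    show a + 1 + 1 = n by omega, ap_blockFrom_self]
  ring

/-- The recursion of `ap_block_bar` telescopes down to the last barred row of the chain, where both
spin nodes act. -/
theorem ap_block_bar_sum (m a : ℕ) (ha : a + m + 2 = n) :
    withOne d a * ap (blockFrom n d 0) φ (bar a (by omega)) =
      ∑ j : Fin m, d (a + j.val + 1) * φ (bar (a + j.val) (by omega)) +
        (d (n - 1) * d n * φ (bar (n - 2) (by omega)) + d (n - 1) * φ (vec (n - 1) (by omega)) +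
          d n * φ (bar (n - 1) (by omega)) + φ (vec (n - 2) (by omega))) := by
  induction m generalizing a with
  | zero =>
    rw [ap_block_bar_sub_two hn hd φ (by omega)]
    obtain rfl : a = n - 2 := by omega
    simp only [show n - 2 + 1 = n - 1 by omega]
    simp
  | succ m ih =>
    rw [ap_block_bar hn hd φ (by omega), ih (a + 1) (by omega), Fin.sum_univ_succ]
    simp only [Fin.val_zero, Fin.val_succ, add_zero, ← add_assoc, add_right_comm a 1]

end

end TypeD

end

noncomputable section

namespace TypeD

open Matrix

/-! ### Columns of a product of blocks in the vector representation -/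

/-- The column with index `v_{p+1}` of a product of blocks. -/
def vecCol (n : ℕ) (c : ℕ → ℕ → ℂ) (p : ℕ) (hp : p < n) (t m : ℕ) : Idx n → ℂ :=
  ap (blocks n c t m) (Pi.single (vec p hp) 1)

theorem vecCol_succ {n : ℕ} (c : ℕ → ℕ → ℂ) (p : ℕ) (hp : p < n) (t m : ℕ) :
    vecCol n c p hp t (m + 1) = ap (blockFrom n (c (t + 1)) 0) (vecCol n c p hp (t + 1) m) := by
  rw [vecCol, blocks_succ, ap_mul, vecCol]

theorem vecCol_zero {n : ℕ} (c : ℕ → ℕ → ℂ) (p : ℕ) (hp : p < n) (t : ℕ) :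
    vecCol n c p hp t 0 = Pi.single (vec p hp) 1 := by
  rw [vecCol, blocks_zero, ap_one]

theorem vecCol_zero_vec {n : ℕ} (c : ℕ → ℕ → ℂ) (p : ℕ) (hp : p < n) (t : ℕ) {a : ℕ} (ha : a < n) :
    vecCol n c p hp t 0 (vec a ha) = if a = p then 1 else 0 := by
  rw [vecCol_zero, Pi.single_apply]
  simp [vec]

theorem vecCol_zero_bar {n : ℕ} (c : ℕ → ℕ → ℂ) (p : ℕ) (hp : p < n) (t : ℕ) {a : ℕ} (ha : a < n) :
    vecCol n c p hp t 0 (bar a ha) = 0 := by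
  rw [vecCol_zero, Pi.single_apply, if_neg (by simp [vec, bar])]

/-- Finite propagation: a block advances an unbarred index by at most one, and barred coordinates
are fed only by the last two unbarred ones. -/
theorem vecCol_eq_zero {n : ℕ} (hn : 3 ≤ n) {c : ℕ → ℕ → ℂ}
    (hc : ∀ l ∈ Finset.Icc 1 (n - 1), ∀ i ∈ Finset.Icc 1 n, c l i ≠ 0) {p : ℕ} (hp : p < n)
    (t m : ℕ) (htm : t + m < n) :
    (∀ a (ha : a < n), p + m < a → vecCol n c p hp t m (vec a ha) = 0) ∧
      (p + m < n - 1 → ∀ a (ha : a < n), vecCol n c p hp t m (bar a ha) = 0) := by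
  induction m generalizing t with
  | zero =>
    refine ⟨fun a ha h => ?_, fun _ a ha => vecCol_zero_bar c p hp t ha⟩
    rw [vecCol_zero_vec, if_neg (by omega)]
  | succ m ih =>
    obtain ⟨h1, h2⟩ := ih (t + 1) (by omega)
    have hd := hc (t + 1) (Finset.mem_Icc.2 (by omega))
    rw [vecCol_succ]
    set φ := vecCol n c p hp (t + 1) m
    refine ⟨fun a ha h => ?_, fun h => ?_⟩
    · obtain ⟨a, rfl⟩ : ∃ a', a = a' + 1 := ⟨a - 1, by omega⟩
      have e1 := h1 (a + 1) ha (by omega)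
      have e2 := h1 a (by omega) (by omega)
      rcases lt_trichotomy (a + 3) n with h3 | h3 | h3
      · rw [ap_block_vec hn hd φ h3, e1, e2]; simp
      · rw [ap_block_vec_sub_two hn hd φ h3, e1, e2]; simp
      · rw [ap_block_vec_last hn hd φ (by omega), e1, e2]; simp
    · have h2 := h2 (by omega)
      intro a ha
      by_cases h3 : a + 1 = n
      · obtain ⟨a, rfl⟩ : ∃ a', a = a' + 1 := ⟨a - 1, by omega⟩
        rw [ap_block_bar_last hn hd φ (by omega), h2, h1 a (by omega) (by omega)]; simp
      · have h4 := ap_block_bar_sum hn hd φ (n - 2 - a) a (by omega)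
        simp only [h2] at h4
        rw [h1 (n - 1) (by omega) (by omega), h1 (n - 2) (by omega) (by omega)] at h4
        simpa [withOne_ne_zero hd (show a ≤ n by omega)] using h4

/-- The front of the propagation is the path that advances in every block. The bound stops it before
the last index, where an advance would cost the factor `d_n⁻¹`. -/
theorem vecCol_eq_one {n : ℕ} (hn : 3 ≤ n) {c : ℕ → ℕ → ℂ}
    (hc : ∀ l ∈ Finset.Icc 1 (n - 1), ∀ i ∈ Finset.Icc 1 n, c l i ≠ 0) {p : ℕ} (hp : p < n)
    (t m : ℕ) (htm : t + m < n) (hpm : p + m + 2 ≤ n) :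
    vecCol n c p hp t m (vec (p + m) (by omega)) = 1 := by
  induction m generalizing t with
  | zero => rw [vecCol_zero_vec, if_pos (by omega)]
  | succ m ih =>
    have h1 := (vecCol_eq_zero hn hc hp (t + 1) m (by omega)).1 (p + m + 1) (by omega) (by omega)
    have h2 := ih (t + 1) (by omega) (by omega)
    have hd := hc (t + 1) (Finset.mem_Icc.2 (by omega))
    rw [vecCol_succ]
    show ap _ _ (vec (p + m + 1) _) = 1
    rcases lt_or_eq_of_le (show p + m + 3 ≤ n by omega) with h3 | h3
    · rw [ap_block_vec hn hd _ h3, h1, h2]; simp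
    · rw [ap_block_vec_sub_two hn hd _ h3, h1, h2]; simp

/-- After row `a` is scaled by `δ a`, subtracting each next row leaves the rows of `N` and the last
row, with first column `(0, …, 0, 1)`. The factors `δ` cancel, as `δ 0 = 1`, and the cofactor sign
is absorbed by the extra row sign. -/
theorem det_step {K : ℕ} (M : Matrix (Fin (K + 1)) (Fin (K + 1)) ℂ) (N : Matrix (Fin K) (Fin (K + 1)) ℂ)
    (δ : ℕ → ℂ) (hδ : ∀ a ≤ K, δ a ≠ 0) (hδ0 : δ 0 = 1)
    (h : ∀ (a : Fin K) b, δ a * M a.castSucc b = δ (a + 1) * N a b + δ (a + 1) * M a.succ b)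
    (h0 : ∀ a, N a 0 = 0) (h1 : δ K * M (Fin.last K) 0 = 1) :
    (Matrix.of fun a b : Fin (K + 1) => (-1 : ℂ) ^ a.val * M a b).det =
      (Matrix.of fun a b : Fin K => (-1 : ℂ) ^ a.val * N a b.succ).det := by
  set E : Matrix (Fin (K + 1)) (Fin (K + 1)) ℂ := Matrix.of fun a b => δ a * M a b with hE
  set B : Matrix (Fin (K + 1)) (Fin (K + 1)) ℂ :=
    Matrix.of fun a b => Fin.lastCases (δ K * M (Fin.last K) b) (fun a => δ (a + 1) * N a b) a with hB
  have hBl : ∀ b, B (Fin.last K) b = δ K * M (Fin.last K) b := fun b => by simp [hB]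
  have hBc : ∀ (a : Fin K) b, B a.castSucc b = δ (a + 1) * N a b := fun a b => by simp [hB]
  have hEB : E.det = B.det := by
    -- The row-operation lemma adds the preceding row, whereas here the following one is added;
    -- hence the reversal.
    rw [← det_submatrix_equiv_self Fin.revPerm E, ← det_submatrix_equiv_self Fin.revPerm B]
    refine det_eq_of_forall_row_eq_smul_add_pred (fun _ => 1) (fun b => ?_) fun a b => ?_
    · simp only [submatrix_apply, Fin.revPerm_apply, Fin.rev_zero, hBl, hE, of_apply, Fin.val_last]
    · simp only [submatrix_apply, Fin.revPerm_apply, Fin.rev_succ, Fin.rev_castSucc, hBc, hE, of_apply,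
        Fin.val_castSucc, Fin.val_succ, one_mul]
      exact h _ _
  have hE' : E.det = (∏ a : Fin (K + 1), δ a) * M.det := det_mul_column _ _
  have hB' : B.det = (-1) ^ K * ((∏ a : Fin K, δ (a + 1)) *
      (Matrix.of fun a b : Fin K => N a b.succ).det) := by
    rw [det_succ_column_zero, Fin.sum_univ_castSucc, Finset.sum_eq_zero, zero_add, hBl, h1, mul_one,
      ← det_mul_column, Fin.val_last]
    · congr 2
      ext a b
      rw [submatrix_apply, Fin.succAbove_last, hBc, of_apply, of_apply]
    · intro a _
      rw [hBc, h0]; ring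
  have hprod : ∏ a : Fin (K + 1), δ a = ∏ a : Fin K, δ (a + 1) := by
    rw [Fin.prod_univ_succ]; simp [hδ0]
  have hne : ∏ a : Fin K, δ (a + 1) ≠ 0 :=
    Finset.prod_ne_zero_iff.2 fun a _ => hδ _ (by have := a.2; omega)
  have hMN : M.det = (-1) ^ K * (Matrix.of fun a b : Fin K => N a b.succ).det := by
    rw [hE', hB', hprod] at hEB
    refine mul_left_cancel₀ hne ?_
    rw [hEB]; ring
  rw [show (Matrix.of fun a b : Fin (K + 1) => (-1 : ℂ) ^ a.val * M a b).det =
    (∏ a : Fin (K + 1), (-1 : ℂ) ^ a.val) * M.det from det_mul_column _ _,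
    show (Matrix.of fun a b : Fin K => (-1 : ℂ) ^ a.val * N a b.succ).det =
    (∏ a : Fin K, (-1 : ℂ) ^ a.val) * (Matrix.of fun a b : Fin K => N a b.succ).det from
      det_mul_column _ _, hMN, Fin.prod_univ_castSucc]
  simp only [Fin.val_castSucc, Fin.val_last]
  have : ((-1 : ℂ) ^ K) * (-1) ^ K = 1 := by rw [← pow_add]; exact Even.neg_one_pow ⟨_, rfl⟩
  linear_combination (∏ a : Fin K, (-1 : ℂ) ^ a.val) *
    (Matrix.of fun a b : Fin K => N a b.succ).det * this

/-- Each step removes the leftmost block through `det_step`. Without that block, column `t` has not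
yet reached the barred vectors, so the first column of `N` vanishes. -/
theorem det_vecCol {n : ℕ} (hn : 3 ≤ n) {c : ℕ → ℕ → ℂ}
    (hc : ∀ l ∈ Finset.Icc 1 (n - 1), ∀ i ∈ Finset.Icc 1 n, c l i ≠ 0) {k : ℕ} (hk : k + 2 < n)
    (K t : ℕ) (hKt : t + K = k) :
    (Matrix.of fun a b : Fin (K + 1) => (-1 : ℂ) ^ a.val *
      vecCol n c (if t + b.val = k then k + 1 else t + b.val) (by split_ifs <;> omega) t (n - 1 - t)
        (bar a.val (by omega))).det =
      vecCol n c (k + 1) (by omega) k (n - 1 - k) (bar 0 (by omega)) := by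
  induction K generalizing t with
  | zero =>
    refine (det_fin_one _).trans ?_
    obtain rfl : t = k := by omega
    simp
  | succ K ih =>
    rw [← ih (t + 1) (by omega)]
    have hd := hc (t + 1) (Finset.mem_Icc.2 (by omega))
    have hm : n - 1 - t = n - 1 - (t + 1) + 1 := by omega
    set q : Fin (K + 1 + 1) → ℕ := fun b => if t + b.val = k then k + 1 else t + b.val with hq
    have hqn : ∀ b, q b < n := fun b => by
      have := b.2
      simp only [hq]; split_ifs <;> omega
    have hq0 : q 0 = t := if_neg (by rw [Fin.val_zero]; omega)
    have hz := vecCol_eq_zero hn hc (hqn 0) (t + 1) (n - 1 - (t + 1)) (by omega)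
    have hz2 := hz.2 (by omega)
    refine (det_step (fun a b => vecCol n c (q b) (hqn b) t (n - 1 - t) (bar a.val (by omega)))
      (fun a b => vecCol n c (q b) (hqn b) (t + 1) (n - 1 - (t + 1)) (bar a.val (by omega)))
      (withOne (c (t + 1))) (fun a ha => withOne_ne_zero hd (by omega)) rfl (fun a b => ?_)
      (fun a => hz2 _ _) ?_).trans ?_
    · have ha := a.2
      have h := ap_block_bar hn hd (vecCol n c (q b) (hqn b) (t + 1) (n - 1 - (t + 1))) (a := a.val)
        (by omega)
      rw [show withOne (c (t + 1)) (a.val + 1) = c (t + 1) (a.val + 1) from if_neg (by omega)] at h ⊢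
      simp only [hm, vecCol_succ, Fin.val_castSucc, Fin.val_succ]
      exact h
    -- The remaining `n-2-t` blocks bring index `t` exactly to index `n-2` with coefficient 1, so
    -- only the last term of the telescoped row survives.
    · have h := ap_block_bar_sum hn hd (vecCol n c (q 0) (hqn 0) (t + 1) (n - 1 - (t + 1)))
        (n - 2 - (K + 1)) (K + 1) (by omega)
      simp only [hz2] at h
      have h1 := vecCol_eq_one hn hc (hqn 0) (t + 1) (n - 1 - (t + 1)) (by omega) (by omega)
      simp only [show q 0 + (n - 1 - (t + 1)) = n - 2 by omega] at h1
      rw [hz.1 (n - 1) (by omega) (by omega), h1, ← vecCol_succ, ← hm] at h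
      simpa using h
    · congr 2
      funext a b
      simp only [hq, Fin.val_succ]
      congr 2
      all_goals simp only [show t + (b.val + 1) = t + 1 + b.val by omega]

/-- One step behind the front means that exactly one block did not advance the vector; the sum runs
over this block, weighted by its diagonal entry. -/
theorem vecCol_slack {n : ℕ} (hn : 3 ≤ n) {c : ℕ → ℕ → ℂ}
    (hc : ∀ l ∈ Finset.Icc 1 (n - 1), ∀ i ∈ Finset.Icc 1 n, c l i ≠ 0) {k : ℕ} (m : ℕ)
    (hm : k + m + 3 ≤ n) :
    vecCol n c (k + 1) (by omega) (n - 1 - m) m (vec (k + m) (by omega)) =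
      ∑ j ∈ Finset.Icc (n - m) (n - 1), c j (n + k - j) / c j (n + k + 1 - j) := by
  induction m with
  | zero =>
    rw [vecCol_zero_vec, if_neg (by omega), Finset.Icc_eq_empty (by omega), Finset.sum_empty]
  | succ m ih =>
    have hd := hc (n - 1 - (m + 1) + 1) (Finset.mem_Icc.2 (by omega))
    rw [vecCol_succ]
    show ap _ _ (vec (k + m + 1) _) = _
    rw [ap_block_vec hn hd _ (by omega)]
    have e : n - 1 - (m + 1) + 1 = n - 1 - m := by omega
    have h1 := vecCol_eq_one hn hc (show k + 1 < n by omega) (n - 1 - m) m (by omega) (by omega)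
    simp only [show k + 1 + m = k + m + 1 by omega] at h1
    rw [e, h1, ih (by omega), mul_one, ← Finset.add_sum_Ioc_eq_sum_Icc (a := n - (m + 1)) (by omega),
      ← Finset.Icc_add_one_left_eq_Ioc, show n - (m + 1) + 1 = n - m by omega,
      show n - (m + 1) = n - 1 - m by omega, show n + k - (n - 1 - m) = k + m + 1 by omega,
      show n + k + 1 - (n - 1 - m) = k + m + 2 by omega]

theorem vecCol_final {n : ℕ} (hn : 3 ≤ n) {c : ℕ → ℕ → ℂ}
    (hc : ∀ l ∈ Finset.Icc 1 (n - 1), ∀ i ∈ Finset.Icc 1 n, c l i ≠ 0) {k : ℕ} (hk : 1 ≤ k)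
    (hkn : k + 2 ≤ n) :
    vecCol n c k (by omega) (k - 1) (n - k) (bar 0 (by omega)) =
      c k 1 + ∑ j ∈ Finset.Icc 2 (n - 2), c k j / c (k + 1) (j - 1)
            + c k (n - 1) * c k n / c (k + 1) (n - 2)
            + c (k + 1) (n - 2) / (c (k + 1) (n - 1) * c (k + 1) n)
            + c k n / c (k + 1) (n - 1)
            + c k (n - 1) / c (k + 1) n
            + ∑ j ∈ Finset.Icc (k + 2) (n - 1), c j (n - 1 + k - j) / c j (n + k - j) := by
  obtain ⟨k, rfl⟩ : ∃ k', k = k' + 1 := ⟨k - 1, by omega⟩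
  have hd := hc (k + 1) (Finset.mem_Icc.2 (by omega))
  have hd' := hc (k + 1 + 1) (Finset.mem_Icc.2 (by omega))
  -- Two blocks are peeled off the left. The rest, `ψ`, has not reached the bars and enters only
  -- through index `n-2`, with coefficient 1, and index `n-3`, with the one-delay sum.
  rw [show n - (k + 1) = n - 3 - k + 1 + 1 by omega, vecCol_succ, Nat.add_sub_cancel]
  have hz := vecCol_eq_zero hn hc (show k + 1 < n by omega) (k + 1 + 1) (n - 3 - k) (by omega)
  have hz2 := hz.2 (by omega)
  have hone := vecCol_eq_one hn hc (show k + 1 < n by omega) (k + 1 + 1) (n - 3 - k) (by omega) (by omega)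
  simp only [show k + 1 + (n - 3 - k) = n - 2 by omega] at hone
  have hslack := vecCol_slack hn hc (k := k) (n - 3 - k) (by omega)
  simp only [show k + (n - 3 - k) = n - 3 by omega, show n - 1 - (n - 3 - k) = k + 1 + 1 by omega,
    show n - (n - 3 - k) = k + 1 + 2 by omega] at hslack
  have hzl := hz.1 (n - 1) (by omega) (by omega)
  set ψ := vecCol n c (k + 1) (by omega) (k + 1 + 1) (n - 3 - k) with hψ
  have hφ : vecCol n c (k + 1) (by omega) (k + 1) (n - 3 - k + 1) =
      ap (blockFrom n (c (k + 1 + 1)) 0) ψ := vecCol_succ _ _ _ _ _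
  have hbar : ∀ a (ha : a + 1 < n), vecCol n c (k + 1) (by omega) (k + 1) (n - 3 - k + 1)
      (bar a (by omega)) = (withOne (c (k + 1 + 1)) a)⁻¹ := by
    intro a ha
    have h := ap_block_bar_sum hn hd' ψ (n - 2 - a) a (by omega)
    simp only [hz2] at h
    rw [hzl, hone, ← hφ] at h
    refine eq_inv_of_mul_eq_one_right ?_
    simpa using h
  have hbl : vecCol n c (k + 1) (by omega) (k + 1) (n - 3 - k + 1) (bar (n - 1) (by omega)) =
      (c (k + 1 + 1) (n - 1))⁻¹ := by
    have h := ap_block_bar_last hn hd' ψ (a := n - 2) (by omega)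
    simp only [show n - 2 + 1 = n - 1 by omega] at h
    rw [hφ, h, hz2, hone]; simp
  have hvl : vecCol n c (k + 1) (by omega) (k + 1) (n - 3 - k + 1) (vec (n - 1) (by omega)) =
      (c (k + 1 + 1) n)⁻¹ := by
    have h := ap_block_vec_last hn hd' ψ (a := n - 2) (by omega)
    simp only [show n - 2 + 1 = n - 1 by omega] at h
    rw [hφ, h, hzl, hone]; simp
  have hvs : vecCol n c (k + 1) (by omega) (k + 1) (n - 3 - k + 1) (vec (n - 2) (by omega)) =
      c (k + 1 + 1) (n - 2) / (c (k + 1 + 1) (n - 1) * c (k + 1 + 1) n) +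
        ∑ j ∈ Finset.Icc (k + 1 + 2) (n - 1), c j (n + k - j) / c j (n + k + 1 - j) := by
    have h := ap_block_vec_sub_two hn hd' ψ (a := n - 3) (by omega)
    simp only [show n - 3 + 1 = n - 2 by omega, show n - 3 + 2 = n - 1 by omega] at h
    rw [hφ, h, hone, hslack, mul_one]
  have h := ap_block_bar_sum hn hd (vecCol n c (k + 1) (by omega) (k + 1) (n - 3 - k + 1)) (n - 2) 0
    (by omega)
  rw [hbl, hvl, hvs] at h
  have hw0 : withOne (c (k + 1)) 0 = 1 := rfl
  have hwl : withOne (c (k + 1 + 1)) (n - 2) = c (k + 1 + 1) (n - 2) := if_neg (by omega)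
  rw [hw0, one_mul, hbar (n - 2) (by omega), hwl] at h
  rw [h]
  have hsum : ∑ j : Fin (n - 2), c (k + 1) (0 + j.val + 1) *
      vecCol n c (k + 1) (by omega) (k + 1) (n - 3 - k + 1) (bar (0 + j.val) (by omega)) =
      c (k + 1) 1 + ∑ j ∈ Finset.Icc 2 (n - 2), c (k + 1) j / c (k + 1 + 1) (j - 1) := by
    have e1 : ∀ j : Fin (n - 2), c (k + 1) (0 + j.val + 1) *
        vecCol n c (k + 1) (by omega) (k + 1) (n - 3 - k + 1) (bar (0 + j.val) (by omega)) =
        c (k + 1) (j.val + 1) * (withOne (c (k + 1 + 1)) j.val)⁻¹ := by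
      intro j
      have hj := j.2
      rw [hbar (0 + j.val) (by omega), zero_add]
    rw [Finset.sum_congr rfl fun j _ => e1 j,
      Fin.sum_univ_eq_sum_range (fun j => c (k + 1) (j + 1) * (withOne (c (k + 1 + 1)) j)⁻¹) (n - 2),
      show n - 2 = n - 3 + 1 by omega, Finset.sum_range_succ', add_comm]
    congr 1
    · simp [withOne]
    · rw [show Finset.Icc 2 (n - 3 + 1) = Finset.Ico (0 + 2) (n - 3 + 2) by
          ext j; simp only [Finset.mem_Icc, Finset.mem_Ico]; omega,
        ← Finset.sum_Ico_add' (fun j => c (k + 1) j / c (k + 1 + 1) (j - 1)), Finset.range_eq_Ico]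
      exact Finset.sum_congr rfl fun j _ => (div_eq_mul_inv _ _).symm
  rw [hsum]
  have hlast : ∑ j ∈ Finset.Icc (k + 1 + 2) (n - 1), c j (n + k - j) / c j (n + k + 1 - j) =
      ∑ j ∈ Finset.Icc (k + 1 + 2) (n - 1), c j (n - 1 + (k + 1) - j) / c j (n + (k + 1) - j) := by
    refine Finset.sum_congr rfl fun j _ => ?_
    rw [show n - 1 + (k + 1) - j = n + k - j by omega, add_assoc]
  rw [hlast]
  simp only [div_eq_mul_inv]
  ring

end TypeD

end

noncomputable section

namespace TypeD

open Matrix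

/-! ### Columns of a product of blocks in the spin representations -/

/-- The sum of the first `n - 1` coordinates of the doubled weight. -/
def height {n : ℕ} (b : Idx n) : ℤ := (fun j : Fin n => if j.val + 1 < n then (1 : ℤ) else 0) ⬝ᵥ wt b

/-- A chain node moves a sign within the first `n-1` places; each spin node links the last of them
with place `n`, which is not counted. -/
theorem height_raise {n : ℕ} (hn : 3 ≤ n) {i : Fin n} {b a : Idx n} (h : Raise i b a) :
    height a = height b + if i.val + 2 < n then 0 else 2 := by
  have hi' := i.2
  rw [height, h.wt_eq hn, dotProduct_add, dotProduct_smul, dotProduct_comm _ (sroot i), sroot_dot,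
    lo_val, hi_val, sg, height, smul_eq_mul]
  congr 1
  by_cases h1 : i.val + 1 = n
  · rw [if_pos h1, if_pos h1, if_pos h1, if_pos (by omega), if_neg (by omega), if_neg (by omega)]
    rfl
  · rw [if_neg h1, if_neg h1, if_neg h1, if_pos (by omega)]
    by_cases h2 : i.val + 2 < n
    · rw [if_pos (by omega), if_pos h2]; rfl
    · rw [if_neg (by omega), if_neg h2]; rfl

theorem height_spinVec {n : ℕ} (hn : 3 ≤ n) (ε : Bool) :
    height (spinVec true ε : Idx n) = (n : ℤ) - 1 := by
  have h : ∀ j : Fin n, (if j.val + 1 < n then (1 : ℤ) else 0) * wt (spinVec true ε) j =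
      if j.val + 1 < n then 1 else 0 := by
    intro j
    rw [wt_spinVec]
    split_ifs <;> first | omega | rfl | contradiction
  rw [height, dotProduct, Finset.sum_congr rfl fun j _ => h j,
    Fin.sum_univ_eq_sum_range (fun j => if j + 1 < n then (1 : ℤ) else 0) n]
  obtain ⟨n, rfl⟩ : ∃ m, n = m + 1 := ⟨n - 1, by omega⟩
  rw [Finset.sum_range_succ, Finset.sum_congr rfl fun j hj => if_pos (by
    have := Finset.mem_range.1 hj; omega)]
  simp

theorem Raise.exists_spin {n : ℕ} {i : Fin n} {S : SpinIdx n} {a : Idx n} (h : Raise i (.inr S) a) :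
    ∃ S', a = .inr S' := by
  rcases a with a | a
  · exact h.elim
  · exact ⟨a, rfl⟩

theorem pr_spin_of_lt {n : ℕ} (hn : 3 ≤ n) {i : ℕ} (hi : i + 1 < n) (S : SpinIdx n) :
    2 * pr ⟨i, by omega⟩ (.inr S) =
      (if S ⟨i, by omega⟩ then 1 else -1) - if S ⟨i + 1, hi⟩ then 1 else -1 := by
  have e1 : lo (⟨i, by omega⟩ : Fin n) = ⟨i, by omega⟩ :=
    Fin.ext (by rw [lo_val]; simp only; split_ifs <;> omega)
  have e2 : TypeD.hi (⟨i, by omega⟩ : Fin n) = ⟨i + 1, hi⟩ :=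
    Fin.ext (by rw [hi_val]; simp only; split_ifs <;> omega)
  have e3 : sg (⟨i, by omega⟩ : Fin n) = -1 := if_neg (by simp only; omega)
  rw [← two_mul_pr hn, sroot_dot, e1, e2, e3]
  simp only [wt]
  ring

theorem pr_spin_last {n : ℕ} (hn : 3 ≤ n) (S : SpinIdx n) :
    2 * pr ⟨n - 1, sub_one_lt hn⟩ (.inr S) =
      (if S ⟨n - 2, sub_two_lt hn⟩ then 1 else -1) + if S ⟨n - 1, sub_one_lt hn⟩ then 1 else -1 := by
  have e1 : lo (⟨n - 1, by omega⟩ : Fin n) = ⟨n - 2, by omega⟩ :=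
    Fin.ext (by rw [lo_val]; simp only; split_ifs <;> omega)
  have e2 : TypeD.hi (⟨n - 1, by omega⟩ : Fin n) = ⟨n - 1, by omega⟩ :=
    Fin.ext (by rw [hi_val]; simp only; split_ifs <;> omega)
  have e3 : sg (⟨n - 1, by omega⟩ : Fin n) = 1 := if_pos (by simp only; omega)
  rw [← two_mul_pr hn, sroot_dot, e1, e2, e3]
  simp only [wt]
  ring

/-- The sign vector with minus signs at the first `m` places and at the place `i`, and last sign `ε`. -/
def signs (n m i : ℕ) (ε : Bool) : SpinIdx n :=
  fun j => if j.val + 1 = n then ε else !decide (j.val < m ∨ j.val = i)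

theorem signs_of_lt {n m i : ℕ} {ε : Bool} {j : ℕ} (hj : j + 1 < n) :
    signs n m i ε ⟨j, by omega⟩ = !decide (j < m ∨ j = i) :=
  if_neg (by simp only; omega)

theorem signs_last {n m i : ℕ} (hn : 3 ≤ n) {ε : Bool} : signs n m i ε ⟨n - 1, sub_one_lt hn⟩ = ε :=
  if_pos (by simp only; omega)

theorem raise_signs {n m i : ℕ} {ε : Bool} (hmi : m ≤ i) (hi : i + 2 < n) :
    Raise ⟨i, by omega⟩ (.inr (signs n m i ε)) (.inr (signs n m (i + 1) ε)) := by
  refine Or.inl ⟨⟨i + 1, by omega⟩, rfl, ?_, ?_, ?_⟩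
  · rw [signs_of_lt (by omega)]; simp
  · rw [signs_of_lt (by omega)]; simp; omega
  · funext j
    simp only [Function.update_apply, Fin.ext_iff, signs]
    by_cases h1 : j.val + 1 = n
    · rw [if_pos h1, if_pos h1, if_neg (by omega), if_neg (by omega)]
    · rw [if_neg h1, if_neg h1]
      by_cases h2 : j.val = i + 1
      · simp [h2]
      · by_cases h3 : j.val = i
        · simp [h3]; omega
        · simp [h2, h3]

theorem ap_blockFrom_eq_zero {n : ℕ} (hn : 3 ≤ n) {d : ℕ → ℂ} (hd : ∀ i ∈ Finset.Icc 1 n, d i ≠ 0)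
    {i : ℕ} (hi : i < n) {b : Idx n} (h : pr ⟨i, hi⟩ b ≠ -1) {φ : Idx n → ℂ}
    (h0 : ap (blockFrom n d (i + 1)) φ b = 0) : ap (blockFrom n d i) φ b = 0 := by
  rcases (pr_cases hn ⟨i, hi⟩ b).2 with h1 | h1 | h1
  · exact absurd h1 h
  · rw [ap_blockFrom_zero hn hd hi h1, h0]
  · rw [ap_blockFrom_one hn hd hi h1, h0, mul_zero]

/-- The condition `hT` says that `f_i` kills the basis vector `T`, so the factor only rescales it.
-/
theorem ap_blockFrom_delta {n : ℕ} (hn : 3 ≤ n) {d : ℕ → ℂ} (hd : ∀ i ∈ Finset.Icc 1 n, d i ≠ 0)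
    {i : ℕ} (hi : i < n) {T : Idx n} (hT : pr ⟨i, hi⟩ T ≠ 1) {φ : Idx n → ℂ} {z : ℂ}
    (h : ∀ b, ap (blockFrom n d (i + 1)) φ b = if b = T then z else 0) (b : Idx n) :
    ap (blockFrom n d i) φ b =
      if b = T then (if pr ⟨i, hi⟩ T = -1 then d (i + 1) * z else z) else 0 := by
  by_cases h1 : pr ⟨i, hi⟩ b = -1
  · obtain ⟨a, ha⟩ := exists_raise hn h1
    have haT : a ≠ T := by rintro rfl; exact hT (ha.pr_right hn)
    rw [ap_blockFrom_raise hn hd hi ha, h, h, if_neg haT, add_zero]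
    by_cases hb : b = T
    · subst hb; simp [h1]
    · simp [hb]
  · by_cases hb : b = T
    · subst hb
      have h2 : pr ⟨i, hi⟩ b = 0 := by
        rcases (pr_cases hn ⟨i, hi⟩ b).2 with h2 | h2 | h2
        · exact absurd h2 h1
        · exact h2
        · exact absurd h2 hT
      rw [ap_blockFrom_zero hn hd hi h2, h, if_pos rfl, if_pos rfl, if_neg h1]
    · rw [if_neg hb]
      exact ap_blockFrom_eq_zero hn hd hi h1 (by rw [h, if_neg hb])

/-- Once the two spin factors have acted, the chain factors carry the new minus sign leftwards from
place `n-2` to place `m`, at coefficient 1 and constant height. `H2` kills the diagonal term at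
every move, because the minus sign has not yet arrived; the factors left of place `m` see equal
signs. -/
theorem spin_chain {n : ℕ} (hn : 3 ≤ n) {d : ℕ → ℂ} (hd : ∀ i ∈ Finset.Icc 1 n, d i ≠ 0)
    {φ : Idx n → ℂ} {m : ℕ} (hm : m + 2 ≤ n) {ε : Bool} {γ : ℂ}
    (H1 : ∀ S : SpinIdx n, height (.inr S) + 2 * (m + 1) < (n : ℤ) - 1 →
      ap (blockFrom n d (n - 2)) φ (.inr S) = 0)
    (H2 : ∀ S : SpinIdx n, height (.inr S) + 2 * m < (n : ℤ) - 1 → S ⟨n - 2, sub_two_lt hn⟩ = true →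
      ap (blockFrom n d (n - 2)) φ (.inr S) = 0)
    (H3 : ap (blockFrom n d (n - 2)) φ (.inr (signs n m (n - 2) ε)) = γ)
    (H4 : height (.inr (signs n m (n - 2) ε) : Idx n) + 2 * (m + 1) = (n : ℤ) - 1) :
    (∀ S : SpinIdx n, height (.inr S) + 2 * (m + 1) < (n : ℤ) - 1 →
      ap (blockFrom n d 0) φ (.inr S) = 0) ∧
    ap (blockFrom n d 0) φ (.inr (signs n m m ε)) = γ ∧
    height (.inr (signs n m m ε) : Idx n) + 2 * (m + 1) = (n : ℤ) - 1 := by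
  have key : ∀ r i : ℕ, i + r + 2 = n →
      (∀ S : SpinIdx n, height (.inr S) + 2 * (m + 1) < (n : ℤ) - 1 →
        ap (blockFrom n d i) φ (.inr S) = 0) ∧
      (∀ S : SpinIdx n, height (.inr S) + 2 * m < (n : ℤ) - 1 →
        (∀ j : Fin n, i ≤ j.val → j.val + 1 < n → S j = true) →
        ap (blockFrom n d i) φ (.inr S) = 0) ∧
      (m ≤ i → ap (blockFrom n d i) φ (.inr (signs n m i ε)) = γ ∧
        height (.inr (signs n m i ε) : Idx n) + 2 * (m + 1) = (n : ℤ) - 1) := by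
    intro r
    induction r with
    | zero =>
      intro i hi
      obtain rfl : i = n - 2 := by omega
      exact ⟨H1, fun S h h' => H2 S h (h' _ le_rfl (by simp only; omega)), fun _ => ⟨H3, H4⟩⟩
    | succ r ih =>
      intro i hi
      obtain ⟨h1, h2, h3⟩ := ih (i + 1) (by omega)
      refine ⟨fun S hS => ?_, fun S hS hS' => ?_, fun hmi => ?_⟩
      · by_cases hp : pr ⟨i, by omega⟩ (.inr S : Idx n) = -1
        · obtain ⟨a, ha⟩ := exists_raise hn hp
          obtain ⟨S', rfl⟩ := ha.exists_spin
          have hh := height_raise hn ha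
          rw [if_pos (by simp only; omega), add_zero] at hh
          rw [ap_blockFrom_raise hn hd (by omega) ha, h1 S hS, h1 S' (by omega), mul_zero, add_zero]
        · exact ap_blockFrom_eq_zero hn hd (by omega) hp (h1 S hS)
      · refine ap_blockFrom_eq_zero hn hd (by omega) (fun hp => ?_)
          (h2 S hS fun j hj hj' => hS' j (by omega) hj')
        have h4 := pr_spin_of_lt hn (i := i) (by omega) S
        rw [hp, hS' ⟨i, by omega⟩ le_rfl (by simp only; omega),
          hS' ⟨i + 1, by omega⟩ (by simp) (by simp only; omega)] at h4
        simp at h4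
      · obtain ⟨h3, h4⟩ := h3 (by omega)
        have ha := raise_signs (n := n) (ε := ε) hmi (by omega)
        have hh := height_raise hn ha
        rw [if_pos (by simp only; omega), add_zero] at hh
        refine ⟨?_, by omega⟩
        rw [ap_blockFrom_raise hn hd (by omega) ha, h3, h2 _ (by omega) fun j hj hj' => ?_, mul_zero,
          zero_add]
        rw [show j = ⟨j.val, j.2⟩ from rfl, signs_of_lt (by omega)]
        simp; omega
  obtain ⟨h1, -, -⟩ := key (n - 2) 0 (by omega)
  obtain ⟨h2, h3⟩ := (key (n - 2 - m) m (by omega)).2.2 le_rfl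
  refine ⟨h1, ?_, h3⟩
  rw [ap_blockFrom_skip hn hd φ m (Nat.zero_le _) (by omega) fun j hj _ hjm => ?_, h2]
  have h4 := pr_spin_of_lt hn (i := j) (by omega) (signs n m m ε)
  rw [signs_of_lt (by omega), signs_of_lt (by omega)] at h4
  have e1 : decide (j < m ∨ j = m) = true := decide_eq_true (by omega)
  have e2 : decide (j + 1 < m ∨ j + 1 = m) = true := decide_eq_true (by omega)
  rw [e1, e2] at h4
  simpa using h4

/-- A block creates at most one new minus sign among the first `n-1` places, since both spin nodes
compete for the same place. On the lowest vector reached so far this happens with coefficient 1 and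
flips the last sign. -/
theorem spin_block {n : ℕ} (hn : 3 ≤ n) {d : ℕ → ℂ} (hd : ∀ i ∈ Finset.Icc 1 n, d i ≠ 0)
    {φ : Idx n → ℂ} {m : ℕ} (hm : m + 2 ≤ n) {ε : Bool} {γ : ℂ}
    (H1 : ∀ S : SpinIdx n, height (.inr S) + 2 * m < (n : ℤ) - 1 → φ (.inr S) = 0)
    (H2 : φ (.inr (signs n m n ε)) = γ)
    (H3 : height (.inr (signs n m n ε) : Idx n) + 2 * m = (n : ℤ) - 1) :
    (∀ S : SpinIdx n, height (.inr S) + 2 * (m + 1) < (n : ℤ) - 1 →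
      ap (blockFrom n d 0) φ (.inr S) = 0) ∧
    ap (blockFrom n d 0) φ (.inr (signs n m m (!ε))) = γ ∧
    height (.inr (signs n m m (!ε)) : Idx n) + 2 * (m + 1) = (n : ℤ) - 1 := by
  have hlast : blockFrom n d (n - 1) = yBold ⟨n - 1, by omega⟩ (d (n - 1 + 1)) *
      blockFrom n d (n - 1 + 1) := blockFrom_of_lt d (by omega)
  have hend : ap (blockFrom n d (n - 1 + 1)) φ = φ := by
    rw [show n - 1 + 1 = n by omega, ap_blockFrom_self]
  -- The last sign selects which spin node raises `S`; the other node acts trivially on the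
  -- coordinates that matter.
  have hflip : ∀ S : SpinIdx n, S ⟨n - 2, by omega⟩ = false → ∃ S' : SpinIdx n,
      S' = Function.update (Function.update S ⟨n - 2, by omega⟩ true) ⟨n - 1, by omega⟩
        (!S ⟨n - 1, by omega⟩) ∧ height (.inr S' : Idx n) = height (.inr S : Idx n) + 2 ∧
      (height (.inr S : Idx n) + 2 * m < (n : ℤ) - 1 →
        ap (blockFrom n d (n - 2)) φ (.inr S) = φ (.inr S')) := by
    intro S hS
    refine ⟨_, rfl, ?_⟩
    cases hS' : S ⟨n - 1, by omega⟩
    · have ha : Raise ⟨n - 1, by omega⟩ (.inr S) (.inr (Function.update (Function.update S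
          ⟨n - 2, by omega⟩ true) ⟨n - 1, by omega⟩ true)) :=
        Or.inr ⟨by simp only; omega, ⟨n - 2, by omega⟩, by simp only; omega, hS, hS', rfl⟩
      have hh := height_raise hn ha
      rw [if_neg (by simp only; omega)] at hh
      refine ⟨hh, fun h => ?_⟩
      have h4 := pr_spin_of_lt hn (i := n - 2) (by omega) S
      simp only [show n - 2 + 1 = n - 1 by omega, hS, hS'] at h4
      rw [ap_blockFrom_zero hn hd (i := n - 2) (by omega) (by simpa using h4)]
      simp only [show n - 2 + 1 = n - 1 by omega]
      rw [ap_blockFrom_raise hn hd (by omega) ha, hend, H1 S h, mul_zero, zero_add]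
      rfl
    · have ha : Raise ⟨n - 2, by omega⟩ (.inr S) (.inr (Function.update (Function.update S
          ⟨n - 2, by omega⟩ true) ⟨n - 1, by omega⟩ false)) :=
        Or.inl ⟨⟨n - 1, by omega⟩, by simp only; omega, hS, hS', rfl⟩
      have hh := height_raise hn ha
      rw [if_neg (by simp only; omega)] at hh
      refine ⟨hh, fun h => ?_⟩
      have hne : (⟨n - 2, by omega⟩ : Fin n) ≠ ⟨n - 1, by omega⟩ := Fin.ne_of_val_ne (by simp only; omega)
      have h4 := pr_spin_last hn S
      have h5 := pr_spin_last hn (Function.update (Function.update S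
          ⟨n - 2, by omega⟩ true) ⟨n - 1, by omega⟩ false)
      simp only [hS, hS', Function.update_self, Function.update_of_ne hne] at h4 h5
      rw [ap_blockFrom_raise hn hd (by omega) ha]
      simp only [show n - 2 + 1 = n - 1 by omega]
      rw [ap_blockFrom_zero hn hd (i := n - 1) (by omega) (by simpa using h4),
        ap_blockFrom_zero hn hd (i := n - 1) (by omega) (by simpa using h5), hend, H1 S h, mul_zero,
        zero_add]
      rfl
  have hplus : ∀ S : SpinIdx n, height (.inr S : Idx n) + 2 * m < (n : ℤ) - 1 →
      S ⟨n - 2, by omega⟩ = true → ap (blockFrom n d (n - 2)) φ (.inr S) = 0 := by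
    intro S h hS
    have h4 := pr_spin_of_lt hn (i := n - 2) (by omega) S
    have h5 := pr_spin_last hn S
    simp only [show n - 2 + 1 = n - 1 by omega, hS, if_true] at h4 h5
    refine ap_blockFrom_eq_zero hn hd (by omega) (fun hp => ?_) ?_
    · rw [hp] at h4; split_ifs at h4 <;> omega
    · simp only [show n - 2 + 1 = n - 1 by omega]
      refine ap_blockFrom_eq_zero hn hd (by omega) (fun hp => ?_) (by rw [hend]; exact H1 S h)
      rw [hp] at h5; split_ifs at h5 <;> omega
  refine spin_chain hn hd hm (fun S h => ?_) hplus ?_ ?_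
  · cases hS : S ⟨n - 2, by omega⟩
    · obtain ⟨S', -, h1, h2⟩ := hflip S hS
      rw [h2 (by omega), H1 S' (by omega)]
    · exact hplus S (by omega) hS
  all_goals
    obtain ⟨S', h0, h1, h2⟩ := hflip (signs n m (n - 2) (!ε)) (by rw [signs_of_lt (by omega)]; simp)
    have e : S' = signs n m n ε := by
      rw [h0, signs_last hn, Bool.not_not]
      funext j
      have hj := j.2
      simp only [Function.update_apply, Fin.ext_iff, signs]
      by_cases h3 : j.val + 1 = n
      · rw [if_pos (by omega), if_pos h3]
      · rw [if_neg (by omega), if_neg h3]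
        by_cases h4 : j.val = n - 2
        · rw [if_pos h4, if_neg h3]; simp; omega
        · rw [if_neg h4, if_neg h3]; simp [h4]; omega
    rw [e] at h1 h2
  · rw [h2 (by omega), H2]
  · omega

/-- The starting vector already has its minus sign at place `n-2`, so neither spin node can lower
it: one rescales it by its parameter and the other fixes it. This is the only parameter in the final
answer. -/
theorem spin_first_block {n : ℕ} (hn : 3 ≤ n) {d : ℕ → ℂ} (hd : ∀ i ∈ Finset.Icc 1 n, d i ≠ 0)
    (ε : Bool) :
    (∀ S : SpinIdx n, height (.inr S) + 2 * (0 + 1) < (n : ℤ) - 1 →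
      ap (blockFrom n d 0) (Pi.single (spinTarget ε) 1) (.inr S) = 0) ∧
    ap (blockFrom n d 0) (Pi.single (spinTarget ε) 1) (.inr (signs n 0 0 (!ε))) =
      (if ε then d n else d (n - 1)) ∧
    height (.inr (signs n 0 0 (!ε)) : Idx n) + 2 * (0 + 1) = (n : ℤ) - 1 := by
  have hT : (spinTarget ε : Idx n) = .inr (signs n 0 (n - 2) (!ε)) := by
    rw [spinTarget]
    congr 1
    funext j
    have hj := j.2
    simp only [signs]
    by_cases h1 : j.val + 1 = n
    · simp only [h1, if_true]
    · simp only [h1, if_false]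
      by_cases h2 : j.val + 2 = n
      · rw [if_pos h2]; simp; omega
      · rw [if_neg h2]; simp; omega
  have hheight : height (spinTarget ε : Idx n) + 2 = (n : ℤ) - 1 := by
    have h := height_raise hn (raise_spinTarget hn ε)
    rw [height_spinVec hn, if_neg] at h
    · omega
    · cases ε <;> simp [spinNode] <;> omega
  have hδ : ∀ b, ap (blockFrom n d (n - 2)) (Pi.single (spinTarget ε) 1) b =
      if b = spinTarget ε then (if ε then d n else d (n - 1)) else 0 := by
    have h4 := pr_spin_of_lt hn (i := n - 2) (by omega) (signs n 0 (n - 2) (!ε))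
    have h5 := pr_spin_last hn (signs n 0 (n - 2) (!ε))
    simp only [show n - 2 + 1 = n - 1 by omega] at h4
    rw [signs_last hn, signs_of_lt (by omega)] at h4 h5
    simp only [or_true, decide_true, Bool.not_true, Bool.false_eq_true, if_false] at h4 h5
    rw [← hT] at h4 h5
    have h6 : ∀ b, ap (blockFrom n d (n - 1 + 1)) (Pi.single (spinTarget ε) 1) b =
        if b = spinTarget ε then 1 else 0 := by
      intro b
      rw [show n - 1 + 1 = n by omega, ap_blockFrom_self, Pi.single_apply]
    have h7 := ap_blockFrom_delta hn hd (i := n - 1) (by omega) (by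
      cases ε <;> simp at h5 <;> omega) h6
    have h8 := ap_blockFrom_delta hn hd (i := n - 2) (by omega) (T := spinTarget ε) (by
      cases ε <;> simp at h4 <;> omega) (by simp only [show n - 2 + 1 = n - 1 by omega]; exact h7)
    intro b
    rw [h8]
    simp only [show n - 2 + 1 = n - 1 by omega, show n - 1 + 1 = n by omega]
    cases ε
    · rw [if_pos (show pr ⟨n - 2, by omega⟩ (spinTarget false : Idx n) = -1 by simp at h4; omega),
        if_neg (show ¬ pr ⟨n - 1, by omega⟩ (spinTarget false : Idx n) = -1 by simp at h5; omega)]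
      simp
    · rw [if_neg (show ¬ pr ⟨n - 2, by omega⟩ (spinTarget true : Idx n) = -1 by simp at h4; omega),
        if_pos (show pr ⟨n - 1, by omega⟩ (spinTarget true : Idx n) = -1 by simp at h5; omega)]
      simp
  refine spin_chain hn hd (m := 0) (by omega) (fun S h => ?_) (fun S h hS => ?_) ?_ ?_
  · rw [hδ, if_neg]
    intro h'
    rw [h'] at h
    push_cast at h
    omega
  · rw [hδ, if_neg]
    intro h'
    rw [hT, Sum.inr.injEq] at h'
    rw [h', signs_of_lt (by omega)] at hS
    simp at hS
  · rw [hδ, ← hT, if_pos rfl]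
  · rw [← hT]; push_cast; omega

theorem signs_self {n m : ℕ} (ε : Bool) : signs n m m ε = signs n (m + 1) n ε := by
  funext j
  have hj := j.2
  simp only [signs]
  by_cases h : j.val + 1 = n
  · simp [h]
  · simp only [h, if_false]
    congr 2
    exact propext (by omega)

/-- The rightmost block supplies the parameter, and each further block lengthens the initial run of
minus signs by one. The parity records the flips of the last sign. -/
theorem spin_blocks {n : ℕ} (hn : 3 ≤ n) {c : ℕ → ℕ → ℂ}
    (hc : ∀ l ∈ Finset.Icc 1 (n - 1), ∀ i ∈ Finset.Icc 1 n, c l i ≠ 0) (ε : Bool) (m t : ℕ)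
    (htm : t + (m + 1) = n - 1) :
    (∀ S : SpinIdx n, height (.inr S) + 2 * ((m + 1 : ℕ) : ℤ) < (n : ℤ) - 1 →
      ap (blocks n c t (m + 1)) (Pi.single (spinTarget ε) 1) (.inr S) = 0) ∧
    ap (blocks n c t (m + 1)) (Pi.single (spinTarget ε) 1)
      (.inr (signs n (m + 1) n (if Even (m + 1) then ε else !ε))) =
        (if ε then c (n - 1) n else c (n - 1) (n - 1)) ∧
    height (.inr (signs n (m + 1) n (if Even (m + 1) then ε else !ε)) : Idx n) +
      2 * ((m + 1 : ℕ) : ℤ) = (n : ℤ) - 1 := by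
  induction m generalizing t with
  | zero =>
    have h := spin_first_block hn (hc (n - 1) (Finset.mem_Icc.2 (by omega))) ε
    rw [signs_self] at h
    rw [blocks_succ, blocks_zero, mul_one, show t + 1 = n - 1 by omega]
    exact h
  | succ m ih =>
    obtain ⟨h1, h2, h3⟩ := ih (t + 1) (by omega)
    have h := spin_block hn (hc (t + 1) (Finset.mem_Icc.2 (by omega))) (by omega) h1 h2 h3
    rw [signs_self] at h
    simp only [blocks_succ c t (m + 1), ap_mul]
    have e : (!if Even (m + 1) then ε else !ε) = if Even (m + 1 + 1) then ε else !ε := by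
      by_cases hm : Even (m + 1)
      · simp [hm, Nat.even_add_one]
      · simp [hm, Nat.even_add_one]
    rw [e] at h
    exact_mod_cast h

theorem spinVec_false_eq {n : ℕ} (ε : Bool) : (spinVec false ε : Idx n) = .inr (signs n (n - 1) n ε) := by
  rw [spinVec]
  congr 1
  funext j
  have hj := j.2
  simp only [signs]
  by_cases h : j.val + 1 = n
  · simp [h]
  · simp [h]; omega

theorem generalizedMinor_spin_theta {n : ℕ} (hn : 3 ≤ n) {w₀ : weylGroup n} (hw₀ : IsLongest w₀)
    {c : ℕ → ℕ → ℂ} (hc : ∀ l ∈ Finset.Icc 1 (n - 1), ∀ i ∈ Finset.Icc 1 n, c l i ≠ 0) (ε : Bool) :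
    generalizedMinor (fundamentalWeight (spinNode hn ε)) w₀ (s (spinNode hn ε))
      (thetaMinus (cyclicWord n) (cyclicParams n c)) =
        if ε then c (n - 1) n else c (n - 1) (n - 1) := by
  have h := (spin_blocks hn hc ε (n - 2) 0 (by omega)).2.1
  rw [show n - 2 + 1 = n - 1 by omega] at h
  rw [generalizedMinor_spin hn hw₀, thetaMinus_eq_blocks, spinVec_false_eq, h]

theorem generalizedMinor_vec_theta {n : ℕ} (hn : 3 ≤ n) {w₀ : weylGroup n} (hw₀ : IsLongest w₀)
    {c : ℕ → ℕ → ℂ} (hc : ∀ l ∈ Finset.Icc 1 (n - 1), ∀ i ∈ Finset.Icc 1 n, c l i ≠ 0) (k : ℕ)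
    (hk : k + 2 < n) :
    generalizedMinor (fundamentalWeight ⟨k, by omega⟩) w₀ (s ⟨k, by omega⟩)
      (thetaMinus (cyclicWord n) (cyclicParams n c)) =
        vecCol n c (k + 1) (by omega) k (n - 1 - k) (bar 0 (by omega)) := by
  rw [generalizedMinor_vec hn hw₀ k hk, thetaMinus_eq_blocks, ← det_vecCol hn hc hk k 0 (by omega)]
  congr 2
  funext a b
  simp only [zero_add, vecCol, vec, bar, Nat.sub_zero]

end TypeD

end

theorem mainTheorem9 (n : ℕ) (hn : 3 ≤ n) (w₀ : TypeD.weylGroup n) (hw₀ : TypeD.IsLongest w₀) :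
    TypeD.IsReducedWord (TypeD.cyclicWord n) w₀ ∧
    (∀ k : Fin n, ∃! F : TypeD.G n → ℂ,
      TypeD.IsPrincipalMinor (TypeD.fundamentalWeight k) F) ∧
    ∀ c : ℕ → ℕ → ℂ,
      (∀ l ∈ Finset.Icc 1 (n - 1), ∀ i ∈ Finset.Icc 1 n, c l i ≠ 0) →
      (∀ (k : ℕ) (hk : 1 ≤ k) (hkn : k ≤ n - 2),
        TypeD.generalizedMinor (TypeD.fundamentalWeight ⟨k - 1, by omega⟩)
            w₀ (TypeD.s ⟨k - 1, by omega⟩)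
            (TypeD.thetaMinus (TypeD.cyclicWord n) (TypeD.cyclicParams n c)) =
          c k 1 + ∑ j ∈ Finset.Icc 2 (n - 2), c k j / c (k + 1) (j - 1)
            + c k (n - 1) * c k n / c (k + 1) (n - 2)
            + c (k + 1) (n - 2) / (c (k + 1) (n - 1) * c (k + 1) n)
            + c k n / c (k + 1) (n - 1)
            + c k (n - 1) / c (k + 1) n
            + ∑ j ∈ Finset.Icc (k + 2) (n - 1), c j (n - 1 + k - j) / c j (n + k - j)) ∧
      TypeD.generalizedMinor (TypeD.fundamentalWeight ⟨n - 2, by omega⟩)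
          w₀ (TypeD.s ⟨n - 2, by omega⟩)
          (TypeD.thetaMinus (TypeD.cyclicWord n) (TypeD.cyclicParams n c)) = c (n - 1) (n - 1) ∧
      TypeD.generalizedMinor (TypeD.fundamentalWeight ⟨n - 1, by omega⟩)
          w₀ (TypeD.s ⟨n - 1, by omega⟩)
          (TypeD.thetaMinus (TypeD.cyclicWord n) (TypeD.cyclicParams n c)) = c (n - 1) n := by
  refine ⟨TypeD.isReducedWord_cyclicWord hn hw₀, fun k => ?_, fun c hc => ⟨fun k hk hkn => ?_, ?_, ?_⟩⟩
  · obtain ⟨F, hF⟩ := TypeD.exists_isPrincipalMinor hn k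
    exact ⟨F, hF, fun F' hF' => hF'.unique hn hF⟩
  -- The number `k` counts from 1 and the nodes from 0, so the remaining entry is the column of
  -- index `k` over the last `n-k` blocks.
  · rw [TypeD.generalizedMinor_vec_theta hn hw₀ hc (k - 1) (by omega),
      ← TypeD.vecCol_final hn hc hk (by omega)]
    simp only [show k - 1 + 1 = k by omega, show n - 1 - (k - 1) = n - k by omega]
  · exact TypeD.generalizedMinor_spin_theta hn hw₀ hc false
  · exact TypeD.generalizedMinor_spin_theta hn hw₀ hc true
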